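/- Fix $q\in[0,1)$, $A,C\ge 0$ and $B,D\in(-1,0]$ with $A\le 1$, $C<1$. Write $(\alpha;q)_\infty=\prod_{j\ge0}(1-\alpha q^j)$, $(\alpha_1,\dots,\alpha_k;q)_\infty=\prod_j(\alpha_j;q)_\infty$, and, for $|y|<1$, $y=\cos\theta_y$, let $$f(y;a,b,c,d,q)=\frac{(q,ab,ac,ad,bc,bd,cd;q)_\infty}{2\pi\,(abcd;q)_\infty\sqrt{1-y^2}}\left|\frac{(e^{2i\theta_y};q)_\infty}{(ae^{i\theta_y},be^{i\theta_y},ce^{i\theta_y},de^{i\theta_y};q)_\infty}\right|^2$$ (and $f=0$ for $|y|\ge1$) be the density of the absolutely continuous part of the Askey–Wilson probability measure $\nu(dy;a,b,c,d,q)$. Let $(Y_t)_{0<t\le1}$ be the Askey–Wilson process with parameters $(A,B,C,D,q)$, i.e. the Markov process with marginal laws $\nu(\cdot\,;A\sqrt t,B\sqrt t,C/\sqrt t,D/\sqrt t,q)$ and transition laws from $y$ at time $s$ to time $t>s$ given by $\nu(\cdot\,;A\sqrt t,B\sqrt t,\sqrt{s/t}\,(y+\sqrt{y^2-1}),\sqrt{s/t}\,(y-\sqrt{y^2-1}),q)$,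 where $y\pm\sqrt{y^2-1}$ means $e^{\pm i\theta_y}$ for $|y|\le1$. Let $\pi_t(x)$ and $p_{s,t}(x,y)$ be the densities of the absolutely continuous parts of these marginal and transition laws (for $t$ close to $1$, and $x\in[-1,1]$, the laws are absolutely continuous). Put $$\widehat Y^{(n)}_s=2n\bigl(1-Y_{e^{-2s/\sqrt n}}\bigr),\qquad s\ge0 .$$ With $s_n=e^{-2s/\sqrt n}$, $t_n=e^{-2t/\sqrt n}$, $x_n=1-\frac u{2n}$, $y_n=1-\frac v{2n}$, let $$\widehat\pi^{(n)}_s(u)=\frac{\pi_{s_n}(x_n)}{2n},\qquad \widehat p^{(n)}_{s,t}(u,v)=\frac{p_{t_n,s_n}(y_n,x_n)\,\pi_{t_n}(y_n)}{2n\,\pi_{s_n}(x_n)}\quad(0\le s<t),$$ the latter being extended by continuity to $u=0$. Let $$\mathsf q_{s,t}(x,y)=\frac{2(t-s)\sqrt y}{\pi\left[(t-s)^4+2(t-s)^2(x+y)+(x-y)^2\right]}\mathbf 1_{\{x\ge0,\,y\ge0\}},\qquad s<t,$$ be the transition density of the tangent process $\mathsf Z$. Then: 0. For all $0\le s<t$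 and all $n$ large enough (depending on $s,t$), $\widehat\pi^{(n)}_s$ is the density of $\widehat Y^{(n)}_s$ and $\widehat p^{(n)}_{s,t}$ is the transition density of $\widehat Y^{(n)}$ from time $s$ to time $t$. For $0<s_1<\dots<s_k$ and $n$ large enough, $\prod_{i=1}^k\widehat p^{(n)}_{s_{i-1},s_i}(v_{i-1},v_i)$ (with $s_0=0$, $v_0=u$) is the conditional density at $(v_1,\dots,v_k)$ of $(\widehat Y^{(n)}_{s_1},\dots,\widehat Y^{(n)}_{s_k})$ given $\widehat Y^{(n)}_0=u$, for almost every $u$ with respect to the law of $\widehat Y^{(n)}_0$. 1. For all $0\le s<t$ and $u,v\ge0$, $\lim_{n\to\infty}\widehat p^{(n)}_{s,t}(u,v)=\mathsf q_{s,t}(u,v)$. 2. For every $u>0$ the finite-dimensional distributions of $\widehat Y^{(n)}$ given $\widehat Y^{(n)}_0=u$ converge to those of $\mathsf Z$ given $\mathsf Z_0=u$: for all $0<s_1<\dots<s_k$, with $s_0=0$, $v_0=u$, $\prod_{i=1}^k\mathsf q_{s_{i-1},s_i}(v_{i-1},v_i)$ is a probability density in $(v_1,\dots,v_k)$, and the measures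 with densities $\prod_{i=1}^k\widehat p^{(n)}_{s_{i-1},s_i}(v_{i-1},v_i)$ converge weakly to the probability measure with this density. 3. For every $u>0$, as $n\to\infty$, $$\widehat\pi^{(n)}_0(u)\sim\frac{\mathfrak c_1}{n^{3/2}}\,u^{1/2}\ \text{ if }A<1,\qquad \widehat\pi^{(n)}_0(u)\sim\frac{\mathfrak c_2}{n^{1/2}}\,\frac1{u^{1/2}}\ \text{ if }A=1,$$ where $$\mathfrak c_1=\frac{(q;q)_\infty^3}{\pi}\,\frac{(AB,AC,AD,BC,BD,CD;q)_\infty}{(ABCD;q)_\infty\,(A,B,C,D;q)_\infty^2},\qquad \mathfrak c_2=\frac{(q;q)_\infty}{\pi}\,\frac{(BC,BD,CD;q)_\infty}{(BCD,B,C,D;q)_\infty}.$$ 4. There is a constant $c$, depending only on $A,B,C,D,q$, such that for all $n$ large enough and all $u>0$, $$\widehat\pi^{(n)}_0(u)\le\frac{c}{n^{3/2}}\,u^{1/2}\ \text{ if }A<1,\qquad \widehat\pi^{(n)}_0(u)\le\frac{c}{n^{1/2}}\,\frac1{u^{1/2}}\ \text{ if }A=1 .$$ -/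

import Mathlib

open Filter Topology MeasureTheory ProbabilityTheory

noncomputable section

/-- The infinite `q`-Pochhammer symbol `(α; q)_∞ = ∏_{j ≥ 0} (1 - α q^j)`, `|q| < 1`. -/
def qPoch {K : Type*} [NormedField K] (q α : K) : K := ∏' j : ℕ, (1 - α * q ^ j)

/-- The finite `q`-Pochhammer symbol `(α; q)_n = ∏_{0 ≤ j < n} (1 - α q^j)`. -/
def qPochFin {K : Type*} [NormedField K] (q α : K) (n : ℕ) : K :=
  ∏ j ∈ Finset.range n, (1 - α * q ^ j)

/-! ### The Askey–Wilson measure -/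

/-- Density `f(y; a, b, c, d, q)` of the absolutely continuous part of the Askey–Wilson measure,
with `e^{iθ}`, `θ = arccos y`. The parameters are real or come in conjugate pairs, so that the
normalizing quotient is a real number; `.re` reads it off. -/
def awDensity (q : ℝ) (a b c d : ℂ) (y : ℝ) : ℝ :=
  if |y| < 1 then
    let e : ℂ := Complex.exp (Real.arccos y * Complex.I)
    let Q : ℂ → ℂ := qPoch (q : ℂ)
    (Q q * Q (a * b) * Q (a * c) * Q (a * d) * Q (b * c) * Q (b * d) * Q (c * d)
        / Q (a * b * c * d)).re / (2 * Real.pi * Real.sqrt (1 - y ^ 2))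
      * ‖Q (e ^ 2) / (Q (a * e) * Q (b * e) * Q (c * e) * Q (d * e))‖ ^ 2
  else 0

/-- Location `y_j = (a q^j + 1 / (a q^j)) / 2` of the `j`-th atom generated by `a`. -/
def awAtom (q : ℝ) (a : ℂ) (j : ℕ) : ℝ := ((a * q ^ j + 1 / (a * q ^ j)) / 2).re

/-- Mass `p(y_j; a, b, c, d, q)` of the `j`-th atom generated by `a`. The factors
`(qa/b; q)_j b^j = ∏_{1 ≤ i ≤ j} (b - a q^i)` (same for `c`, `d`) are written in polynomial form, so
that the formula also covers vanishing parameters `b, c, d`. -/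
def awMass (q : ℝ) (a b c d : ℂ) (j : ℕ) : ℝ :=
  let Q : ℂ → ℂ := qPoch (q : ℂ)
  let R : ℂ → ℂ := fun x => qPochFin (q : ℂ) x j
  (Q ((a ^ 2)⁻¹) * Q (b * c) * Q (b * d) * Q (c * d)
      / (Q (b / a) * Q (c / a) * Q (d / a) * Q (a * b * c * d))
    * (R (a ^ 2) * R (a * b) * R (a * c) * R (a * d) * (1 - a ^ 2 * q ^ (2 * j))
      / (R q * (∏ i ∈ Finset.Icc 1 j, (b - a * q ^ i) * (c - a * q ^ i) * (d - a * q ^ i))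
        * (1 - a ^ 2)))
    * (q / a) ^ j).re

open Classical in
/-- The atoms generated by the parameter `a`: there are some only if `|a| > 1`, one for each `j`
with `|a q^j| ≥ 1`. -/
def awAtoms (q : ℝ) (a b c d : ℂ) : Measure ℝ :=
  Measure.sum fun j : ℕ =>
    if 1 < ‖a‖ ∧ 1 ≤ ‖a * (q : ℂ) ^ j‖ then
      ENNReal.ofReal (awMass q a b c d j) • Measure.dirac (awAtom q a j)
    else 0

/-- The Askey–Wilson measure `ν(dy; a, b, c, d, q)`. -/
def awMeasure (q : ℝ) (a b c d : ℂ) : Measure ℝ :=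
  volume.withDensity (fun y => ENNReal.ofReal (awDensity q a b c d y))
    + awAtoms q a b c d + awAtoms q b a c d + awAtoms q c a b d + awAtoms q d a b c

/-! ### The Askey–Wilson process -/

/-- `y + √(y² - 1)`, understood as `e^{iθ}` with `cos θ = y` when `|y| ≤ 1`. -/
def rootPlus (y : ℝ) : ℂ :=
  if |y| ≤ 1 then Complex.exp (Real.arccos y * Complex.I) else ((y + Real.sqrt (y ^ 2 - 1) : ℝ) : ℂ)

/-- `y - √(y² - 1)`, understood as `e^{-iθ}` with `cos θ = y` when `|y| ≤ 1`. -/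
def rootMinus (y : ℝ) : ℂ :=
  if |y| ≤ 1 then Complex.exp (-(Real.arccos y * Complex.I))
  else ((y - Real.sqrt (y ^ 2 - 1) : ℝ) : ℂ)

/-- Marginal law at time `t`: `ν(·; A√t, B√t, C/√t, D/√t, q)`. -/
def awMarginal (A B C D q t : ℝ) : Measure ℝ :=
  awMeasure q ((A * √t : ℝ) : ℂ) ((B * √t : ℝ) : ℂ) ((C / √t : ℝ) : ℂ) ((D / √t : ℝ) : ℂ)

/-- Transition law from `y` at time `s` to time `t > s`:
`ν(·; A√t, B√t, √(s/t)(y + √(y²-1)), √(s/t)(y - √(y²-1)), q)`. -/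
def awTransition (A B q s t y : ℝ) : Measure ℝ :=
  awMeasure q ((A * √t : ℝ) : ℂ) ((B * √t : ℝ) : ℂ)
    ((√(s / t) : ℝ) * rootPlus y) ((√(s / t) : ℝ) * rootMinus y)

/-- `Y` is, on the time interval `(0, 1]`, a Markov process with the marginal laws and the
transition probabilities of the Askey–Wilson process with parameters `(A, B, C, D, q)`. The Markov
property is with respect to the natural filtration: for `F` in the past of `s`,
`P(F ∩ {Y_t ∈ S}) = E[1_F · P_{s,t}(Y_s, S)]`. -/
structure IsAskeyWilsonProcess {Ω : Type*} [MeasurableSpace Ω] (A B C D q : ℝ)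
    (P : Measure Ω) (Y : ℝ → Ω → ℝ) : Prop where
  measurable : ∀ t, 0 < t → t ≤ 1 → Measurable (Y t)
  marginal : ∀ t, 0 < t → t ≤ 1 → P.map (Y t) = awMarginal A B C D q t
  markov : ∀ s t, 0 < s → s < t → t ≤ 1 → ∀ S : Set ℝ, MeasurableSet S → ∀ F : Set Ω,
    MeasurableSet[⨆ r ∈ Set.Ioc 0 s, MeasurableSpace.comap (Y r) inferInstance] F →
    P (F ∩ Y t ⁻¹' S) = ∫⁻ ω in F, awTransition A B q s t (Y s ω) S ∂P

/-- The marginal density `π_t(x)` of the (absolutely continuous part of the) law at time `t`. -/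
def awMarginalDensity (A B C D q t x : ℝ) : ℝ :=
  awDensity q ((A * √t : ℝ) : ℂ) ((B * √t : ℝ) : ℂ) ((C / √t : ℝ) : ℂ) ((D / √t : ℝ) : ℂ) x

/-- The transition density `p_{s,t}(x, y)` from `x` at time `s` to `y` at time `t > s`. -/
def awTransitionDensity (A B q s t x y : ℝ) : ℝ :=
  awDensity q ((A * √t : ℝ) : ℂ) ((B * √t : ℝ) : ℂ)
    ((√(s / t) : ℝ) * rootPlus x) ((√(s / t) : ℝ) * rootMinus x) y

/-! ### The rescaled, time-reversed process -/

/-- The time change `s ↦ e^{-2s/√n}`. -/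
def revTime (n : ℕ) (s : ℝ) : ℝ := Real.exp (-2 * s / √(n : ℝ))

/-- `Ŷ^{(n)}_s = 2n (1 - Y_{e^{-2s/√n}})`. -/
def hatY {Ω : Type*} (Y : ℝ → Ω → ℝ) (n : ℕ) (s : ℝ) (ω : Ω) : ℝ :=
  2 * n * (1 - Y (revTime n s) ω)

/-- The density of `Ŷ^{(n)}_s`, by the change of variables `x = 1 - u/(2n)`. -/
def hatPi (A B C D q : ℝ) (n : ℕ) (s u : ℝ) : ℝ :=
  awMarginalDensity A B C D q (revTime n s) (1 - u / (2 * n)) / (2 * n)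

/-- The transition density of `Ŷ^{(n)}` from `u` at time `s` to `v` at time `t > s`. With
`x = 1 - u/(2n)`, `y = 1 - v/(2n)`, `s' = e^{-2s/√n}`, `t' = e^{-2t/√n}` (so `t' < s'`) it is
`p_{t',s'}(y, x) π_{t'}(y) / π_{s'}(x) / (2n)` by Bayes' formula. This quotient is
not defined at `u = 0`; the limit from the right in `u` is its continuous extension to `u = 0`, and
does not change it for `0 < u < 4n`. -/
def hatP (A B C D q : ℝ) (n : ℕ) (s t u v : ℝ) : ℝ :=
  limUnder (𝓝[>] u) fun u' : ℝ =>
    awTransitionDensity A B q (revTime n t) (revTime n s) (1 - v / (2 * n)) (1 - u' / (2 * n))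
      * awMarginalDensity A B C D q (revTime n t) (1 - v / (2 * n))
      / awMarginalDensity A B C D q (revTime n s) (1 - u' / (2 * n)) / (2 * n)

/-! ### The tangent process -/

/-- The transition density `𝗊_{s,t}(x, y)` of the tangent process `Z`. -/
def tangentDensity (s t x y : ℝ) : ℝ :=
  if 0 ≤ x ∧ 0 ≤ y then
    2 * (t - s) * √y / (Real.pi * ((t - s) ^ 4 + 2 * (t - s) ^ 2 * (x + y) + (x - y) ^ 2))
  else 0

/-- For a Markov process `X` with transition densities `p s t x y`: the law of
`(X_{s_1}, …, X_{s_k})` given `X_0 = u`, where `0 < s_1 < … < s_k`. It has the density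
`p_{0,s_1}(u, y_1) p_{s_1,s_2}(y_1, y_2) ⋯ p_{s_{k-1},s_k}(y_{k-1}, y_k)`. -/
def pathLaw (p : ℝ → ℝ → ℝ → ℝ → ℝ) {k : ℕ} (s : Fin k → ℝ) (u : ℝ) : Measure (Fin k → ℝ) :=
  volume.withDensity fun y => ENNReal.ofReal (∏ i : Fin k,
    p ((Fin.cons 0 s : Fin (k + 1) → ℝ) i.castSucc) (s i)
      ((Fin.cons u y : Fin (k + 1) → ℝ) i.castSucc) (y i))

/-! ### The constants -/

/-- The constant `𝔠₁`. -/
def tangentC1 (A B C D q : ℝ) : ℝ :=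
  let Q : ℝ → ℝ := qPoch q
  Q q ^ 3 / Real.pi * (Q (A * B) * Q (A * C) * Q (A * D) * Q (B * C) * Q (B * D) * Q (C * D)
    / (Q (A * B * C * D) * (Q A * Q B * Q C * Q D) ^ 2))

/-- The constant `𝔠₂`. -/
def tangentC2 (B C D q : ℝ) : ℝ :=
  let Q : ℝ → ℝ := qPoch q
  Q q / Real.pi * (Q (B * C) * Q (B * D) * Q (C * D) / (Q (B * C * D) * Q B * Q C * Q D))

end

/-! The Askey–Wilson process reverses well in time. In Bayes' quotient the factors containing `A`
and `B` cancel between the forward transition density and the marginal densities. What remains,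
`awBackwardDensity`, involves only `C` and `D` and is continuous in the starting point, also at `x =
1`; it therefore gives `hatP` a closed form that includes `u = 0`
(`AWParams.transition_mul_marginal`, `hatP_eq`).

Near `x = y = 1` and `t / s = 1` the only degenerate factors are the `j = 0` factors of four
`q`-products. Splitting them off (`awBackwardDensity_eq_mul`) leaves an elementary Poisson-type
kernel times a bounded factor. In that factor all parameters cancel in the limit and `2 / π` is left
(`tendsto_awBackwardFactor`). With `1 - √(t / s)` of order `1 / √n` and `1 - x`, `1 - y` of order `1
/ n`, all terms of the kernel's denominator have order `n⁻²` and the kernel converges to the tangent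
density (`tendsto_chebyshev_quotient`).

Weak convergence integrates one coordinate at a time, by dominated convergence
(`DensityConvergence.tendsto_lintegral_path`). From a fixed `u`, the density is at most a constant
times the tangent density (`eventually_hatPClosed_le_tangentDensity`). This constant grows with `u`,
so the later coordinates are controlled instead by a bound on the total mass that is uniform in the
starting point (`exists_lintegral_hatPClosed_le`), found by passing to angles and comparing with a
Cauchy kernel. The tangent density has mass one by an explicit primitive.

At time `1` the same splitting writes the marginal density as `√(1 - x ^ 2)` times a function
regular at `x = 1` if `A < 1`. If `A = 1`, the denominator has the further factor `|1 - e^{iθ}|² = 2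
(1 - x) = u / n`, which changes both exponents.

For the laws, large `n` brings all parameters into the closed unit disc, so there are no atoms. The
Markov property and Bayes' formula give the joint density by prepending one rescaled time after
another (`IsAskeyWilsonProcess.map_hatY_path`), and `condDistrib_of_density` reads off the
conditional law. No Askey–Wilson integral is evaluated: the total masses of the approximating
densities only need to be bounded. -/

noncomputable section

/-! ### Infinite `q`-products: continuity, positivity, bounds -/

section QPochhammer

theorem summable_norm_neg_mul_pow {K : Type*} [NormedField K] {q : K} (hq : ‖q‖ < 1) (α : K) :
    Summable fun j : ℕ => ‖-(α * q ^ j)‖ := by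
  simpa [norm_mul, norm_pow] using (summable_geometric_of_lt_one (norm_nonneg q) hq).mul_left ‖α‖

theorem multipliable_qPoch {K : Type*} [NormedField K] [CompleteSpace K] {q : K} (hq : ‖q‖ < 1)
    (α : K) : Multipliable fun j : ℕ => 1 - α * q ^ j := by
  simpa [sub_eq_add_neg] using multipliable_one_add_of_summable (summable_norm_neg_mul_pow hq α)

theorem qPoch_succ {K : Type*} [NormedField K] [CompleteSpace K] {q : K} (hq : ‖q‖ < 1) (α : K) :
    qPoch q α = (1 - α) * qPoch q (α * q) := by
  have h := multipliable_qPoch hq (α * q)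
  unfold qPoch
  rw [tprod_eq_zero_mul' (f := fun j : ℕ => 1 - α * q ^ j)]
  · simp [pow_succ', mul_assoc]
  · simpa [pow_succ', mul_assoc] using h

theorem qPoch_ne_zero {K : Type*} [NormedField K] [CompleteSpace K] {q : K} (hq : ‖q‖ < 1) {α : K}
    (h : ∀ j : ℕ, 1 - α * q ^ j ≠ 0) : qPoch q α ≠ 0 := by
  have := tprod_one_add_ne_zero_of_summable (f := fun j : ℕ => -(α * q ^ j))
    (by simpa [sub_eq_add_neg] using h) (summable_norm_neg_mul_pow hq α)
  simpa [qPoch, sub_eq_add_neg] using this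

theorem qPoch_ne_zero_of_norm_lt {K : Type*} [NormedField K] [CompleteSpace K] {q : K}
    (hq : ‖q‖ < 1) {α : K} (hα : ‖α‖ < 1) : qPoch q α ≠ 0 := by
  refine qPoch_ne_zero hq fun j h => ?_
  have h1 : ‖α * q ^ j‖ < 1 := by
    rw [norm_mul, norm_pow]
    exact lt_of_le_of_lt (mul_le_of_le_one_right (norm_nonneg _)
      (pow_le_one₀ (norm_nonneg _) hq.le)) hα
  rw [← sub_eq_zero.1 h] at h1
  simp at h1

/-- On the closed unit ball around `α` the terms are dominated by the geometric series `(‖α‖ + 1)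
‖q‖ ^ j`, so the partial products converge uniformly there. -/
theorem continuous_qPoch {q : ℂ} (hq : ‖q‖ < 1) : Continuous (qPoch q) := by
  rw [continuous_iff_continuousAt]
  intro α
  have hu : Summable fun j : ℕ => (‖α‖ + 1) * ‖q‖ ^ j :=
    (summable_geometric_of_lt_one (norm_nonneg q) hq).mul_left _
  have h := Summable.hasProdUniformlyOn_nat_one_add (K := Metric.closedBall α 1)
    (f := fun (j : ℕ) (z : ℂ) => -(z * q ^ j))
    (isCompact_closedBall α 1) hu (Eventually.of_forall fun j z hz => by
      rw [norm_neg, norm_mul, norm_pow]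
      gcongr
      have := norm_sub_norm_le z α
      rw [Metric.mem_closedBall, dist_eq_norm] at hz
      linarith) (fun j => by fun_prop)
  have hc : ContinuousOn (fun z => ∏' j : ℕ, (1 + -(z * q ^ j))) (Metric.closedBall α 1) := by
    refine h.tendstoUniformlyOn_finsetRange.continuousOn (Frequently.of_forall fun n => ?_)
    fun_prop
  have e : qPoch q = fun z => ∏' j : ℕ, (1 + -(z * q ^ j)) := by
    funext z
    simp [qPoch, sub_eq_add_neg]
  exact e ▸ hc.continuousAt (Metric.closedBall_mem_nhds α one_pos)

theorem qPoch_ofReal {q : ℝ} (hq : ‖q‖ < 1) (x : ℝ) :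
    qPoch (q : ℂ) (x : ℂ) = ((qPoch q x : ℝ) : ℂ) := by
  have := (multipliable_qPoch hq x).map_tprod Complex.ofRealHom Complex.continuous_ofReal
  simpa [qPoch] using this.symm

theorem qPoch_conj {q : ℝ} (hq : ‖q‖ < 1) (z : ℂ) :
    qPoch (q : ℂ) ((starRingEnd ℂ) z) = (starRingEnd ℂ) (qPoch (q : ℂ) z) := by
  have hq' : ‖(q : ℂ)‖ < 1 := by simpa using hq
  have := (multipliable_qPoch hq' z).map_tprod (starRingEnd ℂ) Complex.continuous_conj
  simpa [qPoch] using this.symm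

/-- All factors are positive, so the limit is nonnegative, and it is nonzero as a convergent product
of nonzero factors. Arbitrarily negative `x` are allowed, which suits the products with `B` and `D`.
-/
theorem qPoch_pos {q : ℝ} (hq0 : 0 ≤ q) (hq1 : q < 1) {x : ℝ} (hx : x < 1) : 0 < qPoch q x := by
  have hq : ‖q‖ < 1 := by rwa [Real.norm_of_nonneg hq0]
  have hpos : ∀ j : ℕ, 0 < 1 - x * q ^ j := fun j => by
    have h1 : q ^ j ≤ 1 := pow_le_one₀ hq0 hq1.le
    have h0 : 0 ≤ q ^ j := pow_nonneg hq0 j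
    rcases le_total x 0 with h | h <;> nlinarith
  refine lt_of_le_of_ne ?_ (qPoch_ne_zero hq fun j => (hpos j).ne').symm
  exact ge_of_tendsto (multipliable_qPoch hq x).hasProd
    (Eventually.of_forall fun s => Finset.prod_nonneg fun j _ => (hpos j).le)

theorem continuous_qPoch_real {q : ℝ} (hq : ‖q‖ < 1) : Continuous (qPoch q) := by
  have h : qPoch q = fun x : ℝ => (qPoch (q : ℂ) (x : ℂ)).re := by
    funext x; rw [qPoch_ofReal hq]; simp
  rw [h]
  exact Complex.continuous_re.comp
    ((continuous_qPoch (by simpa using hq)).comp Complex.continuous_ofReal)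

/-- The squared modulus `|(z; q)_∞|²`. -/
def qPochNormSq (q : ℝ) (z : ℂ) : ℝ := ‖qPoch (q : ℂ) z‖ ^ 2

theorem qPochNormSq_nonneg (q : ℝ) (z : ℂ) : 0 ≤ qPochNormSq q z := sq_nonneg _

theorem continuous_qPochNormSq {q : ℝ} (hq : ‖q‖ < 1) : Continuous (qPochNormSq q) :=
  ((continuous_qPoch (by simpa using hq)).norm).pow 2

theorem qPochNormSq_pos {q : ℝ} (hq : ‖q‖ < 1) {z : ℂ} (hz : ‖z‖ < 1) : 0 < qPochNormSq q z :=
  pow_pos (norm_pos_iff.2 (qPoch_ne_zero_of_norm_lt (by simpa using hq) hz)) 2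

theorem qPochNormSq_succ {q : ℝ} (hq : ‖q‖ < 1) (z : ℂ) :
    qPochNormSq q z = ‖1 - z‖ ^ 2 * qPochNormSq q (z * q) := by
  rw [qPochNormSq, qPoch_succ (by simpa using hq), norm_mul, mul_pow, qPochNormSq]

/-- On the closed disc only the `j = 0` factor can vanish. The boundary is needed for `e^{2iθ}` and
for `A√t = 1`. -/
theorem qPochNormSq_pos_of_ne {q : ℝ} (hq : ‖q‖ < 1) {z : ℂ} (hz : ‖z‖ ≤ 1) (hz1 : z ≠ 1) :
    0 < qPochNormSq q z := by
  rw [qPochNormSq_succ hq]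
  refine mul_pos (pow_pos (norm_pos_iff.2 (sub_ne_zero.2 hz1.symm)) 2) (qPochNormSq_pos hq ?_)
  rw [norm_mul, Complex.norm_real]
  exact lt_of_le_of_lt (mul_le_of_le_one_left (norm_nonneg _) hz) hq

theorem qPochNormSq_ofReal {q : ℝ} (hq : ‖q‖ < 1) (x : ℝ) :
    qPochNormSq q (x : ℂ) = qPoch q x ^ 2 := by
  rw [qPochNormSq, qPoch_ofReal hq, Complex.norm_real, Real.norm_eq_abs, sq_abs]

theorem qPoch_mul_conj {q : ℝ} (hq : ‖q‖ < 1) (z : ℂ) :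
    qPoch (q : ℂ) z * qPoch (q : ℂ) ((starRingEnd ℂ) z) = ((qPochNormSq q z : ℝ) : ℂ) := by
  rw [qPoch_conj hq, Complex.mul_conj, qPochNormSq, Complex.normSq_eq_norm_sq]

/-- Two-sided bounds of `|(z; q)_∞|²` on a closed disc of radius less than `1`. -/
theorem exists_qPochNormSq_bounds {q : ℝ} (hq : ‖q‖ < 1) {ρ : ℝ} (hρ : ρ < 1) :
    ∃ m M : ℝ, 0 < m ∧ 0 < M ∧
      (∀ z : ℂ, ‖z‖ ≤ ρ → m ≤ qPochNormSq q z) ∧ ∀ z : ℂ, ‖z‖ ≤ 1 → qPochNormSq q z ≤ M := by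
  obtain ⟨M, hM⟩ := (isCompact_closedBall (0 : ℂ) 1).bddAbove_image
    (continuous_qPochNormSq hq).continuousOn
  have hM' : ∀ z : ℂ, ‖z‖ ≤ 1 → qPochNormSq q z ≤ M := fun z hz =>
    hM ⟨z, by simpa using hz, rfl⟩
  have hM0 : 0 < M := (qPochNormSq_pos hq (z := 0) (by simp)).trans_le (hM' 0 (by simp))
  rcases lt_or_ge ρ 0 with h | h
  · exact ⟨1, M, one_pos, hM0, fun z hz => absurd (norm_nonneg z) (by linarith), hM'⟩
  · obtain ⟨z0, hz0, hmin⟩ := (isCompact_closedBall (0 : ℂ) ρ).exists_isMinOn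
      ⟨0, by simpa using h⟩ (continuous_qPochNormSq hq).continuousOn
    refine ⟨qPochNormSq q z0, M, qPochNormSq_pos hq ?_, hM0, fun z hz => ?_, hM'⟩
    · have : ‖z0‖ ≤ ρ := by simpa using hz0
      linarith
    · exact hmin (by simpa using hz)

end QPochhammer

/-! ### The point `e^{iθ}` on the unit circle and the elementary kernel -/

section ArccosExp

/-- The point `e^{iθ}`, `θ = arccos x`, of the closed upper half of the unit circle. -/
def arccosExp (x : ℝ) : ℂ := Complex.exp (Real.arccos x * Complex.I)

theorem norm_arccosExp (x : ℝ) : ‖arccosExp x‖ = 1 := Complex.norm_exp_ofReal_mul_I _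

theorem norm_mul_arccosExp (a x : ℝ) : ‖(a : ℂ) * arccosExp x‖ = |a| := by
  rw [norm_mul, norm_arccosExp, mul_one, Complex.norm_real, Real.norm_eq_abs]

theorem arccosExp_re {x : ℝ} (hx : |x| ≤ 1) : (arccosExp x).re = x := by
  rw [abs_le] at hx
  rw [arccosExp, Complex.exp_ofReal_mul_I_re, Real.cos_arccos hx.1 hx.2]

theorem arccosExp_im {x : ℝ} : (arccosExp x).im = √(1 - x ^ 2) := by
  rw [arccosExp, Complex.exp_ofReal_mul_I_im, Real.sin_arccos]

theorem continuous_arccosExp : Continuous arccosExp := by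
  unfold arccosExp
  have := Real.continuous_arccos
  fun_prop

theorem arccosExp_one : arccosExp 1 = 1 := by simp [arccosExp]

theorem conj_arccosExp (x : ℝ) :
    (starRingEnd ℂ) (arccosExp x) = Complex.exp (-(Real.arccos x * Complex.I)) := by
  rw [arccosExp, ← Complex.exp_conj]
  simp

theorem one_sub_sq_pos {x : ℝ} (hx : |x| < 1) : 0 < 1 - x ^ 2 := by
  rw [sub_pos, sq_lt_one_iff_abs_lt_one]
  exact hx

theorem norm_one_sub_sq (z : ℂ) : ‖1 - z‖ ^ 2 = 1 - 2 * z.re + ‖z‖ ^ 2 := by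
  rw [← Complex.normSq_eq_norm_sq, ← Complex.normSq_eq_norm_sq]
  simp [Complex.normSq_apply]
  ring

theorem norm_one_sub_arccosExp_sq {x : ℝ} (hx : |x| ≤ 1) :
    ‖1 - arccosExp x‖ ^ 2 = 2 * (1 - x) := by
  rw [norm_one_sub_sq, arccosExp_re hx, norm_arccosExp]
  ring

theorem sq_sqrt_one_sub {x : ℝ} (hx : |x| ≤ 1) : √(1 - x ^ 2) ^ 2 = 1 - x ^ 2 :=
  Real.sq_sqrt (by rw [sub_nonneg, sq_le_one_iff_abs_le_one]; exact hx)

theorem norm_one_sub_arccosExp_sq_sq {x : ℝ} (hx : |x| ≤ 1) :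
    ‖1 - arccosExp x ^ 2‖ ^ 2 = 4 * (1 - x ^ 2) := by
  rw [norm_one_sub_sq, norm_pow, norm_arccosExp, sq (arccosExp x), Complex.mul_re,
    arccosExp_re hx, arccosExp_im]
  linear_combination 2 * sq_sqrt_one_sub hx

theorem mul_arccosExp_ne_one {a x : ℝ} (hx : |x| < 1) : (a : ℂ) * arccosExp x ≠ 1 := by
  intro h
  have him := congrArg Complex.im h
  have hre := congrArg Complex.re h
  rw [Complex.re_ofReal_mul] at hre
  rw [Complex.im_ofReal_mul, arccosExp_im, Complex.one_im] at him
  have := Real.sqrt_pos.2 (one_sub_sq_pos hx)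
  rcases mul_eq_zero.1 him with h0 | h0
  · rw [h0] at hre; simp at hre
  · exact this.ne' h0

theorem arccosExp_sq_ne_one {x : ℝ} (hx : |x| < 1) : arccosExp x ^ 2 ≠ 1 := by
  intro h
  have := norm_one_sub_arccosExp_sq_sq hx.le
  rw [h, sub_self, norm_zero, zero_pow two_ne_zero] at this
  linarith [one_sub_sq_pos hx]

/-- The denominator of the Poisson-type kernel of the Chebyshev polynomials. -/
def chebyshevDenom (r x y : ℝ) : ℝ :=
  (1 - r) ^ 2 * ((1 - r) ^ 2 + 4 * r * (1 - x * y)) + 4 * r ^ 2 * (x - y) ^ 2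

/-- For `x = cos θ`, `y = cos φ` the two factors are `1 - 2 r cos (θ ± φ) + r ^ 2`. Their product is
polynomial in `x` and `y`, since the sines enter only through their squares. -/
theorem norm_one_sub_mul_mul (r : ℝ) {x y : ℝ} (hx : |x| ≤ 1) (hy : |y| ≤ 1) :
    ‖1 - (r : ℂ) * arccosExp y * arccosExp x‖ ^ 2 *
      ‖1 - (r : ℂ) * (starRingEnd ℂ) (arccosExp y) * arccosExp x‖ ^ 2 = chebyshevDenom r x y := by
  rw [norm_one_sub_sq, norm_one_sub_sq]
  simp only [mul_assoc, norm_mul, RCLike.norm_conj, norm_arccosExp, Complex.norm_real,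
    Complex.re_ofReal_mul]
  rw [Complex.mul_re, Complex.mul_re, Complex.conj_re, Complex.conj_im]
  simp only [arccosExp_re hx, arccosExp_re hy, arccosExp_im, mul_one, Real.norm_eq_abs, sq_abs]
  unfold chebyshevDenom
  have h1 := sq_sqrt_one_sub hx
  have h2 := sq_sqrt_one_sub hy
  linear_combination (-4 * r ^ 2 * √(1 - y ^ 2) ^ 2) * h1 - 4 * r ^ 2 * (1 - x ^ 2) * h2

end ArccosExp

/-! ### Real forms of the densities and Bayes' formula -/

section Densities

theorem awDensity_ofReal {q : ℝ} (hq : ‖q‖ < 1) (a b c d : ℝ) {y : ℝ} (hy : |y| < 1) :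
    awDensity q a b c d y =
      (qPoch q q * qPoch q (a * b) * qPoch q (a * c) * qPoch q (a * d) * qPoch q (b * c)
          * qPoch q (b * d) * qPoch q (c * d) / qPoch q (a * b * c * d))
        / (2 * Real.pi * √(1 - y ^ 2))
      * (qPochNormSq q (arccosExp y ^ 2) /
        (qPochNormSq q (a * arccosExp y) * qPochNormSq q (b * arccosExp y)
          * qPochNormSq q (c * arccosExp y) * qPochNormSq q (d * arccosExp y))) := by
  rw [awDensity, if_pos hy]
  simp only [← Complex.ofReal_mul, qPoch_ofReal hq, ← Complex.ofReal_div, Complex.ofReal_re]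
  simp only [norm_div, norm_mul, div_pow, mul_pow, qPochNormSq, arccosExp]

/-- For a conjugate pair `c, d` the products with `ac` and `ad` are conjugate and combine to a
squared modulus, and `cd = r ^ 2`. The normalizing quotient is thus real and `.re` loses nothing. -/
theorem awDensity_conj {q : ℝ} (hq : ‖q‖ < 1) (a b r : ℝ) {w : ℂ} (hw : ‖w‖ = 1) {y : ℝ}
    (hy : |y| < 1) :
    awDensity q a b (r * w) (r * (starRingEnd ℂ) w) y =
      (qPoch q q * qPoch q (a * b) * qPochNormSq q ((a * r : ℝ) * w)
          * qPochNormSq q ((b * r : ℝ) * w) * qPoch q (r ^ 2) / qPoch q (a * b * r ^ 2))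
        / (2 * Real.pi * √(1 - y ^ 2))
      * (qPochNormSq q (arccosExp y ^ 2) /
        (qPochNormSq q (a * arccosExp y) * qPochNormSq q (b * arccosExp y)
          * qPochNormSq q (r * w * arccosExp y)
          * qPochNormSq q (r * (starRingEnd ℂ) w * arccosExp y))) := by
  have hcd : (r : ℂ) * w * (r * (starRingEnd ℂ) w) = ((r ^ 2 : ℝ) : ℂ) := by
    have : w * (starRingEnd ℂ) w = 1 := by
      rw [Complex.mul_conj, Complex.normSq_eq_norm_sq, hw]; simp
    push_cast
    linear_combination (r : ℂ) ^ 2 * this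
  have hpair : ∀ e : ℝ, qPoch (q : ℂ) (e * (r * w)) * qPoch (q : ℂ) (e * (r * (starRingEnd ℂ) w))
      = ((qPochNormSq q ((e * r : ℝ) * w) : ℝ) : ℂ) := by
    intro e
    rw [← qPoch_mul_conj hq]
    simp [mul_assoc]
  rw [awDensity, if_pos hy]
  have key : (qPoch (q : ℂ) q * qPoch (q : ℂ) ((a : ℂ) * b) * qPoch (q : ℂ) ((a : ℂ) * (r * w))
      * qPoch (q : ℂ) ((a : ℂ) * (r * (starRingEnd ℂ) w)) * qPoch (q : ℂ) ((b : ℂ) * (r * w))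
      * qPoch (q : ℂ) ((b : ℂ) * (r * (starRingEnd ℂ) w))
      * qPoch (q : ℂ) ((r * w) * (r * (starRingEnd ℂ) w))
        / qPoch (q : ℂ) ((a : ℂ) * b * (r * w) * (r * (starRingEnd ℂ) w)))
      = ((qPoch q q * qPoch q (a * b) * qPochNormSq q ((a * r : ℝ) * w)
          * qPochNormSq q ((b * r : ℝ) * w) * qPoch q (r ^ 2)
          / qPoch q (a * b * r ^ 2) : ℝ) : ℂ) := by
    rw [mul_assoc ((a : ℂ) * b), hcd]
    have ha := hpair a
    have hb := hpair b
    simp only [Complex.ofReal_mul, Complex.ofReal_div, ← qPoch_ofReal hq] at ha hb ⊢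
    rw [← ha, ← hb]
    ring
  simp only [key, Complex.ofReal_re]
  simp only [norm_div, norm_mul, div_pow, mul_pow, qPochNormSq, arccosExp]

theorem awDensity_of_not_lt {q : ℝ} {a b c d : ℂ} {y : ℝ} (hy : ¬ |y| < 1) :
    awDensity q a b c d y = 0 := by
  rw [awDensity, if_neg hy]

/-- The identity `√s * √(t / s) = √t` turns the mixed products of the normalizing constant into the
`A√t` and `B√t` factors at `y`. These are the factors in the denominator of the marginal density at
time `t`, which makes Bayes' quotient simplify. -/
theorem awTransitionDensity_eq {A B q t s x y : ℝ} (hq : ‖q‖ < 1) (ht : 0 < t) (hs : 0 < s)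
    (hx : |x| < 1) (hy : |y| < 1) :
    awTransitionDensity A B q t s y x =
      (qPoch q q * qPoch q (A * B * s) * qPochNormSq q ((A * √t : ℝ) * arccosExp y)
          * qPochNormSq q ((B * √t : ℝ) * arccosExp y) * qPoch q (t / s) / qPoch q (A * B * t))
        / (2 * Real.pi * √(1 - x ^ 2))
      * (qPochNormSq q (arccosExp x ^ 2) /
        (qPochNormSq q ((A * √s : ℝ) * arccosExp x) * qPochNormSq q ((B * √s : ℝ) * arccosExp x)
          * qPochNormSq q (√(t / s) * arccosExp y * arccosExp x)
          * qPochNormSq q (√(t / s) * (starRingEnd ℂ) (arccosExp y) * arccosExp x))) := by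
  have h1 : √s * √(t / s) = √t := by
    rw [← Real.sqrt_mul hs.le, mul_div_cancel₀ _ hs.ne']
  have h2 : √(t / s) ^ 2 = t / s := Real.sq_sqrt (by positivity)
  have h3 : √s * √s = s := Real.mul_self_sqrt hs.le
  rw [awTransitionDensity, rootPlus, rootMinus, if_pos hy.le, if_pos hy.le, ← conj_arccosExp,
    ← arccosExp, awDensity_conj hq _ _ _ (norm_arccosExp y) hx, h2,
    show A * √s * √(t / s) = A * √t by rw [mul_assoc, h1],
    show B * √s * √(t / s) = B * √t by rw [mul_assoc, h1],
    show A * √s * (B * √s) = A * B * s by linear_combination A * B * h3,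
    show A * B * s * (t / s) = A * B * t by field_simp]

theorem awMarginalDensity_eq {A B C D q t x : ℝ} (hq : ‖q‖ < 1) (ht : 0 < t) (hx : |x| < 1) :
    awMarginalDensity A B C D q t x =
      (qPoch q q * qPoch q (A * B * t) * qPoch q (A * C) * qPoch q (A * D) * qPoch q (B * C)
          * qPoch q (B * D) * qPoch q (C * D / t) / qPoch q (A * B * C * D))
        / (2 * Real.pi * √(1 - x ^ 2))
      * (qPochNormSq q (arccosExp x ^ 2) /
        (qPochNormSq q ((A * √t : ℝ) * arccosExp x) * qPochNormSq q ((B * √t : ℝ) * arccosExp x)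
          * qPochNormSq q ((C / √t : ℝ) * arccosExp x)
          * qPochNormSq q ((D / √t : ℝ) * arccosExp x))) := by
  have h0 : √t ≠ 0 := (Real.sqrt_pos.2 ht).ne'
  have h1 : √t * √t = t := Real.mul_self_sqrt ht.le
  rw [awMarginalDensity, awDensity_ofReal hq _ _ _ _ hx,
    show A * √t * (B * √t) = A * B * t by linear_combination A * B * h1,
    show A * √t * (C / √t) = A * C by field_simp, show A * √t * (D / √t) = A * D by field_simp,
    show B * √t * (C / √t) = B * C by field_simp, show B * √t * (D / √t) = B * D by field_simp,
    show C / √t * (D / √t) = C * D / t by rw [div_mul_div_comm, h1],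
    show A * B * t * (C / √t) * (D / √t) = A * B * C * D by
      field_simp; linear_combination (-A * B * C * D) * h1]

/-- The transition density from `x` at time `s` back to `y` at the earlier time `t` of the
Askey–Wilson process. -/
def awBackwardDensity (C D q s t x y : ℝ) : ℝ :=
  (qPoch q q * qPoch q (t / s) * qPoch q (C * D / t) / qPoch q (C * D / s))
      / (2 * Real.pi * √(1 - y ^ 2)) * qPochNormSq q (arccosExp y ^ 2)
    * (qPochNormSq q ((C / √s : ℝ) * arccosExp x) * qPochNormSq q ((D / √s : ℝ) * arccosExp x))
    / (qPochNormSq q ((C / √t : ℝ) * arccosExp y) * qPochNormSq q ((D / √t : ℝ) * arccosExp y)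
      * qPochNormSq q (√(t / s) * arccosExp y * arccosExp x)
      * qPochNormSq q (√(t / s) * (starRingEnd ℂ) (arccosExp y) * arccosExp x))

/-- Only the quantities that cancel must be nonzero: `a, b` (the `A`, `B` factors at `y`) and `p2`
on the left, `c, d` (the `C`, `D` factors at `x`) and `p10` on the right. The other denominators
agree on both sides, so their inverses are carried along formally. -/
theorem bayes_algebra {p0 p1 p2 p3 p4 p5 p6 p7 p8 p9 p10 σ τ m n a b a' b' c d c' d' e f : ℝ}
    (ha : a ≠ 0) (hb : b ≠ 0) (hc : c ≠ 0) (hd : d ≠ 0) (h2 : p2 ≠ 0) (h10 : p10 ≠ 0) :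
    p0 * p1 * a * b * p3 / p2 / σ * (m / (a' * b' * e * f))
      * (p0 * p2 * p4 * p5 * p6 * p7 * p8 / p9 / τ * (n / (a * b * c' * d')))
    = p0 * p1 * p4 * p5 * p6 * p7 * p10 / p9 / σ * (m / (a' * b' * c * d))
      * (p0 * p3 * p8 / p10 / τ * n * (c * d) / (c' * d' * e * f)) := by
  have key : p0 * p1 * p3 * (p0 * p4 * p5 * p6 * p7 * p8) * σ⁻¹ * τ⁻¹ * p9⁻¹ * m * n
      * a'⁻¹ * b'⁻¹ * c'⁻¹ * d'⁻¹ * e⁻¹ * f⁻¹ * ((a * a⁻¹) * (b * b⁻¹) * (p2 * p2⁻¹))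
    = p0 * p1 * p3 * (p0 * p4 * p5 * p6 * p7 * p8) * σ⁻¹ * τ⁻¹ * p9⁻¹ * m * n
      * a'⁻¹ * b'⁻¹ * c'⁻¹ * d'⁻¹ * e⁻¹ * f⁻¹ * ((c * c⁻¹) * (d * d⁻¹) * (p10 * p10⁻¹)) := by
    rw [mul_inv_cancel₀ ha, mul_inv_cancel₀ hb, mul_inv_cancel₀ hc, mul_inv_cancel₀ hd,
      mul_inv_cancel₀ h2, mul_inv_cancel₀ h10]
  simp only [div_eq_mul_inv, mul_inv]
  convert key using 1 <;> ac_rfl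

/-- The constraints on the parameters, for the process at time `t ≤ 1`. -/
structure AWParams (A B C D q t : ℝ) : Prop where
  q_nonneg : 0 ≤ q
  q_lt : q < 1
  A_nonneg : 0 ≤ A
  A_le : A ≤ 1
  B_gt : -1 < B
  B_nonpos : B ≤ 0
  C_nonneg : 0 ≤ C
  D_nonpos : D ≤ 0
  t_pos : 0 < t
  t_le : t ≤ 1
  C_lt : C < √t
  D_gt : -√t < D

namespace AWParams

variable {A B C D q t s x y : ℝ}

theorem norm_q (h : AWParams A B C D q t) : ‖q‖ < 1 := by
  rw [Real.norm_of_nonneg h.q_nonneg]; exact h.q_lt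

theorem sqrt_pos (h : AWParams A B C D q t) : 0 < √t := Real.sqrt_pos.2 h.t_pos

theorem sqrt_le (h : AWParams A B C D q t) : √t ≤ 1 := Real.sqrt_le_one.2 h.t_le

theorem mono (h : AWParams A B C D q t) (hts : t ≤ s) (hs : s ≤ 1) : AWParams A B C D q s :=
  { h with
    t_pos := h.t_pos.trans_le hts
    t_le := hs
    C_lt := h.C_lt.trans_le (Real.sqrt_le_sqrt hts)
    D_gt := (neg_le_neg (Real.sqrt_le_sqrt hts)).trans_lt h.D_gt }

theorem abs_A (h : AWParams A B C D q t) : |A * √t| ≤ 1 := by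
  rw [abs_of_nonneg (mul_nonneg h.A_nonneg h.sqrt_pos.le)]
  exact mul_le_one₀ h.A_le h.sqrt_pos.le h.sqrt_le

theorem abs_B (h : AWParams A B C D q t) : |B * √t| < 1 := by
  rw [abs_of_nonpos (mul_nonpos_of_nonpos_of_nonneg h.B_nonpos h.sqrt_pos.le)]
  nlinarith [h.B_gt, h.B_nonpos, h.sqrt_pos, h.sqrt_le]

theorem abs_C (h : AWParams A B C D q t) : |C / √t| < 1 := by
  rw [abs_of_nonneg (div_nonneg h.C_nonneg h.sqrt_pos.le), div_lt_one h.sqrt_pos]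
  exact h.C_lt

theorem abs_D (h : AWParams A B C D q t) : |D / √t| < 1 := by
  rw [abs_of_nonpos (div_nonpos_of_nonpos_of_nonneg h.D_nonpos h.sqrt_pos.le), ← neg_div,
    div_lt_one h.sqrt_pos]
  linarith [h.D_gt]

theorem CD_nonpos (h : AWParams A B C D q t) : C * D ≤ 0 :=
  mul_nonpos_of_nonneg_of_nonpos h.C_nonneg h.D_nonpos

theorem qPoch_CD_pos (h : AWParams A B C D q t) : 0 < qPoch q (C * D / t) :=
  qPoch_pos h.q_nonneg h.q_lt
    ((div_nonpos_of_nonpos_of_nonneg h.CD_nonpos h.t_pos.le).trans_lt one_pos)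

theorem qPoch_AB_pos (h : AWParams A B C D q t) : 0 < qPoch q (A * B * t) :=
  qPoch_pos h.q_nonneg h.q_lt ((mul_nonpos_of_nonpos_of_nonneg
    (mul_nonpos_of_nonneg_of_nonpos h.A_nonneg h.B_nonpos) h.t_pos.le).trans_lt one_pos)

theorem C_lt_one (h : AWParams A B C D q t) : C < 1 := h.C_lt.trans_le h.sqrt_le

theorem D_gt_neg_one (h : AWParams A B C D q t) : -1 < D :=
  (neg_le_neg h.sqrt_le).trans_lt h.D_gt

theorem ABCD_lt (h : AWParams A B C D q t) : A * B * C * D < 1 := by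
  have h1 : 0 ≤ A * -B := mul_nonneg h.A_nonneg (by linarith [h.B_nonpos])
  have h2 : A * -B ≤ 1 := mul_le_one₀ h.A_le (by linarith [h.B_nonpos]) (by linarith [h.B_gt])
  have h3 : 0 ≤ C * -D := mul_nonneg h.C_nonneg (by linarith [h.D_nonpos])
  have h4 : C * -D < 1 := by nlinarith [h.C_nonneg, h.D_nonpos, h.C_lt_one, h.D_gt_neg_one]
  nlinarith

/-- The normalizing constant of the marginal law at time `t`. -/
theorem const_pos (h : AWParams A B C D q t) :
    0 < qPoch q q * qPoch q (A * B * t) * qPoch q (A * C) * qPoch q (A * D) * qPoch q (B * C)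
          * qPoch q (B * D) * qPoch q (C * D / t) / qPoch q (A * B * C * D) := by
  have hp := fun {x : ℝ} (hx : x < 1) => qPoch_pos h.q_nonneg h.q_lt hx
  have hAC : A * C < 1 := (mul_le_of_le_one_left h.C_nonneg h.A_le).trans_lt h.C_lt_one
  have hAD : A * D < 1 := (mul_nonpos_of_nonneg_of_nonpos h.A_nonneg h.D_nonpos).trans_lt one_pos
  have hBC : B * C < 1 := (mul_nonpos_of_nonpos_of_nonneg h.B_nonpos h.C_nonneg).trans_lt one_pos
  have hBD : B * D < 1 := by nlinarith [h.B_gt, h.B_nonpos, h.D_nonpos, h.D_gt_neg_one]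
  have := hp h.q_lt
  have := hp hAC
  have := hp hAD
  have := hp hBC
  have := hp hBD
  have := hp h.ABCD_lt
  have := h.qPoch_AB_pos
  have := h.qPoch_CD_pos
  positivity

theorem normSq_A_pos (h : AWParams A B C D q t) (hx : |x| < 1) :
    0 < qPochNormSq q ((A * √t : ℝ) * arccosExp x) :=
  qPochNormSq_pos_of_ne h.norm_q (by rw [norm_mul_arccosExp]; exact h.abs_A)
    (mul_arccosExp_ne_one hx)

theorem normSq_B_pos (h : AWParams A B C D q t) : 0 < qPochNormSq q ((B * √t : ℝ) * arccosExp x) :=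
  qPochNormSq_pos h.norm_q (by rw [norm_mul_arccosExp]; exact h.abs_B)

theorem normSq_C_pos (h : AWParams A B C D q t) : 0 < qPochNormSq q ((C / √t : ℝ) * arccosExp x) :=
  qPochNormSq_pos h.norm_q (by rw [norm_mul_arccosExp]; exact h.abs_C)

theorem normSq_D_pos (h : AWParams A B C D q t) : 0 < qPochNormSq q ((D / √t : ℝ) * arccosExp x) :=
  qPochNormSq_pos h.norm_q (by rw [norm_mul_arccosExp]; exact h.abs_D)

theorem normSq_arccosExp_sq_pos (h : AWParams A B C D q t) (hx : |x| < 1) :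
    0 < qPochNormSq q (arccosExp x ^ 2) :=
  qPochNormSq_pos_of_ne h.norm_q (by simp [norm_arccosExp]) (arccosExp_sq_ne_one hx)

theorem awMarginalDensity_pos (h : AWParams A B C D q t) (hx : |x| < 1) :
    0 < awMarginalDensity A B C D q t x := by
  rw [awMarginalDensity_eq h.norm_q h.t_pos hx]
  have h1 := h.const_pos
  have h2 := Real.sqrt_pos.2 (one_sub_sq_pos hx)
  have h3 := h.normSq_A_pos hx
  have h4 := h.normSq_B_pos (x := x)
  have h5 := h.normSq_C_pos (x := x)
  have h6 := h.normSq_D_pos (x := x)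
  have h7 := h.normSq_arccosExp_sq_pos hx
  refine mul_pos (div_pos h1 ?_) (div_pos h7 ?_) <;> positivity

theorem norm_sqrt_div_mul (h : AWParams A B C D q t) (hts : t < s) (z w : ℂ) (hz : ‖z‖ = 1)
    (hw : ‖w‖ = 1) : ‖(√(t / s) : ℂ) * z * w‖ < 1 := by
  rw [norm_mul, norm_mul, hz, hw, mul_one, mul_one, Complex.norm_real,
    Real.norm_of_nonneg (Real.sqrt_nonneg _), Real.sqrt_lt' one_pos, one_pow,
    div_lt_one (h.t_pos.trans hts)]
  exact hts

theorem normSq_plus_pos (h : AWParams A B C D q t) (hts : t < s) :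
    0 < qPochNormSq q (√(t / s) * arccosExp y * arccosExp x) :=
  qPochNormSq_pos h.norm_q (h.norm_sqrt_div_mul hts _ _ (norm_arccosExp y) (norm_arccosExp x))

theorem normSq_minus_pos (h : AWParams A B C D q t) (hts : t < s) :
    0 < qPochNormSq q (√(t / s) * (starRingEnd ℂ) (arccosExp y) * arccosExp x) :=
  qPochNormSq_pos h.norm_q (h.norm_sqrt_div_mul hts _ _
    (by rw [RCLike.norm_conj, norm_arccosExp]) (norm_arccosExp x))

/-- Bayes' formula. -/
theorem transition_mul_marginal (h : AWParams A B C D q t) (hts : t < s) (hs : s ≤ 1)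
    (hx : |x| < 1) (hy : |y| < 1) :
    awTransitionDensity A B q t s y x * awMarginalDensity A B C D q t y
      = awMarginalDensity A B C D q s x * awBackwardDensity C D q s t x y := by
  have h' := h.mono hts.le hs
  rw [awTransitionDensity_eq h.norm_q h.t_pos h'.t_pos hx hy,
    awMarginalDensity_eq h.norm_q h.t_pos hy, awMarginalDensity_eq h.norm_q h'.t_pos hx,
    awBackwardDensity]
  have a1 := (h.normSq_A_pos hy).ne'
  have a2 := (h.normSq_B_pos (x := y)).ne'
  have a3 := (h'.normSq_C_pos (x := x)).ne'
  have a4 := (h'.normSq_D_pos (x := x)).ne'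
  have a5 := h.qPoch_AB_pos.ne'
  have a6 := h'.qPoch_CD_pos.ne'
  exact bayes_algebra a1 a2 a3 a4 a5 a6

theorem awBackwardDensity_nonneg (h : AWParams A B C D q t) (hts : t < s) (hs : s ≤ 1) :
    0 ≤ awBackwardDensity C D q s t x y := by
  have h' := h.mono hts.le hs
  have h1 := qPoch_pos h.q_nonneg h.q_lt h.q_lt
  have h2 := qPoch_pos h.q_nonneg h.q_lt (x := t / s) (by rwa [div_lt_one (h.t_pos.trans hts)])
  have h3 := h.qPoch_CD_pos
  have h4 := h'.qPoch_CD_pos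
  have h5 := fun z => qPochNormSq_nonneg q z
  have h6 := Real.sqrt_nonneg (1 - y ^ 2)
  have h7 := Real.pi_pos
  unfold awBackwardDensity
  refine div_nonneg (mul_nonneg (mul_nonneg (div_nonneg ?_ ?_) (h5 _)) (mul_nonneg (h5 _) (h5 _)))
    (mul_nonneg (mul_nonneg (mul_nonneg (h5 _) (h5 _)) (h5 _)) (h5 _)) <;> positivity

end AWParams

end Densities

/-! ### The time change -/

section RevTime

theorem revTime_pos (n : ℕ) (s : ℝ) : 0 < revTime n s := Real.exp_pos _

theorem revTime_le_one (n : ℕ) {s : ℝ} (hs : 0 ≤ s) : revTime n s ≤ 1 := by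
  rw [revTime, Real.exp_le_one_iff]
  exact div_nonpos_of_nonpos_of_nonneg (by linarith) (Real.sqrt_nonneg _)

theorem revTime_zero (n : ℕ) : revTime n 0 = 1 := by simp [revTime]

theorem revTime_lt {n : ℕ} (hn : 0 < n) {s t : ℝ} (hst : s < t) : revTime n t < revTime n s := by
  have : (0 : ℝ) < √n := Real.sqrt_pos.2 (by exact_mod_cast hn)
  rw [revTime, revTime, Real.exp_lt_exp, div_lt_div_iff_of_pos_right this]
  linarith

theorem revTime_le {n : ℕ} {s t : ℝ} (hst : s ≤ t) : revTime n t ≤ revTime n s := by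
  rw [revTime, revTime, Real.exp_le_exp]
  exact div_le_div_of_nonneg_right (by linarith) (Real.sqrt_nonneg _)

theorem revTime_div (n : ℕ) (s t : ℝ) : revTime n t / revTime n s = revTime n (t - s) := by
  rw [revTime, revTime, revTime, ← Real.exp_sub]
  congr 1
  ring

theorem sqrt_revTime (n : ℕ) (s : ℝ) : √(revTime n s) = Real.exp (-s / √n) := by
  rw [revTime, Real.sqrt_eq_iff_mul_self_eq (Real.exp_pos _).le (Real.exp_pos _).le,
    ← Real.exp_add]
  congr 1
  ring

theorem tendsto_sqrt_natCast : Tendsto (fun n : ℕ => √(n : ℝ)) atTop atTop :=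
  Real.tendsto_sqrt_atTop.comp tendsto_natCast_atTop_atTop

theorem tendsto_revTime (s : ℝ) : Tendsto (fun n : ℕ => revTime n s) atTop (𝓝 1) := by
  have h : Tendsto (fun n : ℕ => -2 * s / √(n : ℝ)) atTop (𝓝 0) :=
    tendsto_const_nhds.div_atTop tendsto_sqrt_natCast
  simpa [revTime, Function.comp_def] using (Real.continuous_exp.tendsto 0).comp h

theorem tendsto_sqrt_mul_one_sub_exp (a : ℝ) :
    Tendsto (fun n : ℕ => √(n : ℝ) * (1 - Real.exp (-a / √(n : ℝ)))) atTop (𝓝 a) := by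
  have hd : HasDerivAt (fun h : ℝ => 1 - Real.exp (-a * h)) a 0 := by
    have h1 : HasDerivAt (fun h : ℝ => -a * h) (-a) 0 := by
      simpa using (hasDerivAt_id (0 : ℝ)).const_mul (-a)
    have h2 := (h1.exp).const_sub 1
    simpa using h2
  have hs := hd.tendsto_slope_zero
  have h0 : Tendsto (fun n : ℕ => (√(n : ℝ))⁻¹) atTop (𝓝[≠] 0) := by
    refine tendsto_nhdsWithin_iff.2 ⟨tendsto_sqrt_natCast.inv_tendsto_atTop, ?_⟩
    filter_upwards [eventually_gt_atTop 0] with n hn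
    have : (0 : ℝ) < √n := Real.sqrt_pos.2 (by exact_mod_cast hn)
    simpa using this.ne'
  refine (hs.comp h0).congr fun n => ?_
  simp [div_eq_mul_inv]

/-- Since `revTime n t` tends to `1`, the strict inequalities for `C` and `D` survive the division
by its square root. This is what "for `n` large enough" means throughout. -/
theorem eventually_AWParams {A B C D q : ℝ} (hq0 : 0 ≤ q) (hq1 : q < 1)
    (hA0 : 0 ≤ A) (hA1 : A ≤ 1) (hC0 : 0 ≤ C) (hC1 : C < 1)
    (hB0 : -1 < B) (hB1 : B ≤ 0) (hD0 : -1 < D) (hD1 : D ≤ 0) {t : ℝ} (ht : 0 ≤ t) :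
    ∀ᶠ n : ℕ in atTop, AWParams A B C D q (revTime n t) := by
  have h : Tendsto (fun n : ℕ => √(revTime n t)) atTop (𝓝 1) := by
    simpa [Function.comp_def] using (Real.continuous_sqrt.tendsto 1).comp (tendsto_revTime t)
  filter_upwards [h.eventually_const_lt hC1, h.eventually_const_lt (by linarith : -D < 1)]
    with n h1 h2
  exact ⟨hq0, hq1, hA0, hA1, hB0, hB1, hC0, hD1, revTime_pos n t, revTime_le_one n ht, h1,
    by linarith⟩

end RevTime

/-! ### Closed form of the rescaled transition density -/

section Closed

variable {A B C D q : ℝ}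

namespace AWParams

variable {t s x y : ℝ}

theorem continuous_awBackwardDensity (h : AWParams A B C D q t) (hts : t < s) :
    Continuous fun x => awBackwardDensity C D q s t x y := by
  have hN := continuous_qPochNormSq h.norm_q
  have he := continuous_arccosExp
  unfold awBackwardDensity
  refine Continuous.div (by fun_prop) (by fun_prop) fun x => ?_
  have h1 := h.normSq_C_pos (x := y)
  have h2 := h.normSq_D_pos (x := y)
  have h3 := h.normSq_plus_pos hts (x := x) (y := y)
  have h4 := h.normSq_minus_pos hts (x := x) (y := y)
  positivity

theorem measurable_awBackwardDensity (h : AWParams A B C D q t) :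
    Measurable fun p : ℝ × ℝ => awBackwardDensity C D q s t p.1 p.2 := by
  have hN := (continuous_qPochNormSq h.norm_q).measurable
  have he := continuous_arccosExp.measurable
  have hc := Complex.continuous_conj.measurable
  unfold awBackwardDensity
  fun_prop

end AWParams

/-- Closed form of the transition density of the rescaled process. -/
def hatPClosed (C D q : ℝ) (n : ℕ) (s t u v : ℝ) : ℝ :=
  if 0 ≤ u ∧ u < 4 * n ∧ 0 < v ∧ v < 4 * n then
    awBackwardDensity C D q (revTime n s) (revTime n t) (1 - u / (2 * n)) (1 - v / (2 * n))
      / (2 * n)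
  else 0

theorem abs_one_sub_lt_one {n : ℕ} (hn : 0 < n) {u : ℝ} :
    |1 - u / (2 * n)| < 1 ↔ 0 < u ∧ u < 4 * n := by
  have : (0 : ℝ) < 2 * n := by positivity
  rw [abs_lt]
  constructor
  · rintro ⟨h1, h2⟩
    have h3 : 0 < u / (2 * n) := by linarith
    have h4 : u / (2 * n) < 2 := by linarith
    rw [div_lt_iff₀ this] at h4
    exact ⟨by simpa [this] using h3, by linarith⟩
  · rintro ⟨h1, h2⟩
    have h3 : 0 < u / (2 * n) := by positivity
    have h4 : u / (2 * n) < 2 := by rw [div_lt_iff₀ this]; linarith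
    constructor <;> linarith

theorem abs_one_sub_le_one {n : ℕ} (hn : 0 < n) {u : ℝ} (h0 : 0 ≤ u) (h1 : u ≤ 4 * n) :
    |1 - u / (2 * n)| ≤ 1 := by
  have : (0 : ℝ) < 2 * n := by positivity
  have h3 : 0 ≤ u / (2 * n) := by positivity
  have h4 : u / (2 * n) ≤ 2 := by rw [div_le_iff₀ this]; linarith
  rw [abs_le]
  constructor <;> linarith

theorem awMarginalDensity_of_not_lt {t x : ℝ} (hx : ¬ |x| < 1) :
    awMarginalDensity A B C D q t x = 0 :=
  awDensity_of_not_lt hx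

/-- For `u'` slightly to the right of `u` in `[0, 4n)`, Bayes' formula identifies the quotient with
a function continuous in `u'`, so the right limit is its value at `u`, including `u = 0`. -/
theorem hatP_eq {n : ℕ} (hn : 0 < n) {s t : ℝ} (hs : 0 ≤ s) (hst : s < t)
    (h : AWParams A B C D q (revTime n t)) (u v : ℝ) :
    hatP A B C D q n s t u v = hatPClosed C D q n s t u v := by
  have hts := revTime_lt hn hst
  have hs1 := revTime_le_one n hs
  have h' := h.mono hts.le hs1
  rw [hatP]
  apply Tendsto.limUnder_eq
  rw [hatPClosed]
  split_ifs with hc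
  · obtain ⟨hu0, hu1, hv⟩ := hc
    have hy := (abs_one_sub_lt_one hn).2 hv
    have hcont := ((h.continuous_awBackwardDensity hts (y := 1 - v / (2 * n))).comp
      (by fun_prop : Continuous fun u : ℝ => 1 - u / (2 * n))).div_const (2 * n : ℝ)
    refine ((hcont.tendsto u).mono_left nhdsWithin_le_nhds).congr' ?_
    filter_upwards [Ioo_mem_nhdsGT hu1] with u' hu'
    have hx := (abs_one_sub_lt_one hn).2 ⟨hu0.trans_lt hu'.1, hu'.2⟩
    rw [h.transition_mul_marginal hts hs1 hx hy,
      mul_div_cancel_left₀ _ (h'.awMarginalDensity_pos hx).ne', Function.comp]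
  -- Here one of the two marginal densities vanishes on a right neighbourhood of `u`. If it is the
  -- denominator, the quotient is `0` by the convention `x / 0 = 0`.
  · refine tendsto_const_nhds.congr' ?_
    by_cases hv : 0 < v ∧ v < 4 * n
    · rcases lt_or_ge u 0 with hu | hu
      · filter_upwards [Ioo_mem_nhdsGT hu] with u' hu'
        rw [awMarginalDensity_of_not_lt (x := 1 - u' / (2 * n))
          (by rw [abs_one_sub_lt_one hn]; intro hh; linarith [hh.1, hu'.2])]
        simp
      · have hu4 : 4 * n ≤ u := by
          by_contra! hlt
          exact hc ⟨hu, hlt, hv⟩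
        filter_upwards [self_mem_nhdsWithin] with u' hu'
        rw [awMarginalDensity_of_not_lt (x := 1 - u' / (2 * n))
          (by rw [abs_one_sub_lt_one hn]; intro hh; linarith [hh.2, Set.mem_Ioi.1 hu'])]
        simp
    · refine Eventually.of_forall fun u' => ?_
      rw [awMarginalDensity_of_not_lt (x := 1 - v / (2 * n)) (by rwa [abs_one_sub_lt_one hn])]
      simp

theorem hatPClosed_nonneg {n : ℕ} (hn : 0 < n) {s t : ℝ} (hs : 0 ≤ s) (hst : s < t)
    (h : AWParams A B C D q (revTime n t)) (u v : ℝ) : 0 ≤ hatPClosed C D q n s t u v := by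
  rw [hatPClosed]
  split_ifs
  · exact div_nonneg (h.awBackwardDensity_nonneg (revTime_lt hn hst) (revTime_le_one n hs))
      (by positivity)
  · exact le_rfl

theorem measurable_hatPClosed {n : ℕ} {s t : ℝ} (h : AWParams A B C D q (revTime n t)) :
    Measurable fun p : ℝ × ℝ => hatPClosed C D q n s t p.1 p.2 := by
  unfold hatPClosed
  refine Measurable.ite ?_ ?_ measurable_const
  · exact (measurableSet_le measurable_const measurable_fst).inter
      ((measurableSet_lt measurable_fst measurable_const).inter
        ((measurableSet_lt measurable_const measurable_snd).inter
          (measurableSet_lt measurable_snd measurable_const)))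
  · have hm := h.measurable_awBackwardDensity (s := revTime n s)
    exact (hm.comp (by fun_prop :
      Measurable fun p : ℝ × ℝ => (1 - p.1 / (2 * n : ℝ), 1 - p.2 / (2 * n : ℝ)))).div_const _

/-- The factor of `awBackwardDensity` that is bounded and converges. -/
def awBackwardFactor (C D q s t x y : ℝ) : ℝ :=
  2 / Real.pi * (qPoch q q * qPoch q (t / s * q) * qPoch q (C * D / t) / qPoch q (C * D / s))
    * qPochNormSq q (arccosExp y ^ 2 * q)
    * (qPochNormSq q ((C / √s : ℝ) * arccosExp x) * qPochNormSq q ((D / √s : ℝ) * arccosExp x))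
    / (qPochNormSq q ((C / √t : ℝ) * arccosExp y) * qPochNormSq q ((D / √t : ℝ) * arccosExp y)
      * qPochNormSq q (√(t / s) * arccosExp y * arccosExp x * q)
      * qPochNormSq q (√(t / s) * (starRingEnd ℂ) (arccosExp y) * arccosExp x * q))

/-- The `j = 0` factors are split off from exactly those products that vanish at `x = y = 1`, `t =
s`: the ones of `e^{2iθ}`, of `t / s`, and the two that couple `x` and `y`. Every product left over
has its argument multiplied by `q`, or involves `C`, `D`, and stays away from zero. -/
theorem awBackwardDensity_eq_mul (hq : ‖q‖ < 1) {s t x y : ℝ} (hx : |x| ≤ 1) (hy : |y| < 1) :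
    awBackwardDensity C D q s t x y =
      √(1 - y ^ 2) * (1 - t / s) / chebyshevDenom √(t / s) x y
        * awBackwardFactor C D q s t x y := by
  have h1 := Real.sqrt_pos.2 (one_sub_sq_pos hy)
  rw [awBackwardDensity, awBackwardFactor, qPochNormSq_succ hq (arccosExp y ^ 2),
    norm_one_sub_arccosExp_sq_sq hy.le, qPochNormSq_succ hq (√(t / s) * arccosExp y * arccosExp x),
    qPochNormSq_succ hq (√(t / s) * (starRingEnd ℂ) (arccosExp y) * arccosExp x),
    qPoch_succ hq (t / s), ← norm_one_sub_mul_mul _ hx hy.le]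
  have e : 4 * (1 - y ^ 2) / (2 * Real.pi * √(1 - y ^ 2)) = 2 * √(1 - y ^ 2) / Real.pi := by
    have := Real.pi_pos
    rw [div_eq_div_iff (by positivity) this.ne']
    linear_combination (-4 * Real.pi) * sq_sqrt_one_sub hy.le
  generalize √(1 - y ^ 2) = σ at *
  generalize 1 - y ^ 2 = w at *
  generalize qPochNormSq q (↑(C / √s) * arccosExp x) = z1
  generalize qPochNormSq q (↑(D / √s) * arccosExp x) = z2
  generalize qPochNormSq q (arccosExp y ^ 2 * q) = z3
  generalize qPochNormSq q (↑(C / √t) * arccosExp y) = z4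
  generalize qPochNormSq q (↑(D / √t) * arccosExp y) = z5
  generalize qPochNormSq q _ = z6
  generalize qPochNormSq q _ = z7
  generalize ‖(_ : ℂ)‖ = z8
  generalize ‖(_ : ℂ)‖ = z9
  generalize qPoch q q = z10
  generalize qPoch q _ = z11
  generalize qPoch q _ = z12
  generalize qPoch q _ = z13
  generalize t / s = z14
  linear_combination z10 * (1 - z14) * z11 * z12 / z13 * z3 * z1 * z2
    / (z4 * z5 * z8 ^ 2 * z6 * z9 ^ 2 * z7) * e

end Closed

/-! ### Uniform bounds for the two factors -/

section Bounds

variable {A B C D q : ℝ}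

theorem qPoch_eq_sqrt (hq0 : 0 ≤ q) (hq1 : q < 1) {x : ℝ} (hx : x < 1) :
    qPoch q x = √(qPochNormSq q (x : ℂ)) := by
  rw [qPochNormSq_ofReal (by rwa [Real.norm_of_nonneg hq0]), Real.sqrt_sq (qPoch_pos hq0 hq1 hx).le]

/-- All arguments in the denominator lie in the disc of radius `ρ = max q (max |C / √t₀| |D / √t₀|)
< 1`, for every `t ≥ t₀`, and those in the numerator lie in the unit disc. Compactness does the
rest. -/
theorem AWParams.exists_awBackwardFactor_le {t₀ : ℝ} (h : AWParams A B C D q t₀) :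
    ∃ K : ℝ, 0 < K ∧ ∀ s t x y : ℝ, t₀ ≤ t → t < s → s ≤ 1 →
      awBackwardFactor C D q s t x y ≤ K := by
  set ρ := max q (max |C / √t₀| |D / √t₀|) with hρ
  have hρ1 : ρ < 1 := max_lt h.q_lt (max_lt h.abs_C h.abs_D)
  obtain ⟨m, M, hm, hM, hlow, hup⟩ := exists_qPochNormSq_bounds h.norm_q hρ1
  refine ⟨2 / Real.pi * (√M * √M * √M / √m) * M * (M * M) / (m * m * m * m), ?_, ?_⟩
  · have := Real.pi_pos
    positivity
  intro s t x y h0 hts hs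
  have ht := h.mono h0 (hts.le.trans hs)
  have hs' := ht.mono hts.le hs
  have hmono : ∀ (E τ : ℝ), t₀ ≤ τ → |E / √τ| ≤ |E / √t₀| := fun E τ hτ => by
    rw [abs_div, abs_div, abs_of_nonneg (Real.sqrt_nonneg _), abs_of_nonneg (Real.sqrt_nonneg _)]
    exact div_le_div_of_nonneg_left (abs_nonneg _) h.sqrt_pos (Real.sqrt_le_sqrt hτ)
  have hCρ : ∀ τ, t₀ ≤ τ → |C / √τ| ≤ ρ := fun τ hτ =>
    (hmono C τ hτ).trans ((le_max_left _ _).trans (le_max_right _ _))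
  have hDρ : ∀ τ, t₀ ≤ τ → |D / √τ| ≤ ρ := fun τ hτ =>
    (hmono D τ hτ).trans ((le_max_right _ _).trans (le_max_right _ _))
  have hqρ : q ≤ ρ := le_max_left _ _
  have hρ0 : 0 ≤ ρ := h.q_nonneg.trans hqρ
  have hCD : ∀ τ, t₀ ≤ τ → 0 < τ → |C * D / τ| ≤ ρ := fun τ hτ hτ0 => by
    have : C * D / τ = C / √τ * (D / √τ) := by
      rw [div_mul_div_comm, Real.mul_self_sqrt hτ0.le]
    rw [this, abs_mul]
    calc |C / √τ| * |D / √τ| ≤ ρ * ρ := by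
          gcongr
          exacts [hCρ τ hτ, hDρ τ hτ]
      _ ≤ ρ := mul_le_of_le_one_left hρ0 hρ1.le
  have hreal : ∀ z : ℝ, |z| < 1 → qPoch q z ≤ √M := fun z hz => by
    rw [qPoch_eq_sqrt h.q_nonneg h.q_lt (lt_of_abs_lt hz)]
    exact Real.sqrt_le_sqrt (hup _ (by simpa using hz.le))
  have hreal' : ∀ z : ℝ, |z| ≤ ρ → √m ≤ qPoch q z := fun z hz => by
    rw [qPoch_eq_sqrt h.q_nonneg h.q_lt (lt_of_abs_lt (hz.trans_lt hρ1))]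
    exact Real.sqrt_le_sqrt (hlow _ (by simpa using hz))
  have hpos : ∀ z : ℝ, z < 1 → 0 ≤ qPoch q z := fun z hz =>
    (qPoch_pos h.q_nonneg h.q_lt hz).le
  have hN := fun z => qPochNormSq_nonneg q z
  have hts1 : t / s < 1 := by rwa [div_lt_one (ht.t_pos.trans hts)]
  have hts0 : 0 ≤ t / s := div_nonneg ht.t_pos.le hs'.t_pos.le
  have htsq : |t / s * q| < 1 := by
    rw [abs_of_nonneg (mul_nonneg hts0 h.q_nonneg)]
    exact (mul_le_of_le_one_left h.q_nonneg hts1.le).trans_lt h.q_lt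
  have hmulq : ∀ z w : ℂ, ‖z‖ = 1 → ‖w‖ = 1 → ‖(√(t / s) : ℂ) * z * w * q‖ ≤ ρ :=
    fun z w hz hw => by
      rw [norm_mul, Complex.norm_real, Real.norm_of_nonneg h.q_nonneg]
      exact (mul_le_of_le_one_left h.q_nonneg (ht.norm_sqrt_div_mul hts z w hz hw).le).trans hqρ
  have e := norm_arccosExp
  have ec : ‖(starRingEnd ℂ) (arccosExp y)‖ = 1 := by rw [RCLike.norm_conj, e]
  have hCDt := hCD t h0 ht.t_pos
  have hCDs := hCD s (h0.trans hts.le) hs'.t_pos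
  have b1 := hreal q (by rw [abs_of_nonneg h.q_nonneg]; exact h.q_lt)
  have b2 := hreal _ htsq
  have b3 := hreal _ (hCDt.trans_lt hρ1)
  have b4 := hreal' _ hCDs
  have c1 := hpos q h.q_lt
  have c2 := hpos _ (lt_of_abs_lt htsq)
  have c3 := ht.qPoch_CD_pos.le
  have b5 := hup (arccosExp y ^ 2 * q) (by
    rw [norm_mul, norm_pow, e, one_pow, one_mul, Complex.norm_real, Real.norm_of_nonneg h.q_nonneg]
    exact h.q_lt.le)
  have b6 := hup ((C / √s : ℝ) * arccosExp x) (by rw [norm_mul_arccosExp]; exact hs'.abs_C.le)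
  have b7 := hup ((D / √s : ℝ) * arccosExp x) (by rw [norm_mul_arccosExp]; exact hs'.abs_D.le)
  have d1 := hlow ((C / √t : ℝ) * arccosExp y) (by rw [norm_mul_arccosExp]; exact hCρ t h0)
  have d2 := hlow ((D / √t : ℝ) * arccosExp y) (by rw [norm_mul_arccosExp]; exact hDρ t h0)
  have d3 := hlow _ (hmulq (arccosExp y) (arccosExp x) (e y) (e x))
  have d4 := hlow _ (hmulq _ (arccosExp x) ec (e x))
  have hm' := Real.sqrt_pos.2 hm
  have hpi := Real.pi_pos
  unfold awBackwardFactor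
  gcongr
  all_goals first | exact hN _ | exact mul_nonneg (hN _) (hN _) |
    exact mul_nonneg (mul_nonneg (hN _) (hN _)) (hN _)

/-- The term with `1 - x * y` is nonnegative and is dropped. What is lost is recovered in the
domination estimate, at the price of a constant depending on the starting point. -/
theorem chebyshevDenom_ge {r x y : ℝ} (hr : 0 ≤ r) (hx : |x| ≤ 1) (hy : |y| ≤ 1) :
    (1 - r) ^ 4 + 4 * r ^ 2 * (x - y) ^ 2 ≤ chebyshevDenom r x y := by
  have hxy : 0 ≤ 1 - x * y := by
    have : |x * y| ≤ 1 := by rw [abs_mul]; exact mul_le_one₀ hx (abs_nonneg _) hy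
    linarith [(abs_le.1 this).2]
  unfold chebyshevDenom
  have : 0 ≤ (1 - r) ^ 2 * (4 * r * (1 - x * y)) := by positivity
  nlinarith

theorem chebyshevDenom_pos {r x y : ℝ} (hr : 0 ≤ r) (hr1 : r < 1) (hx : |x| ≤ 1) (hy : |y| ≤ 1) :
    0 < chebyshevDenom r x y := by
  have : 0 < 1 - r := by linarith
  exact lt_of_lt_of_le (by positivity) (chebyshevDenom_ge hr hx hy)

end Bounds

/-! ### Pointwise convergence to the tangent density -/

section PointwiseLimit

theorem tendsto_div_apply {ι : Type*} {l : Filter ι} {f g : ι → ℝ} {a b : ℝ}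
    (hf : Tendsto f l (𝓝 a)) (hg : Tendsto g l (𝓝 b)) (hb : b ≠ 0) :
    Tendsto (fun n => f n / g n) l (𝓝 (a / b)) := hf.div hg hb

variable {A B C D q : ℝ}

theorem tendsto_one_sub_div (u : ℝ) :
    Tendsto (fun n : ℕ => 1 - u / (2 * (n : ℝ))) atTop (𝓝 1) := by
  have h : Tendsto (fun n : ℕ => 2 * (n : ℝ)) atTop atTop :=
    tendsto_natCast_atTop_atTop.const_mul_atTop two_pos
  simpa using tendsto_const_nhds.sub (tendsto_const_nhds.div_atTop h : Tendsto _ _ (𝓝 (0 : ℝ)))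

theorem tendsto_qPochNormSq_mul (hq : ‖q‖ < 1) {a : ℕ → ℝ} {a₀ : ℝ} (ha : Tendsto a atTop (𝓝 a₀))
    {e : ℕ → ℂ} (he : Tendsto e atTop (𝓝 1)) :
    Tendsto (fun n => qPochNormSq q (a n * e n)) atTop (𝓝 (qPoch q a₀ ^ 2)) := by
  rw [← qPochNormSq_ofReal hq]
  have h := ((Complex.continuous_ofReal.tendsto a₀).comp ha).mul he
  rw [mul_one] at h
  exact ((continuous_qPochNormSq hq).tendsto _).comp h

theorem tendsto_arccosExp {x : ℕ → ℝ} (hx : Tendsto x atTop (𝓝 1)) :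
    Tendsto (fun n => arccosExp (x n)) atTop (𝓝 1) := by
  have := (continuous_arccosExp.tendsto 1).comp hx
  rwa [arccosExp_one] at this

/-- The `C` and `D` factors at `x` and at `y` have the same limit and cancel, as do four powers of
`(q; q)_∞` in numerator and denominator. Hence the limit process does not depend on the parameters.
-/
theorem tendsto_awBackwardFactor (hq0 : 0 ≤ q) (hq1 : q < 1) (hC0 : 0 ≤ C) (hC1 : C < 1)
    (hD1 : D ≤ 0) {s t x y : ℕ → ℝ} (hs : Tendsto s atTop (𝓝 1))
    (ht : Tendsto t atTop (𝓝 1)) (hx : Tendsto x atTop (𝓝 1)) (hy : Tendsto y atTop (𝓝 1)) :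
    Tendsto (fun n => awBackwardFactor C D q (s n) (t n) (x n) (y n)) atTop
      (𝓝 (2 / Real.pi)) := by
  have hq : ‖q‖ < 1 := by rwa [Real.norm_of_nonneg hq0]
  have hP := continuous_qPoch_real hq
  have hts : Tendsto (fun n => t n / s n) atTop (𝓝 1) := by
    simpa using tendsto_div_apply ht hs one_ne_zero
  have hr : Tendsto (fun n => √(t n / s n)) atTop (𝓝 1) := by
    simpa [Function.comp_def] using (Real.continuous_sqrt.tendsto 1).comp hts
  have hdiv : ∀ (E : ℝ) {τ : ℕ → ℝ}, Tendsto τ atTop (𝓝 1) →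
      Tendsto (fun n => E / √(τ n)) atTop (𝓝 E) := fun E τ hτ => by
    have := (Real.continuous_sqrt.tendsto 1).comp hτ
    simpa using tendsto_div_apply (tendsto_const_nhds (x := E)) this (by simp)
  have hdiv' : ∀ {τ : ℕ → ℝ}, Tendsto τ atTop (𝓝 1) →
      Tendsto (fun n => qPoch q (C * D / τ n)) atTop (𝓝 (qPoch q (C * D))) := fun {τ} hτ => by
    have := tendsto_div_apply (tendsto_const_nhds (x := C * D)) hτ one_ne_zero
    rw [div_one] at this
    exact (hP.tendsto _).comp this
  have ex := tendsto_arccosExp hx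
  have ey := tendsto_arccosExp hy
  have eyc : Tendsto (fun n => (starRingEnd ℂ) (arccosExp (y n))) atTop (𝓝 1) := by
    simpa [Function.comp_def] using (Complex.continuous_conj.tendsto 1).comp ey
  have h2 : Tendsto (fun n => qPoch q (t n / s n * q)) atTop (𝓝 (qPoch q q)) := by
    have := hts.mul_const q
    rw [one_mul] at this
    exact (hP.tendsto _).comp this
  have h3 : Tendsto (fun n => qPochNormSq q (arccosExp (y n) ^ 2 * q)) atTop
      (𝓝 (qPoch q q ^ 2)) := by
    have := tendsto_qPochNormSq_mul hq (tendsto_const_nhds (x := q)) (e := fun n =>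
      arccosExp (y n) ^ 2) (by simpa using ey.pow 2)
    simpa [mul_comm] using this
  have h4 : ∀ {e : ℕ → ℂ}, Tendsto e atTop (𝓝 1) → Tendsto (fun n =>
      qPochNormSq q (√(t n / s n) * e n * arccosExp (x n) * q)) atTop (𝓝 (qPoch q q ^ 2)) := by
    intro e he
    have hrq := hr.mul_const q
    rw [one_mul] at hrq
    have := tendsto_qPochNormSq_mul hq hrq (e := fun n => e n * arccosExp (x n))
      (by simpa using he.mul ex)
    refine this.congr fun n => ?_
    congr 1
    push_cast
    ring
  have hQ : qPoch q q ≠ 0 := (qPoch_pos hq0 hq1 hq1).ne'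
  have hQC : qPoch q C ≠ 0 := (qPoch_pos hq0 hq1 hC1).ne'
  have hQD : qPoch q D ≠ 0 := (qPoch_pos hq0 hq1 (hD1.trans_lt one_pos)).ne'
  have hQCD : qPoch q (C * D) ≠ 0 := (qPoch_pos hq0 hq1
    ((mul_nonpos_of_nonneg_of_nonpos hC0 hD1).trans_lt one_pos)).ne'
  have := (((tendsto_div_apply (((tendsto_const_nhds (x := qPoch q q)).mul h2).mul (hdiv' ht))
    (hdiv' hs) hQCD).const_mul (2 / Real.pi)).mul h3).mul
      ((tendsto_qPochNormSq_mul hq (hdiv C hs) ex).mul (tendsto_qPochNormSq_mul hq (hdiv D hs) ex))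
  have := tendsto_div_apply this ((((tendsto_qPochNormSq_mul hq (hdiv C ht) ey).mul
    (tendsto_qPochNormSq_mul hq (hdiv D ht) ey)).mul (h4 ey)).mul (h4 eyc)) (by positivity)
  have hlim : ∀ a c d e : ℝ, a ≠ 0 → c ≠ 0 → d ≠ 0 → e ≠ 0 →
      2 / Real.pi * (a * a * e / e) * a ^ 2 * (c ^ 2 * d ^ 2) / (c ^ 2 * d ^ 2 * a ^ 2 * a ^ 2)
        = 2 / Real.pi := fun a c d e ha hc hd he => by field_simp
  rw [hlim _ _ _ _ hQ hQC hQD hQCD] at this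
  exact this

theorem one_sub_sq_eq {n : ℕ} (hn : 0 < n) (u : ℝ) :
    1 - (1 - u / (2 * n)) ^ 2 = u * (1 - u / (4 * n)) / n := by
  have : (n : ℝ) ≠ 0 := by positivity
  field_simp
  ring

theorem tendsto_sqrt_one_sub_sq (u : ℝ) :
    Tendsto (fun n : ℕ => √(n : ℝ) * √(1 - (1 - u / (2 * (n : ℝ))) ^ 2)) atTop (𝓝 √u) := by
  have h1 : Tendsto (fun n : ℕ => 4 * (n : ℝ)) atTop atTop :=
    tendsto_natCast_atTop_atTop.const_mul_atTop four_pos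
  have h2 : Tendsto (fun n : ℕ => u * (1 - u / (4 * (n : ℝ)))) atTop (𝓝 u) := by
    simpa using ((tendsto_const_nhds (x := (1 : ℝ))).sub (tendsto_const_nhds.div_atTop h1 :
      Tendsto (fun n : ℕ => u / (4 * (n : ℝ))) _ (𝓝 0))).const_mul u
  refine ((Real.continuous_sqrt.tendsto u).comp h2).congr' ?_
  filter_upwards [eventually_gt_atTop 0] with n hn
  rw [Function.comp, ← Real.sqrt_mul (by positivity), one_sub_sq_eq hn]
  have : (n : ℝ) ≠ 0 := by positivity
  congr 1
  field_simp

theorem sqrt_revTime_div (n : ℕ) (s t : ℝ) :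
    √(revTime n t / revTime n s) = Real.exp (-(t - s) / √n) := by
  rw [revTime_div, sqrt_revTime]

theorem one_sub_revTime (n : ℕ) (δ : ℝ) :
    1 - revTime n δ = (1 - Real.exp (-δ / √n)) * (1 + Real.exp (-δ / √n)) := by
  rw [← sqrt_revTime]
  linear_combination Real.sq_sqrt (revTime_pos n δ).le

theorem tendsto_exp_neg_div_sqrt (a : ℝ) :
    Tendsto (fun n : ℕ => Real.exp (-a / √(n : ℝ))) atTop (𝓝 1) := by
  have h : Tendsto (fun n : ℕ => -a / √(n : ℝ)) atTop (𝓝 0) :=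
    tendsto_const_nhds.div_atTop tendsto_sqrt_natCast
  simpa [Function.comp_def] using (Real.continuous_exp.tendsto 0).comp h

/-- With `δ = t - s` one has `√n (1 - r) → δ`, `n (1 - x y) → (u + v) / 2` and `n (x - y) = (v - u)
/ 2`. After multiplying numerator and denominator by `n ^ 2`, each term converges separately. -/
theorem tendsto_chebyshev_quotient {s t u v : ℝ} (hst : s < t) (hu : 0 ≤ u) (hv : 0 ≤ v) :
    Tendsto (fun n : ℕ => √(1 - (1 - v / (2 * (n : ℝ))) ^ 2)
      * (1 - revTime n t / revTime n s)
      / chebyshevDenom √(revTime n t / revTime n s) (1 - u / (2 * n)) (1 - v / (2 * n)) / (2 * n))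
      atTop (𝓝 ((t - s) * √v /
        ((t - s) ^ 4 + 2 * (t - s) ^ 2 * (u + v) + (u - v) ^ 2))) := by
  set δ := t - s with hδ
  have hδ0 : 0 < δ := by rw [hδ]; linarith
  have hr := tendsto_exp_neg_div_sqrt δ
  have hr1 := tendsto_sqrt_mul_one_sub_exp δ
  have h4 : Tendsto (fun n : ℕ => 4 * (n : ℝ)) atTop atTop :=
    tendsto_natCast_atTop_atTop.const_mul_atTop four_pos
  have huv : Tendsto (fun n : ℕ => (u + v) / 2 - u * v / (4 * (n : ℝ))) atTop
      (𝓝 ((u + v) / 2)) := by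
    simpa using (tendsto_const_nhds (x := (u + v) / 2)).sub
      (tendsto_const_nhds.div_atTop h4 : Tendsto _ _ (𝓝 (0 : ℝ)))
  have hnum := ((tendsto_sqrt_one_sub_sq v).mul (hr1.mul (hr.const_add 1))).div_const 2
  have hden := ((hr1.pow 2).mul ((hr1.pow 2).add ((hr.const_mul 4).mul huv))).add
    (((hr.pow 2).const_mul 4).mul_const (((u - v) / 2) ^ 2))
  have hpos : 0 < δ ^ 2 * (δ ^ 2 + 4 * 1 * ((u + v) / 2)) + 4 * 1 ^ 2 * ((u - v) / 2) ^ 2 := by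
    positivity
  have := tendsto_div_apply hnum hden hpos.ne'
  have hlim : √v * (δ * (1 + 1)) / 2
      / (δ ^ 2 * (δ ^ 2 + 4 * 1 * ((u + v) / 2)) + 4 * 1 ^ 2 * ((u - v) / 2) ^ 2)
      = δ * √v / (δ ^ 4 + 2 * δ ^ 2 * (u + v) + (u - v) ^ 2) := by
    congr 1 <;> ring
  rw [hlim] at this
  refine this.congr' ?_
  filter_upwards [eventually_gt_atTop 0] with n hn
  have hn' : (0 : ℝ) < n := by positivity
  have hsq : √(n : ℝ) ^ 2 = n := Real.sq_sqrt hn'.le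
  rw [sqrt_revTime_div, revTime_div, one_sub_revTime, ← hδ, chebyshevDenom]
  set r := Real.exp (-δ / √n)
  set σ := √(1 - (1 - v / (2 * (n : ℝ))) ^ 2)
  have e1 : √(n : ℝ) * σ * (√n * (1 - r) * (1 + r)) / 2
      = n ^ 2 * (σ * ((1 - r) * (1 + r)) / (2 * n)) := by
    field_simp
    rw [hsq]
    ring
  have e2 : (√(n : ℝ) * (1 - r)) ^ 2 * ((√n * (1 - r)) ^ 2 + 4 * r * ((u + v) / 2 - u * v / (4 * n)))
      + 4 * r ^ 2 * ((u - v) / 2) ^ 2 = n ^ 2 * ((1 - r) ^ 2 *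
        ((1 - r) ^ 2 + 4 * r * (1 - (1 - u / (2 * n)) * (1 - v / (2 * n))))
        + 4 * r ^ 2 * ((1 - u / (2 * n)) - (1 - v / (2 * n))) ^ 2) := by
    rw [mul_pow, hsq]
    field_simp
    ring
  rw [e1, e2, mul_div_mul_left _ _ (by positivity), div_right_comm]

theorem tendsto_hatPClosed (hq0 : 0 ≤ q) (hq1 : q < 1) (hC0 : 0 ≤ C) (hC1 : C < 1)
    (hD1 : D ≤ 0) {s t u v : ℝ} (hst : s < t) (hu : 0 ≤ u)
    (hv : 0 ≤ v) :
    Tendsto (fun n : ℕ => hatPClosed C D q n s t u v) atTop (𝓝 (tangentDensity s t u v)) := by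
  have hq : ‖q‖ < 1 := by rwa [Real.norm_of_nonneg hq0]
  rw [tangentDensity, if_pos ⟨hu, hv⟩]
  -- At `v = 0` both sides are zero: the closed form requires `0 < v`, and the tangent density has
  -- the factor `√v`.
  rcases hv.eq_or_lt with rfl | hv
  · simp [hatPClosed]
  have h := (tendsto_chebyshev_quotient hst hu hv.le).mul (tendsto_awBackwardFactor hq0 hq1 hC0 hC1
    hD1 (tendsto_revTime s) (tendsto_revTime t) (tendsto_one_sub_div u) (tendsto_one_sub_div v))
  have hlim : (t - s) * √v / ((t - s) ^ 4 + 2 * (t - s) ^ 2 * (u + v) + (u - v) ^ 2)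
      * (2 / Real.pi) = 2 * (t - s) * √v / (Real.pi *
        ((t - s) ^ 4 + 2 * (t - s) ^ 2 * (u + v) + (u - v) ^ 2)) := by
    rw [div_mul_div_comm]
    congr 1 <;> ring
  rw [hlim] at h
  refine h.congr' ?_
  have h4 : Tendsto (fun n : ℕ => 4 * (n : ℝ)) atTop atTop :=
    tendsto_natCast_atTop_atTop.const_mul_atTop four_pos
  filter_upwards [eventually_gt_atTop 0, h4.eventually_gt_atTop u, h4.eventually_gt_atTop v]
    with n hn h1 h2
  rw [hatPClosed, if_pos ⟨hu, h1, hv, h2⟩, awBackwardDensity_eq_mul hq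
    (abs_one_sub_le_one hn hu h1.le) ((abs_one_sub_lt_one hn).2 ⟨hv, h2⟩)]
  ring

end PointwiseLimit

/-! ### The tangent density is a probability density -/

section Tangent

theorem tangentDensity_nonneg {s t : ℝ} (hst : s < t) (u v : ℝ) : 0 ≤ tangentDensity s t u v := by
  rw [tangentDensity]
  split_ifs with h
  · obtain ⟨hu, hv⟩ := h
    have : 0 < t - s := by linarith
    have := Real.pi_pos
    positivity
  · exact le_rfl

theorem tangentDensity_of_nonpos {s t u v : ℝ} (hv : v ≤ 0) : tangentDensity s t u v = 0 := by
  rw [tangentDensity]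
  split_ifs with h
  · rw [le_antisymm hv h.2]; simp
  · rfl

theorem measurable_tangentDensity (s t : ℝ) :
    Measurable fun p : ℝ × ℝ => tangentDensity s t p.1 p.2 := by
  unfold tangentDensity
  refine Measurable.ite ?_ (by fun_prop) measurable_const
  exact (measurableSet_le measurable_const measurable_fst).inter
    (measurableSet_le measurable_const measurable_snd)

/-- A primitive of `v ↦ tangentDensity 0 δ (a ^ 2) v`, as a function of `z = √v`. -/
def tangentPrimitive (δ a z : ℝ) : ℝ :=
  δ / (2 * Real.pi * a) * Real.log ((δ ^ 2 + (z - a) ^ 2) / (δ ^ 2 + (z + a) ^ 2))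
    + (Real.arctan ((z - a) / δ) + Real.arctan ((z + a) / δ)) / Real.pi

/-- With `v = z ^ 2` and `u = a ^ 2` the quartic denominator factors into `δ ^ 2 + (z - a) ^ 2` and
`δ ^ 2 + (z + a) ^ 2`; the primitive comes from partial fractions. The derivative includes the
Jacobian `2 z`. -/
theorem hasDerivAt_tangentPrimitive {δ a z : ℝ} (hδ : 0 < δ) (ha : 0 < a) :
    HasDerivAt (tangentPrimitive δ a)
      (4 * δ * z ^ 2 / (Real.pi * ((δ ^ 2 + (z - a) ^ 2) * (δ ^ 2 + (z + a) ^ 2)))) z := by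
  have hP : 0 < δ ^ 2 + (z - a) ^ 2 := by positivity
  have hM : 0 < δ ^ 2 + (z + a) ^ 2 := by positivity
  have d1 : HasDerivAt (fun z => z - a) 1 z := (hasDerivAt_id z).sub_const a
  have d2 : HasDerivAt (fun z => z + a) 1 z := (hasDerivAt_id z).add_const a
  have dP := (d1.fun_pow 2).const_add (δ ^ 2)
  have dM := (d2.fun_pow 2).const_add (δ ^ 2)
  have h := (((dP.fun_div dM hM.ne').log (div_pos hP hM).ne').const_mul
    (δ / (2 * Real.pi * a))).fun_add
    (((d1.div_const δ).arctan.fun_add (d2.div_const δ).arctan).div_const Real.pi)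
  refine h.congr_deriv ?_
  have h1 : 1 + ((z - a) / δ) ^ 2 = (δ ^ 2 + (z - a) ^ 2) / δ ^ 2 := by field_simp
  have h2 : 1 + ((z + a) / δ) ^ 2 = (δ ^ 2 + (z + a) ^ 2) / δ ^ 2 := by field_simp
  rw [h1, h2]
  have := Real.pi_pos
  simp only [Nat.cast_ofNat, Nat.add_one_sub_one, pow_one, mul_one]
  field_simp
  ring

theorem tangentPrimitive_zero {δ a : ℝ} (hδ : 0 < δ) : tangentPrimitive δ a 0 = 0 := by
  have : 0 < δ ^ 2 + a ^ 2 := by positivity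
  simp [tangentPrimitive, neg_div, Real.arctan_neg, this.ne']

theorem tendsto_tangentPrimitive {δ a : ℝ} (hδ : 0 < δ) (ha : 0 < a) :
    Tendsto (tangentPrimitive δ a) atTop (𝓝 1) := by
  have harc : ∀ b : ℝ, Tendsto (fun z => Real.arctan ((z + b) / δ)) atTop (𝓝 (Real.pi / 2)) :=
    fun b => (Real.tendsto_arctan_atTop.mono_right nhdsWithin_le_nhds).comp
      ((tendsto_atTop_add_const_right _ b tendsto_id).atTop_div_const hδ)
  have hratio : Tendsto (fun z : ℝ => (δ ^ 2 + (z - a) ^ 2) / (δ ^ 2 + (z + a) ^ 2)) atTop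
      (𝓝 1) := by
    have h0 : Tendsto (fun z : ℝ => 4 * a * z / (δ ^ 2 + (z + a) ^ 2)) atTop (𝓝 0) := by
      have h4 : Tendsto (fun z : ℝ => 4 * a / z) atTop (𝓝 0) :=
        tendsto_const_nhds.div_atTop tendsto_id
      refine tendsto_of_tendsto_of_tendsto_of_le_of_le' tendsto_const_nhds h4 ?_ ?_
      · filter_upwards [eventually_gt_atTop 0] with z hz
        positivity
      · filter_upwards [eventually_gt_atTop 0] with z hz
        rw [div_le_div_iff₀ (by positivity) hz]
        nlinarith [mul_pos ha hz, sq_nonneg δ, sq_nonneg a]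
    have := (tendsto_const_nhds (x := (1 : ℝ))).sub h0
    rw [sub_zero] at this
    refine this.congr fun z => ?_
    have : 0 < δ ^ 2 + (z + a) ^ 2 := by positivity
    field_simp
    ring
  have hlog := ((Real.continuousAt_log one_ne_zero).tendsto.comp hratio).const_mul
    (δ / (2 * Real.pi * a))
  have := hlog.add (((harc (-a)).add (harc a)).div_const Real.pi)
  have hpi := Real.pi_pos
  have e : δ / (2 * Real.pi * a) * Real.log 1 + (Real.pi / 2 + Real.pi / 2) / Real.pi = 1 := by
    rw [Real.log_one]; field_simp; ring
  rw [e] at this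
  exact this

theorem hasDerivAt_tangentPrimitive_sqrt {s t u v : ℝ} (hst : s < t) (hu : 0 < u) (hv : 0 < v) :
    HasDerivAt (fun v => tangentPrimitive (t - s) √u √v) (tangentDensity s t u v) v := by
  have hδ : 0 < t - s := by linarith
  have ha := Real.sqrt_pos.2 hu
  have hz := Real.sqrt_pos.2 hv
  have h := (hasDerivAt_tangentPrimitive hδ ha (z := √v)).comp v (Real.hasDerivAt_sqrt hv.ne')
  refine h.congr_deriv ?_
  rw [tangentDensity, if_pos ⟨hu.le, hv.le⟩]
  have e1 : √u ^ 2 = u := Real.sq_sqrt hu.le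
  have e2 : √v ^ 2 = v := Real.sq_sqrt hv.le
  have e3 : ((t - s) ^ 2 + (√v - √u) ^ 2) * ((t - s) ^ 2 + (√v + √u) ^ 2)
      = (t - s) ^ 4 + 2 * (t - s) ^ 2 * (u + v) + (u - v) ^ 2 := by
    rw [← e1, ← e2, Real.sqrt_sq ha.le, Real.sqrt_sq hz.le]
    ring
  rw [e3]
  have hpi := Real.pi_pos
  have hT : 0 < (t - s) ^ 4 + 2 * (t - s) ^ 2 * (u + v) + (u - v) ^ 2 := by positivity
  field_simp
  norm_num

/-- The primitive increases from `0` to `1`: at infinity the logarithm tends to `0` and each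
arctangent to `π / 2`. Nonnegativity of the derivative supplies integrability, and continuity
suffices at `0`, where `√v` is not differentiable. -/
theorem lintegral_tangentDensity {s t u : ℝ} (hst : s < t) (hu : 0 < u) :
    ∫⁻ v, ENNReal.ofReal (tangentDensity s t u v) = 1 := by
  have hδ : 0 < t - s := by linarith
  have ha := Real.sqrt_pos.2 hu
  have hcont : ContinuousWithinAt (fun v => tangentPrimitive (t - s) √u √v) (Set.Ici 0) 0 := by
    have h1 : Continuous (tangentPrimitive (t - s) √u) :=
      continuous_iff_continuousAt.2 fun z => (hasDerivAt_tangentPrimitive hδ ha).continuousAt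
    exact (h1.comp Real.continuous_sqrt).continuousWithinAt
  have hlim : Tendsto (fun v => tangentPrimitive (t - s) √u √v) atTop (𝓝 1) :=
    (tendsto_tangentPrimitive hδ ha).comp Real.tendsto_sqrt_atTop
  have hderiv : ∀ v ∈ Set.Ioi (0 : ℝ), HasDerivAt (fun v => tangentPrimitive (t - s) √u √v)
      (tangentDensity s t u v) v := fun v hv => hasDerivAt_tangentPrimitive_sqrt hst hu hv
  have hnn : ∀ v ∈ Set.Ioi (0 : ℝ), 0 ≤ tangentDensity s t u v :=
    fun v _ => tangentDensity_nonneg hst u v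
  have hint := integrableOn_Ioi_deriv_of_nonneg hcont hderiv hnn hlim
  have hval := integral_Ioi_of_hasDerivAt_of_nonneg hcont hderiv hnn hlim
  rw [Real.sqrt_zero, tangentPrimitive_zero hδ, sub_zero] at hval
  have hset : ∫⁻ v in Set.Ioi (0 : ℝ), ENNReal.ofReal (tangentDensity s t u v) = 1 := by
    rw [← ofReal_integral_eq_lintegral_ofReal hint
      (Eventually.of_forall fun v => tangentDensity_nonneg hst u v), hval, ENNReal.ofReal_one]
  rw [← hset, ← lintegral_indicator measurableSet_Ioi]
  refine lintegral_congr fun v => ?_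
  by_cases hv : v ∈ Set.Ioi (0 : ℝ)
  · rw [Set.indicator_of_mem hv]
  · rw [Set.indicator_of_notMem hv, tangentDensity_of_nonpos (not_lt.1 hv), ENNReal.ofReal_zero]

end Tangent

/-! ### Domination by the tangent density -/

section Domination

variable {A B C D q : ℝ}

theorem exists_hatPClosed_le (hq0 : 0 ≤ q) (hq1 : q < 1) (hC0 : 0 ≤ C) (hC1 : C < 1)
    (hD0 : -1 < D) (hD1 : D ≤ 0) {s t : ℝ} (hs : 0 ≤ s) (hst : s < t) :
    ∃ K : ℝ, 0 < K ∧ ∀ᶠ n : ℕ in atTop, ∀ u v : ℝ, 0 ≤ u → u < 4 * n → 0 < v → v < 4 * n →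
      hatPClosed C D q n s t u v ≤ K * (√(1 - (1 - v / (2 * n)) ^ 2)
        * (1 - revTime n (t - s)) / chebyshevDenom (Real.exp (-(t - s) / √n))
          (1 - u / (2 * n)) (1 - v / (2 * n))) / (2 * n) := by
  have ht : 0 ≤ t := hs.trans hst.le
  -- The closed form does not contain `A` and `B`, so both are set to `0`. One admissible time
  -- `revTime n₀ t < 1` serves as the lower bound `t₀`; eventually `revTime n t` exceeds it.
  obtain ⟨n₀, hn₀, h⟩ := ((eventually_gt_atTop 0).and (eventually_AWParams (A := 0) (B := 0) hq0
    hq1 le_rfl zero_le_one hC0 hC1 neg_one_lt_zero le_rfl hD0 hD1 ht)).exists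
  obtain ⟨K, hK, hle⟩ := h.exists_awBackwardFactor_le
  have ht0 : revTime n₀ t < 1 := by
    have := revTime_lt hn₀ (hs.trans_lt hst)
    rwa [revTime_zero] at this
  refine ⟨K, hK, ?_⟩
  filter_upwards [eventually_gt_atTop 0, (tendsto_revTime t).eventually_const_lt ht0]
    with n hn hnt u v hu0 hu1 hv0 hv1
  have hx := abs_one_sub_le_one hn hu0 hu1.le
  have hy := (abs_one_sub_lt_one hn).2 ⟨hv0, hv1⟩
  rw [hatPClosed, if_pos ⟨hu0, hu1, hv0, hv1⟩, awBackwardDensity_eq_mul h.norm_q hx hy,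
    sqrt_revTime_div, revTime_div, mul_comm]
  have hts := revTime_lt hn hst
  have hb := hle _ _ (1 - u / (2 * n)) (1 - v / (2 * n)) hnt.le hts (revTime_le_one n hs)
  have hr1 : Real.exp (-(t - s) / √n) < 1 := by
    rw [Real.exp_lt_one_iff]
    exact div_neg_of_neg_of_pos (by linarith) (Real.sqrt_pos.2 (by exact_mod_cast hn))
  have hd := chebyshevDenom_pos (Real.exp_pos _).le hr1 hx hy.le
  have h1 : 0 ≤ 1 - revTime n (t - s) := by
    linarith [revTime_le_one n (by linarith : 0 ≤ t - s)]
  gcongr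

theorem eventually_hatPClosed_le_tangentDensity (hq0 : 0 ≤ q) (hq1 : q < 1) (hC0 : 0 ≤ C)
    (hC1 : C < 1) (hD0 : -1 < D) (hD1 : D ≤ 0) {s t u : ℝ} (hs : 0 ≤ s) (hst : s < t)
    (hu : 0 ≤ u) :
    ∃ M : ℝ, 0 ≤ M ∧ ∀ᶠ n : ℕ in atTop, ∀ v : ℝ,
      hatPClosed C D q n s t u v ≤ M * tangentDensity s t u v := by
  obtain ⟨K, hK, hle⟩ := exists_hatPClosed_le hq0 hq1 hC0 hC1 hD0 hD1 hs hst
  set δ := t - s with hδ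
  have hδ0 : 0 < δ := by linarith
  have hpi := Real.pi_pos
  -- The bracket compares the tangent denominator with the weaker `(δ / 2) ^ 4 + (u - v) ^ 2 / 4`,
  -- and `π` undoes the normalization of `tangentDensity`.
  refine ⟨K * (32 + 64 * u / δ ^ 2) * Real.pi, by positivity, ?_⟩
  have hε := tendsto_sqrt_mul_one_sub_exp δ
  filter_upwards [hle, eventually_gt_atTop 0, hε.eventually_const_lt (by linarith : δ / 2 < δ),
    hε.eventually_lt_const (by linarith : δ < 2 * δ),
    (tendsto_exp_neg_div_sqrt δ).eventually_const_lt (by norm_num : (1 / 2 : ℝ) < 1)]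
    with n hn hn0 hε1 hε2 hr v
  by_cases hc : 0 ≤ u ∧ u < 4 * n ∧ 0 < v ∧ v < 4 * n
  swap
  · rw [hatPClosed, if_neg hc]
    have := tangentDensity_nonneg hst u v
    positivity
  obtain ⟨-, hu1, hv0, hv1⟩ := hc
  refine (hn u v hu hu1 hv0 hv1).trans ?_
  have hx := abs_one_sub_le_one hn0 hu hu1.le
  have hy := (abs_one_sub_lt_one hn0).2 ⟨hv0, hv1⟩
  have hn' : (0 : ℝ) < n := by positivity
  have hsn : 0 < √(n : ℝ) := Real.sqrt_pos.2 hn'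
  have hsq : √(n : ℝ) ^ 2 = n := Real.sq_sqrt hn'.le
  rw [one_sub_revTime]
  set r := Real.exp (-δ / √n) with hrdef
  have hr1 : r < 1 := by
    rw [hrdef, Real.exp_lt_one_iff]
    exact div_neg_of_neg_of_pos (by linarith) hsn
  have hden := chebyshevDenom_ge (r := r) (by linarith) hx hy.le
  set ε := √(n : ℝ) * (1 - r) with hεdef
  have hden2 : ((δ / 2) ^ 4 + (u - v) ^ 2 / 4) / n ^ 2
      ≤ chebyshevDenom r (1 - u / (2 * n)) (1 - v / (2 * n)) := by
    refine le_trans ?_ hden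
    rw [div_le_iff₀ (by positivity)]
    have e1 : ((1 - r) ^ 4 + 4 * r ^ 2 * (1 - u / (2 * n) - (1 - v / (2 * n))) ^ 2) * (n : ℝ) ^ 2
        = ε ^ 4 + r ^ 2 * (u - v) ^ 2 := by
      have : (n : ℝ) ^ 2 * (1 - r) ^ 4 = ε ^ 4 := by
        rw [hεdef, mul_pow, show √(n : ℝ) ^ 4 = (√(n : ℝ) ^ 2) ^ 2 by ring, hsq]
      rw [← this]
      field_simp
      ring
    rw [e1]
    have e2 : (δ / 2) ^ 4 ≤ ε ^ 4 := by gcongr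
    have e3 : (1 / 2) ^ 2 * (u - v) ^ 2 ≤ r ^ 2 * (u - v) ^ 2 := by gcongr
    linarith
  have hσ : √(1 - (1 - v / (2 * n)) ^ 2) ≤ √v / √n := by
    rw [← Real.sqrt_div hv0.le, one_sub_sq_eq hn0]
    refine Real.sqrt_le_sqrt (div_le_div_of_nonneg_right ?_ hn'.le)
    refine mul_le_of_le_one_right hv0.le ?_
    have : 0 ≤ v / (4 * n) := by positivity
    linarith
  have h1r : (1 - r) * (1 + r) ≤ 4 * δ / √n := by
    rw [le_div_iff₀ hsn]
    have : (1 - r) * (1 + r) * √n = ε * (1 + r) := by rw [hεdef]; ring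
    rw [this]
    have : 0 < ε := by linarith
    nlinarith
  have hT : 0 < δ ^ 4 + 2 * δ ^ 2 * (u + v) + (u - v) ^ 2 := by positivity
  have hquad : 0 < (δ / 2) ^ 4 + (u - v) ^ 2 / 4 := by positivity
  have hTle : δ ^ 4 + 2 * δ ^ 2 * (u + v) + (u - v) ^ 2
      ≤ (32 + 64 * u / δ ^ 2) * ((δ / 2) ^ 4 + (u - v) ^ 2 / 4) := by
    have e1 : (32 + 64 * u / δ ^ 2) * ((δ / 2) ^ 4 + (u - v) ^ 2 / 4)
        = 2 * δ ^ 4 + 8 * (u - v) ^ 2 + 4 * u * δ ^ 2 + 64 * u / δ ^ 2 * ((u - v) ^ 2 / 4) := by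
      field_simp
      ring
    have e2 : 0 ≤ 64 * u / δ ^ 2 * ((u - v) ^ 2 / 4) := by positivity
    rw [e1]
    -- Write `2δ²(u + v) = 4δ²u + 2δ²(v - u)` and bound the last term by `δ⁴ + (v - u)²`.
    nlinarith [sq_nonneg (δ ^ 2 - (v - u)), sq_nonneg (u - v)]
  have h1r0 : 0 ≤ (1 - r) * (1 + r) := mul_nonneg (by linarith) (by linarith)
  calc K * (√(1 - (1 - v / (2 * n)) ^ 2) * ((1 - r) * (1 + r))
        / chebyshevDenom r (1 - u / (2 * n)) (1 - v / (2 * n))) / (2 * n)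
      ≤ K * (√v / √n * (4 * δ / √n) / (((δ / 2) ^ 4 + (u - v) ^ 2 / 4) / n ^ 2)) / (2 * n) := by
        gcongr
    _ = K * (2 * δ * √v) / ((δ / 2) ^ 4 + (u - v) ^ 2 / 4) := by
        have : √v / √n * (4 * δ / √n) = 4 * δ * √v / n := by
          rw [div_mul_div_comm, Real.mul_self_sqrt hn'.le]; ring
        rw [this]
        generalize (δ / 2) ^ 4 + (u - v) ^ 2 / 4 = w at *
        field_simp
        ring
    _ ≤ K * (2 * δ * √v) * ((32 + 64 * u / δ ^ 2)
          / (δ ^ 4 + 2 * δ ^ 2 * (u + v) + (u - v) ^ 2)) := by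
        rw [div_eq_mul_inv]
        refine mul_le_mul_of_nonneg_left ?_ (by positivity)
        rw [inv_eq_one_div, div_le_div_iff₀ hquad hT, one_mul]
        exact hTle
    _ = K * (32 + 64 * u / δ ^ 2) * Real.pi * tangentDensity s t u v := by
        rw [tangentDensity, if_pos ⟨hu, hv0.le⟩, ← hδ]
        generalize δ ^ 4 + 2 * δ ^ 2 * (u + v) + (u - v) ^ 2 = w at *
        field_simp

end Domination

/-! ### A bound on the total mass, uniform in the starting point -/

section Mass

theorem integrable_cauchy {ε : ℝ} (hε : 0 < ε) (θ : ℝ) :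
    Integrable fun φ : ℝ => ε / (ε ^ 2 + (θ - φ) ^ 2) := by
  have h := ((integrable_inv_one_add_sq.comp_div hε.ne').comp_sub_left θ).const_mul ε⁻¹
  refine h.congr (Eventually.of_forall fun φ => ?_)
  simp only
  field_simp

theorem integral_cauchy {ε : ℝ} (hε : 0 < ε) (θ : ℝ) :
    ∫ φ : ℝ, ε / (ε ^ 2 + (θ - φ) ^ 2) = Real.pi := by
  have e : ∀ φ : ℝ, ε / (ε ^ 2 + (θ - φ) ^ 2) = ε⁻¹ * (1 + ((θ - φ) / ε) ^ 2)⁻¹ := fun φ => by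
    field_simp
  simp_rw [e]
  rw [integral_const_mul, integral_sub_left_eq_self (fun x : ℝ => (1 + (x / ε) ^ 2)⁻¹),
    Measure.integral_comp_div (fun x : ℝ => (1 + x ^ 2)⁻¹), integral_univ_inv_one_add_sq,
    abs_of_pos hε, smul_eq_mul, inv_mul_cancel_left₀ hε.ne']

theorem lintegral_cauchy {ε : ℝ} (hε : 0 < ε) (θ : ℝ) :
    ∫⁻ φ : ℝ, ENNReal.ofReal (ε / (ε ^ 2 + (θ - φ) ^ 2)) = ENNReal.ofReal Real.pi := by
  rw [← ofReal_integral_eq_lintegral_ofReal (integrable_cauchy hε θ)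
    (Eventually.of_forall fun φ => by positivity), integral_cauchy hε]

theorem chebyshevDenom_cos (r θ φ : ℝ) : chebyshevDenom r (Real.cos θ) (Real.cos φ) =
    ((1 - r) ^ 2 + 2 * r * (1 - Real.cos (θ + φ))) *
      ((1 - r) ^ 2 + 2 * r * (1 - Real.cos (θ - φ))) := by
  rw [Real.cos_add, Real.cos_sub, chebyshevDenom]
  have h1 := Real.sin_sq_add_cos_sq θ
  have h2 := Real.sin_sq_add_cos_sq φ
  linear_combination (4 * r ^ 2 * Real.sin φ ^ 2) * h1 + 4 * r ^ 2 * (1 - Real.cos θ ^ 2) * h2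

/-- In angles the denominator is a product of a factor in `θ + φ` and one in `θ - φ`. The first
absorbs `sin φ ^ 2`; the second is comparable to the denominator of a Cauchy kernel of width `1 -
r`. The constant is `20 = 2 * 5 * 2`, from the two factors and `1 - r ^ 2 ≤ 2 (1 - r)`. -/
theorem sin_sq_mul_div_chebyshevDenom_le {r θ φ : ℝ} (hr : 1 / 2 ≤ r) (hr1 : r < 1)
    (hθ0 : 0 ≤ θ) (hθ1 : θ ≤ Real.pi) (hφ0 : 0 < φ) (hφ1 : φ < Real.pi) :
    Real.sin φ ^ 2 * (1 - r ^ 2) / chebyshevDenom r (Real.cos θ) (Real.cos φ)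
      ≤ 20 * ((1 - r) / ((1 - r) ^ 2 + (θ - φ) ^ 2)) := by
  have hsin := Real.sin_pos_of_pos_of_lt_pi hφ0 hφ1
  have hsinθ := Real.sin_nonneg_of_nonneg_of_le_pi hθ0 hθ1
  have hε : 0 < 1 - r := by linarith
  have hpi := Real.pi_pos
  have hplus : Real.sin φ ^ 2 / 2 ≤ (1 - r) ^ 2 + 2 * r * (1 - Real.cos (θ + φ)) := by
    have hp : 0 ≤ Real.sin ((θ + φ) / 2) :=
      Real.sin_nonneg_of_nonneg_of_le_pi (by linarith) (by linarith)
    -- Adding `sin θ ≥ 0` to the left side allows the sum-to-product formula.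
    have h1 : Real.sin φ ≤ 2 * Real.sin ((θ + φ) / 2) := by
      have e := Real.sin_add_sin θ φ
      have := Real.cos_le_one ((θ - φ) / 2)
      nlinarith
    have h2 : Real.cos (θ + φ) = 1 - 2 * Real.sin ((θ + φ) / 2) ^ 2 := by
      have := Real.cos_two_mul ((θ + φ) / 2)
      rw [mul_div_cancel₀ _ two_ne_zero] at this
      rw [this, Real.cos_sq']
      ring
    have h3 : Real.sin φ ^ 2 ≤ 4 * Real.sin ((θ + φ) / 2) ^ 2 := by nlinarith
    rw [h2]
    nlinarith [sq_nonneg (1 - r), sq_nonneg (Real.sin ((θ + φ) / 2))]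
  have hminus : ((1 - r) ^ 2 + (θ - φ) ^ 2) / 5
      ≤ (1 - r) ^ 2 + 2 * r * (1 - Real.cos (θ - φ)) := by
    have hc := Real.cos_le_one_sub_mul_cos_sq (x := θ - φ)
      (by rw [abs_le]; constructor <;> linarith)
    have hpi2 : Real.pi ^ 2 ≤ 10 := by nlinarith [Real.pi_lt_d2]
    have h5 : 1 / 5 ≤ 2 / Real.pi ^ 2 := by
      rw [div_le_div_iff₀ (by norm_num) (by positivity)]; linarith
    have h6 : 1 / 5 * (θ - φ) ^ 2 ≤ 2 / Real.pi ^ 2 * (θ - φ) ^ 2 := by gcongr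
    have h7 : 1 / 5 * (θ - φ) ^ 2 ≤ 1 - Real.cos (θ - φ) := by linarith
    nlinarith [sq_nonneg (1 - r), sq_nonneg (θ - φ)]
  rw [chebyshevDenom_cos]
  have hs2 : 0 < Real.sin φ ^ 2 := by positivity
  have hpos : 0 < (1 - r) ^ 2 + (θ - φ) ^ 2 := by positivity
  have hnum : 0 ≤ Real.sin φ ^ 2 * (1 - r ^ 2) := mul_nonneg hs2.le (by nlinarith)
  calc _ ≤ Real.sin φ ^ 2 * (1 - r ^ 2)
        / (Real.sin φ ^ 2 / 2 * (((1 - r) ^ 2 + (θ - φ) ^ 2) / 5)) := by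
        gcongr
        exact (by positivity : 0 ≤ Real.sin φ ^ 2 / 2).trans hplus
    _ = 10 * ((1 - r ^ 2) / ((1 - r) ^ 2 + (θ - φ) ^ 2)) := by
        generalize (1 - r) ^ 2 + (θ - φ) ^ 2 = w at *
        field_simp
        ring
    _ ≤ 10 * (2 * (1 - r) / ((1 - r) ^ 2 + (θ - φ) ^ 2)) := by
        gcongr
        nlinarith
    _ = _ := by ring

variable {C D q : ℝ}

theorem image_versine {n : ℕ} (hn : 0 < n) :
    (fun φ => 2 * n * (1 - Real.cos φ)) '' Set.Ioo 0 Real.pi = Set.Ioo (0 : ℝ) (4 * n) := by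
  have hn' : (0 : ℝ) < n := by positivity
  have hpi := Real.pi_pos
  ext v
  constructor
  · rintro ⟨φ, ⟨h0, h1⟩, rfl⟩
    have h2 : Real.cos φ < 1 := by
      have := Real.cos_lt_cos_of_nonneg_of_le_pi le_rfl h1.le h0
      rwa [Real.cos_zero] at this
    have h3 : -1 < Real.cos φ := by
      have := Real.cos_lt_cos_of_nonneg_of_le_pi h0.le le_rfl h1
      rwa [Real.cos_pi] at this
    constructor
    · exact mul_pos (by positivity) (by linarith)
    · nlinarith
  · rintro hv
    have hy := (abs_one_sub_lt_one hn).2 hv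
    rw [abs_lt] at hy
    refine ⟨Real.arccos (1 - v / (2 * n)), ⟨Real.arccos_pos.2 hy.2, ?_⟩, ?_⟩
    · exact Real.arccos_lt_pi.2 hy.1
    · simp only
      rw [Real.cos_arccos hy.1.le hy.2.le]
      field_simp
      ring

/-- Under `v = 2n(1 - cos φ)` the Jacobian `2n sin φ` and the factor `√(1 - y ^ 2) = sin φ` give the
`sin φ ^ 2` of the kernel estimate. A Cauchy kernel has mass `π` wherever it is centred, hence the
uniformity in `u`. -/
theorem exists_lintegral_hatPClosed_le (hq0 : 0 ≤ q) (hq1 : q < 1) (hC0 : 0 ≤ C) (hC1 : C < 1)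
    (hD0 : -1 < D) (hD1 : D ≤ 0) {s t : ℝ} (hs : 0 ≤ s) (hst : s < t) :
    ∃ K : ℝ, ∀ᶠ n : ℕ in atTop, ∀ u : ℝ,
      ∫⁻ v, ENNReal.ofReal (hatPClosed C D q n s t u v) ≤ ENNReal.ofReal K := by
  obtain ⟨K, hK, hle⟩ := exists_hatPClosed_le hq0 hq1 hC0 hC1 hD0 hD1 hs hst
  have hδ : 0 < t - s := by linarith
  refine ⟨K * 20 * Real.pi, ?_⟩
  filter_upwards [hle, eventually_gt_atTop 0, (tendsto_exp_neg_div_sqrt (t - s)).eventually_const_lt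
    (by norm_num : (1 / 2 : ℝ) < 1)] with n hn hn0 hr u
  by_cases hu : 0 ≤ u ∧ u < 4 * n
  swap
  · have : ∀ v, hatPClosed C D q n s t u v = 0 := fun v => by
      rw [hatPClosed, if_neg]; tauto
    simp [this]
  have hn' : (0 : ℝ) < n := by positivity
  have hx := abs_one_sub_le_one hn0 hu.1 hu.2.le
  rw [abs_le] at hx
  set r := Real.exp (-(t - s) / √n) with hrdef
  have hr1 : r < 1 := by
    rw [hrdef, Real.exp_lt_one_iff]
    exact div_neg_of_neg_of_pos (by linarith) (Real.sqrt_pos.2 hn')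
  set θ := Real.arccos (1 - u / (2 * n)) with hθ
  have hcosθ : Real.cos θ = 1 - u / (2 * n) := Real.cos_arccos hx.1 hx.2
  calc ∫⁻ v, ENNReal.ofReal (hatPClosed C D q n s t u v)
      = ∫⁻ v in (fun φ => 2 * n * (1 - Real.cos φ)) '' Set.Ioo 0 Real.pi,
          ENNReal.ofReal (hatPClosed C D q n s t u v) := by
        rw [image_versine hn0, ← lintegral_indicator measurableSet_Ioo]
        refine lintegral_congr fun v => ?_
        by_cases hv : v ∈ Set.Ioo (0 : ℝ) (4 * n)
        · rw [Set.indicator_of_mem hv]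
        · rw [Set.indicator_of_notMem hv, hatPClosed, if_neg, ENNReal.ofReal_zero]
          exact fun h => hv h.2.2
    _ = ∫⁻ φ in Set.Ioo 0 Real.pi, ENNReal.ofReal |2 * n * Real.sin φ|
          * ENNReal.ofReal (hatPClosed C D q n s t u (2 * n * (1 - Real.cos φ))) := by
        refine lintegral_image_eq_lintegral_abs_deriv_mul measurableSet_Ioo (fun φ _ => ?_) ?_ _
        · have := ((Real.hasDerivAt_cos φ).const_sub 1).const_mul (2 * (n : ℝ))
          rw [neg_neg] at this
          exact this.hasDerivWithinAt
        · intro φ hφ ψ hψ h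
          have : Real.cos φ = Real.cos ψ := by
            have h2 := mul_left_cancel₀ (by positivity : (2 * n : ℝ) ≠ 0) h
            linarith
          exact Real.injOn_cos ⟨hφ.1.le, hφ.2.le⟩ ⟨hψ.1.le, hψ.2.le⟩ this
    _ ≤ ∫⁻ φ in Set.Ioo 0 Real.pi, ENNReal.ofReal (K * 20) *
          ENNReal.ofReal ((1 - r) / ((1 - r) ^ 2 + (θ - φ) ^ 2)) := by
        refine setLIntegral_mono' measurableSet_Ioo fun φ hφ => ?_
        have hsin := Real.sin_pos_of_pos_of_lt_pi hφ.1 hφ.2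
        have hv : 2 * n * (1 - Real.cos φ) ∈ Set.Ioo (0 : ℝ) (4 * n) := by
          rw [← image_versine hn0]
          exact ⟨φ, hφ, rfl⟩
        have hb := hn u _ hu.1 hu.2 hv.1 hv.2
        have hy : 1 - 2 * n * (1 - Real.cos φ) / (2 * n) = Real.cos φ := by field_simp; ring
        have hsq : √(1 - Real.cos φ ^ 2) = Real.sin φ := by
          rw [← Real.sin_sq, Real.sqrt_sq hsin.le]
        have hrev : revTime n (t - s) = r ^ 2 := by
          rw [← Real.sq_sqrt (revTime_pos n (t - s)).le, sqrt_revTime]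
        rw [hy, hsq, ← hcosθ, hrev] at hb
        have hfin := sin_sq_mul_div_chebyshevDenom_le hr.le hr1 (Real.arccos_nonneg _)
          (Real.arccos_le_pi _) hφ.1 hφ.2 (θ := θ)
        rw [abs_of_pos (by positivity), ← ENNReal.ofReal_mul (by positivity),
          ← ENNReal.ofReal_mul (by positivity)]
        refine ENNReal.ofReal_le_ofReal ?_
        calc _ ≤ 2 * n * Real.sin φ * (K * (Real.sin φ * (1 - r ^ 2)
              / chebyshevDenom r (Real.cos θ) (Real.cos φ)) / (2 * n)) := by gcongr
          _ = K * (Real.sin φ ^ 2 * (1 - r ^ 2)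
              / chebyshevDenom r (Real.cos θ) (Real.cos φ)) := by
            generalize chebyshevDenom r (Real.cos θ) (Real.cos φ) = w
            field_simp
          _ ≤ K * (20 * ((1 - r) / ((1 - r) ^ 2 + (θ - φ) ^ 2))) := by gcongr
          _ = _ := by ring
    _ ≤ ∫⁻ φ, ENNReal.ofReal (K * 20) *
          ENNReal.ofReal ((1 - r) / ((1 - r) ^ 2 + (θ - φ) ^ 2)) := setLIntegral_le_lintegral _ _
    _ = ENNReal.ofReal (K * 20 * Real.pi) := by
        rw [lintegral_const_mul' _ _ ENNReal.ofReal_ne_top, lintegral_cauchy (by linarith),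
          ← ENNReal.ofReal_mul (by positivity)]

end Mass

/-! ### Densities of finite-dimensional laws -/

section PathDensity

/-- The density at `y` of the values at times `s` of a chain with transition densities `p`, started
from `u` at time `s₀`. -/
def pathDensity (p : ℝ → ℝ → ℝ → ℝ → ℝ) {k : ℕ} (s₀ : ℝ) (s : Fin k → ℝ) (u : ℝ)
    (y : Fin k → ℝ) : ℝ :=
  ∏ i : Fin k, p ((Fin.cons s₀ s : Fin (k + 1) → ℝ) i.castSucc) (s i)
    ((Fin.cons u y : Fin (k + 1) → ℝ) i.castSucc) (y i)

theorem pathLaw_eq (p : ℝ → ℝ → ℝ → ℝ → ℝ) {k : ℕ} (s : Fin k → ℝ) (u : ℝ) :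
    pathLaw p s u = volume.withDensity fun y => ENNReal.ofReal (pathDensity p 0 s u y) := rfl

theorem pathDensity_cons (p : ℝ → ℝ → ℝ → ℝ → ℝ) {k : ℕ} (s₀ : ℝ) (s : Fin (k + 1) → ℝ) (u v : ℝ)
    (y : Fin k → ℝ) :
    pathDensity p s₀ s u (Fin.cons v y) =
      p s₀ (s 0) u v * pathDensity p (s 0) (Fin.tail s) v y := by
  rw [pathDensity, Fin.prod_univ_succ, pathDensity]
  congr 1
  refine Finset.prod_congr rfl fun i _ => ?_
  rw [Fin.cons_self_tail, ← Fin.succ_castSucc]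
  simp [Fin.tail]

theorem measurable_finCons {k : ℕ} :
    Measurable fun z : ℝ × (Fin k → ℝ) => (Fin.cons z.1 z.2 : Fin (k + 1) → ℝ) := by
  refine measurable_pi_lambda _ fun j => ?_
  refine Fin.cases ?_ (fun i => ?_) j
  · simpa using measurable_fst
  · simp only [Fin.cons_succ]
    exact (measurable_pi_apply i).comp measurable_snd

theorem measurable_pathDensity {p : ℝ → ℝ → ℝ → ℝ → ℝ} {k : ℕ} {s₀ : ℝ} {s : Fin k → ℝ}
    (h : ∀ i : Fin k, Measurable fun z : ℝ × ℝ =>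
      p ((Fin.cons s₀ s : Fin (k + 1) → ℝ) i.castSucc) (s i) z.1 z.2) :
    Measurable fun z : ℝ × (Fin k → ℝ) => pathDensity p s₀ s z.1 z.2 := by
  unfold pathDensity
  refine Finset.measurable_prod _ fun i _ => ?_
  exact (h i).comp (((measurable_pi_apply i.castSucc).comp measurable_finCons).prodMk
    ((measurable_pi_apply i).comp measurable_snd))

theorem lintegral_fin_succ {k : ℕ} {F : (Fin (k + 1) → ℝ) → ENNReal} (hF : Measurable F) :
    ∫⁻ y, F y = ∫⁻ v : ℝ, ∫⁻ y : Fin k → ℝ, F (Fin.cons v y) := by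
  have h := (volume_preserving_piFinSuccAbove (fun _ : Fin (k + 1) => ℝ) 0).symm
  rw [← h.lintegral_comp hF, Measure.volume_eq_prod, lintegral_prod]
  · exact lintegral_congr fun v => lintegral_congr fun y => congrArg F (Fin.insertNth_zero' v y)
  · exact (hF.comp (MeasurableEquiv.measurable _)).aemeasurable

theorem volume_univ_fin_zero : (volume : Measure (Fin 0 → ℝ)) Set.univ = 1 := by
  rw [volume_pi, Measure.pi_univ, Finset.prod_of_isEmpty]

theorem strictMono_finCons {k : ℕ} {s₀ : ℝ} {s : Fin (k + 1) → ℝ}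
    (h : StrictMono (Fin.cons s₀ s : Fin (k + 2) → ℝ)) : s₀ < s 0 ∧ StrictMono s := by
  constructor
  · simpa using h (Fin.succ_pos (0 : Fin (k + 1)))
  · intro i j hij
    simpa using h (Fin.succ_lt_succ_iff.2 hij)

theorem finCons_castSucc_lt {k : ℕ} {s₀ : ℝ} {s : Fin k → ℝ}
    (h : StrictMono (Fin.cons s₀ s : Fin (k + 1) → ℝ)) (i : Fin k) :
    s₀ ≤ (Fin.cons s₀ s : Fin (k + 1) → ℝ) i.castSucc ∧
      (Fin.cons s₀ s : Fin (k + 1) → ℝ) i.castSucc < s i := by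
  constructor
  · simpa using h.monotone (Fin.zero_le i.castSucc)
  · simpa using h (Fin.castSucc_lt_succ (i := i))

end PathDensity

/-! ### From densities to weak convergence -/

section Convergence

/-- Transition densities `P n` that converge to the transition probability densities `p` on
`(0, ∞)`, with the bounds that make the finite-dimensional laws converge. -/
structure DensityConvergence (P : ℕ → ℝ → ℝ → ℝ → ℝ → ℝ) (p : ℝ → ℝ → ℝ → ℝ → ℝ) : Prop where
  eventually_nonneg : ∀ {s t}, 0 ≤ s → s < t → ∀ᶠ n in atTop, ∀ u v, 0 ≤ P n s t u v
  eventually_measurable : ∀ {s t}, 0 ≤ s → s < t →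
    ∀ᶠ n in atTop, Measurable fun z : ℝ × ℝ => P n s t z.1 z.2
  eventually_zero : ∀ {s t}, 0 ≤ s → s < t → ∀ᶠ n in atTop, ∀ u v, v ≤ 0 → P n s t u v = 0
  limit : ∀ {s t u v}, 0 ≤ s → s < t → 0 < u → 0 < v →
    Tendsto (fun n => P n s t u v) atTop (𝓝 (p s t u v))
  dominated : ∀ {s t u}, 0 ≤ s → s < t → 0 < u →
    ∃ M : ℝ, 0 ≤ M ∧ ∀ᶠ n in atTop, ∀ v, P n s t u v ≤ M * p s t u v
  mass : ∀ {s t}, 0 ≤ s → s < t →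
    ∃ K : ℝ, ∀ᶠ n in atTop, ∀ u, ∫⁻ v, ENNReal.ofReal (P n s t u v) ≤ ENNReal.ofReal K
  nonneg : ∀ {s t}, s < t → ∀ u v, 0 ≤ p s t u v
  measurable : ∀ s t, Measurable fun z : ℝ × ℝ => p s t z.1 z.2
  zero : ∀ {s t u v}, v ≤ 0 → p s t u v = 0
  lintegral : ∀ {s t u}, s < t → 0 < u → ∫⁻ v, ENNReal.ofReal (p s t u v) = 1

namespace DensityConvergence

variable {P : ℕ → ℝ → ℝ → ℝ → ℝ → ℝ} {p : ℝ → ℝ → ℝ → ℝ → ℝ}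

theorem eventually_measurable_path (h : DensityConvergence P p) {k : ℕ} {s₀ : ℝ} {s : Fin k → ℝ}
    (h0 : 0 ≤ s₀) (hs : StrictMono (Fin.cons s₀ s : Fin (k + 1) → ℝ)) :
    ∀ᶠ n in atTop, Measurable fun z : ℝ × (Fin k → ℝ) => pathDensity (P n) s₀ s z.1 z.2 := by
  have : ∀ᶠ n in atTop, ∀ i : Fin k, Measurable fun z : ℝ × ℝ =>
      P n ((Fin.cons s₀ s : Fin (k + 1) → ℝ) i.castSucc) (s i) z.1 z.2 :=
    eventually_all.2 fun i => h.eventually_measurable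
      (h0.trans (finCons_castSucc_lt hs i).1) (finCons_castSucc_lt hs i).2
  exact this.mono fun n hn => measurable_pathDensity hn

theorem measurable_path (h : DensityConvergence P p) {k : ℕ} (s₀ : ℝ) (s : Fin k → ℝ) :
    Measurable fun z : ℝ × (Fin k → ℝ) => pathDensity p s₀ s z.1 z.2 :=
  measurable_pathDensity fun _ => h.measurable _ _

/-- Peeling off the first transition is the inductive step of all the following statements on paths.
-/
theorem lintegral_cons {p : ℝ → ℝ → ℝ → ℝ → ℝ} {k : ℕ} {s₀ : ℝ} {s : Fin (k + 1) → ℝ} {u : ℝ}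
    (hm : Measurable fun z : ℝ × (Fin (k + 1) → ℝ) => pathDensity p s₀ s z.1 z.2)
    (hm' : Measurable fun z : ℝ × (Fin k → ℝ) => pathDensity p (s 0) (Fin.tail s) z.1 z.2)
    (hp : ∀ v, 0 ≤ p s₀ (s 0) u v) {f : (Fin (k + 1) → ℝ) → ENNReal} (hf : Measurable f) :
    ∫⁻ y, f y * ENNReal.ofReal (pathDensity p s₀ s u y) =
      ∫⁻ v, ENNReal.ofReal (p s₀ (s 0) u v) *
        ∫⁻ y, f (Fin.cons v y) * ENNReal.ofReal (pathDensity p (s 0) (Fin.tail s) v y) := by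
  rw [lintegral_fin_succ (F := fun y => f y * ENNReal.ofReal (pathDensity p s₀ s u y))
    (hf.mul (hm.comp measurable_prodMk_left).ennreal_ofReal)]
  refine lintegral_congr fun v => ?_
  rw [← lintegral_const_mul]
  · refine lintegral_congr fun y => ?_
    rw [pathDensity_cons, ENNReal.ofReal_mul (hp v)]
    ring
  · exact (hf.comp (measurable_finCons.comp measurable_prodMk_left)).mul
      (hm'.comp measurable_prodMk_left).ennreal_ofReal

theorem lintegral_path_eq_one (h : DensityConvergence P p) {k : ℕ} : ∀ {s₀ : ℝ} {s : Fin k → ℝ}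
    {u : ℝ}, StrictMono (Fin.cons s₀ s : Fin (k + 1) → ℝ) → 0 < u →
    ∫⁻ y, ENNReal.ofReal (pathDensity p s₀ s u y) = 1 := by
  induction k with
  | zero => intro s₀ s u _ _; simp [pathDensity, volume_univ_fin_zero]
  | succ k ih =>
    intro s₀ s u hs hu
    obtain ⟨h1, h2⟩ := strictMono_finCons hs
    have e := lintegral_cons (h.measurable_path s₀ s) (h.measurable_path (s 0) (Fin.tail s))
      (h.nonneg h1 u) (f := fun _ => 1) measurable_const
    simp only [one_mul] at e
    rw [e, ← h.lintegral h1 hu]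
    refine lintegral_congr fun v => ?_
    -- The induction hypothesis needs a positive starting point; nonpositive ones carry no mass.
    rcases le_or_gt v 0 with hv | hv
    · rw [h.zero hv, ENNReal.ofReal_zero, zero_mul]
    · rw [ih (by rwa [Fin.cons_self_tail]) hv, mul_one]

theorem exists_lintegral_path_le (h : DensityConvergence P p) {k : ℕ} : ∀ {s₀ : ℝ} {s : Fin k → ℝ},
    0 ≤ s₀ → StrictMono (Fin.cons s₀ s : Fin (k + 1) → ℝ) →
    ∃ K : ℝ, 0 ≤ K ∧ ∀ᶠ n in atTop, ∀ u,
      ∫⁻ y, ENNReal.ofReal (pathDensity (P n) s₀ s u y) ≤ ENNReal.ofReal K := by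
  induction k with
  | zero =>
    intro s₀ s _ _
    exact ⟨1, zero_le_one, Eventually.of_forall fun n u => by
      simp [pathDensity, volume_univ_fin_zero]⟩
  | succ k ih =>
    intro s₀ s h0 hs
    obtain ⟨h1, h2⟩ := strictMono_finCons hs
    have hs' : StrictMono (Fin.cons (s 0) (Fin.tail s) : Fin (k + 1) → ℝ) := by
      rwa [Fin.cons_self_tail]
    have h0' : 0 ≤ s 0 := h0.trans h1.le
    obtain ⟨K, hK, hle⟩ := ih h0' hs'
    obtain ⟨L, hle'⟩ := h.mass h0 h1
    -- The constant `L` is not known to be nonnegative, and `ENNReal.ofReal_mul` needs a sign.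
    refine ⟨max L 0 * K, by positivity, ?_⟩
    filter_upwards [hle, hle', h.eventually_nonneg h0 h1, h.eventually_measurable_path h0 hs,
      h.eventually_measurable_path h0' hs', h.eventually_measurable h0 h1]
      with n hn1 hn2 hn3 hn4 hn5 hn6 u
    have e := lintegral_cons hn4 hn5 (hn3 u) (f := fun _ => 1) measurable_const
    simp only [one_mul] at e
    rw [e, ENNReal.ofReal_mul (le_max_right _ _)]
    calc _ ≤ ∫⁻ v, ENNReal.ofReal (P n s₀ (s 0) u v) * ENNReal.ofReal K :=
          lintegral_mono fun v => by gcongr; exact hn1 v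
      _ = (∫⁻ v, ENNReal.ofReal (P n s₀ (s 0) u v)) * ENNReal.ofReal K :=
          lintegral_mul_const _ (hn6.comp measurable_prodMk_left).ennreal_ofReal
      _ ≤ _ := by
          gcongr
          exact (hn2 u).trans (ENNReal.ofReal_le_ofReal (le_max_left _ _))

/-- Induction on the number of times, with dominated convergence in the first coordinate `v`. The
inner integral converges for each `v > 0` by induction and is at most `c * K` uniformly in `v`, so
domination of the one-step density from the fixed `u` suffices. -/
theorem tendsto_lintegral_path (h : DensityConvergence P p) {k : ℕ} :
    ∀ {s₀ : ℝ} {s : Fin k → ℝ} {u : ℝ}, 0 ≤ s₀ → StrictMono (Fin.cons s₀ s : Fin (k + 1) → ℝ) →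
    0 < u → ∀ {f : (Fin k → ℝ) → ENNReal} {c : ENNReal}, Measurable f → c ≠ ⊤ → (∀ y, f y ≤ c) →
    Tendsto (fun n => ∫⁻ y, f y * ENNReal.ofReal (pathDensity (P n) s₀ s u y)) atTop
      (𝓝 (∫⁻ y, f y * ENNReal.ofReal (pathDensity p s₀ s u y))) := by
  induction k with
  | zero =>
    intro s₀ s u _ _ _ f c _ _ _
    simp [pathDensity]
  | succ k ih =>
    intro s₀ s u h0 hs hu f c hf hc hfc
    obtain ⟨h1, h2⟩ := strictMono_finCons hs
    have hs' : StrictMono (Fin.cons (s 0) (Fin.tail s) : Fin (k + 1) → ℝ) := by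
      rwa [Fin.cons_self_tail]
    have h0' : 0 ≤ s 0 := h0.trans h1.le
    obtain ⟨K, hK, hle⟩ := h.exists_lintegral_path_le h0' hs'
    obtain ⟨M, hM, hdom⟩ := h.dominated h0 h1 hu
    have hfcons : Measurable fun z : ℝ × (Fin k → ℝ) => f (Fin.cons z.1 z.2) :=
      hf.comp measurable_finCons
    rw [lintegral_cons (h.measurable_path s₀ s) (h.measurable_path (s 0) (Fin.tail s))
      (h.nonneg h1 u) hf]
    have hev : ∀ᶠ n in atTop, ∫⁻ v, ENNReal.ofReal (P n s₀ (s 0) u v) *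
        ∫⁻ y, f (Fin.cons v y) * ENNReal.ofReal (pathDensity (P n) (s 0) (Fin.tail s) v y)
        = ∫⁻ y, f y * ENNReal.ofReal (pathDensity (P n) s₀ s u y) := by
      filter_upwards [h.eventually_nonneg h0 h1, h.eventually_measurable_path h0 hs,
        h.eventually_measurable_path h0' hs'] with n hn1 hn2 hn3
      rw [lintegral_cons hn2 hn3 (hn1 u) hf]
    refine Tendsto.congr' hev ?_
    refine tendsto_lintegral_filter_of_dominated_convergence
      (fun v => ENNReal.ofReal M * ENNReal.ofReal (p s₀ (s 0) u v) * (c * ENNReal.ofReal K))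
      ?_ ?_ ?_ ?_
    · filter_upwards [h.eventually_measurable h0 h1, h.eventually_measurable_path h0' hs']
        with n hn1 hn2
      refine (hn1.comp measurable_prodMk_left).ennreal_ofReal.mul ?_
      exact Measurable.lintegral_prod_right' (f := fun z : ℝ × (Fin k → ℝ) => f (Fin.cons z.1 z.2) *
        ENNReal.ofReal (pathDensity (P n) (s 0) (Fin.tail s) z.1 z.2))
        (hfcons.mul hn2.ennreal_ofReal)
    · filter_upwards [hle, hdom, h.eventually_measurable_path h0' hs'] with n hn1 hn2 hn3
      refine Eventually.of_forall fun v => ?_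
      gcongr
      · rw [← ENNReal.ofReal_mul hM]
        exact ENNReal.ofReal_le_ofReal (hn2 v)
      · calc _ ≤ ∫⁻ y, c * ENNReal.ofReal (pathDensity (P n) (s 0) (Fin.tail s) v y) :=
              lintegral_mono fun y => by gcongr; exact hfc _
          _ = c * ∫⁻ y, ENNReal.ofReal (pathDensity (P n) (s 0) (Fin.tail s) v y) :=
              lintegral_const_mul' _ _ hc
          _ ≤ _ := by gcongr; exact hn1 v
    · rw [lintegral_mul_const' _ _ (ENNReal.mul_ne_top hc ENNReal.ofReal_ne_top),
        lintegral_const_mul' _ _ ENNReal.ofReal_ne_top, h.lintegral h1 hu, mul_one]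
      exact ENNReal.mul_ne_top ENNReal.ofReal_ne_top (ENNReal.mul_ne_top hc ENNReal.ofReal_ne_top)
    · refine Eventually.of_forall fun v => ?_
      rcases le_or_gt v 0 with hv | hv
      · rw [h.zero hv, ENNReal.ofReal_zero, zero_mul]
        refine tendsto_const_nhds.congr' ?_
        filter_upwards [h.eventually_zero h0 h1] with n hn
        rw [hn u v hv, ENNReal.ofReal_zero, zero_mul]
      -- Multiplication in `ENNReal` is continuous at this pair because both limits are finite; for
      -- the inner integral this is its bound `c`.
      · refine ENNReal.Tendsto.mul (ENNReal.tendsto_ofReal (h.limit h0 h1 hu hv)) (Or.inr ?_)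
          (ih h0' hs' hv (hfcons.comp measurable_prodMk_left) hc fun y => hfc _)
          (Or.inr ENNReal.ofReal_ne_top)
        refine ne_top_of_le_ne_top hc ?_
        calc _ ≤ ∫⁻ y, c * ENNReal.ofReal (pathDensity p (s 0) (Fin.tail s) v y) :=
              lintegral_mono fun y => by gcongr; exact hfc _
          _ = c := by
              rw [lintegral_const_mul' _ _ hc, h.lintegral_path_eq_one hs' hv, mul_one]

theorem isProbabilityMeasure_pathLaw (h : DensityConvergence P p) {k : ℕ} {s : Fin k → ℝ} {u : ℝ}
    (hs : StrictMono (Fin.cons 0 s : Fin (k + 1) → ℝ)) (hu : 0 < u) :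
    IsProbabilityMeasure (pathLaw p s u) := by
  constructor
  rw [pathLaw_eq, withDensity_apply _ MeasurableSet.univ, Measure.restrict_univ,
    h.lintegral_path_eq_one hs hu]

theorem tendsto_integral_pathLaw (h : DensityConvergence P p) {k : ℕ} {s : Fin k → ℝ} {u : ℝ}
    (hs : StrictMono (Fin.cons 0 s : Fin (k + 1) → ℝ)) (hu : 0 < u)
    (f : BoundedContinuousFunction (Fin k → ℝ) ℝ) :
    Tendsto (fun n => ∫ y, f y ∂(pathLaw (P n) s u)) atTop (𝓝 (∫ y, f y ∂(pathLaw p s u))) := by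
  obtain ⟨K, hK, hle⟩ := h.exists_lintegral_path_le le_rfl hs
  -- The path laws are known to be finite measures only from some index on, so the sequence is
  -- shifted by `N` before using the topology on `FiniteMeasure`.
  obtain ⟨N, hN⟩ := eventually_atTop.1 (hle.and (h.eventually_measurable_path le_rfl hs))
  have hfin : ∀ n, IsFiniteMeasure (pathLaw (P (n + N)) s u) := fun n => by
    constructor
    rw [pathLaw_eq, withDensity_apply _ MeasurableSet.univ, Measure.restrict_univ]
    exact ((hN (n + N) (Nat.le_add_left N n)).1 u).trans_lt ENNReal.ofReal_lt_top
  have := h.isProbabilityMeasure_pathLaw hs hu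
  rw [← tendsto_add_atTop_iff_nat N]
  let μ : ℕ → FiniteMeasure (Fin k → ℝ) := fun n => ⟨pathLaw (P (n + N)) s u, hfin n⟩
  let ν : FiniteMeasure (Fin k → ℝ) := ⟨pathLaw p s u, inferInstance⟩
  suffices hμ : Tendsto μ atTop (𝓝 ν) from
    FiniteMeasure.tendsto_iff_forall_integral_tendsto.1 hμ f
  rw [FiniteMeasure.tendsto_iff_forall_lintegral_tendsto]
  intro g
  have hg : Measurable fun y => (g y : ENNReal) :=
    measurable_coe_nnreal_ennreal.comp g.continuous.measurable
  have hlim := (tendsto_add_atTop_iff_nat N).2 (h.tendsto_lintegral_path le_rfl hs hu hg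
    (c := (nndist g 0 : NNReal)) ENNReal.coe_ne_top fun y => by
      rw [ENNReal.coe_le_coe]
      simpa using BoundedContinuousFunction.NNReal.upper_bound g y)
  have hdens : ∀ r : ℝ → ℝ → ℝ → ℝ → ℝ,
      (Measurable fun z : ℝ × (Fin k → ℝ) => pathDensity r 0 s z.1 z.2) →
      ∫⁻ y, (g y : ENNReal) ∂(pathLaw r s u)
        = ∫⁻ y, (g y : ENNReal) * ENNReal.ofReal (pathDensity r 0 s u y) := fun r hr => by
    rw [pathLaw_eq, lintegral_withDensity_eq_lintegral_mul
      (f := fun y => ENNReal.ofReal (pathDensity r 0 s u y)) _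
      (hr.comp measurable_prodMk_left).ennreal_ofReal hg]
    exact lintegral_congr fun y => mul_comm (ENNReal.ofReal _) (g y : ENNReal)
  change Tendsto (fun n => ∫⁻ y, (g y : ENNReal) ∂(pathLaw (P (n + N)) s u)) atTop
    (𝓝 (∫⁻ y, (g y : ENNReal) ∂(pathLaw p s u)))
  rw [hdens p (h.measurable_path 0 s)]
  exact hlim.congr fun n => (hdens _ (hN (n + N) (Nat.le_add_left N n)).2).symm

end DensityConvergence

theorem densityConvergence_hatP {A B C D q : ℝ} (hq0 : 0 ≤ q) (hq1 : q < 1)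
    (hA0 : 0 ≤ A) (hA1 : A ≤ 1) (hC0 : 0 ≤ C) (hC1 : C < 1)
    (hB0 : -1 < B) (hB1 : B ≤ 0) (hD0 : -1 < D) (hD1 : D ≤ 0) :
    DensityConvergence (hatP A B C D q) tangentDensity := by
  have heq : ∀ {s t : ℝ}, 0 ≤ s → s < t → ∀ᶠ n in atTop, ∀ u v,
      hatP A B C D q n s t u v = hatPClosed C D q n s t u v := fun {s t} hs hst => by
    filter_upwards [eventually_gt_atTop 0, eventually_AWParams hq0 hq1 hA0 hA1 hC0 hC1 hB0 hB1
      hD0 hD1 (hs.trans hst.le)] with n hn h u v using hatP_eq hn hs hst h u v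
  refine ⟨fun {s t} hs hst => ?_, fun {s t} hs hst => ?_, fun {s t} hs hst => ?_,
    fun {s t u v} hs hst hu hv => ?_, fun {s t u} hs hst hu => ?_, fun {s t} hs hst => ?_,
    tangentDensity_nonneg, measurable_tangentDensity, tangentDensity_of_nonpos,
    lintegral_tangentDensity⟩
  · filter_upwards [heq hs hst, eventually_gt_atTop 0, eventually_AWParams hq0 hq1 hA0 hA1 hC0 hC1
      hB0 hB1 hD0 hD1 (hs.trans hst.le)] with n he hn h u v
    rw [he]
    exact hatPClosed_nonneg hn hs hst h u v
  · filter_upwards [heq hs hst, eventually_AWParams hq0 hq1 hA0 hA1 hC0 hC1 hB0 hB1 hD0 hD1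
      (hs.trans hst.le)] with n he h
    simp_rw [he]
    exact measurable_hatPClosed h
  · filter_upwards [heq hs hst] with n he u v hv
    rw [he, hatPClosed, if_neg fun h => not_lt.2 hv h.2.2.1]
  · refine (tendsto_hatPClosed hq0 hq1 hC0 hC1 hD1 hst hu.le hv.le).congr' ?_
    filter_upwards [heq hs hst] with n he using (he u v).symm
  · obtain ⟨M, hM, hle⟩ := eventually_hatPClosed_le_tangentDensity hq0 hq1 hC0 hC1 hD0 hD1 hs hst
      hu.le
    refine ⟨M, hM, ?_⟩
    filter_upwards [heq hs hst, hle] with n he hn v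
    rw [he]
    exact hn v
  · obtain ⟨K, hle⟩ := exists_lintegral_hatPClosed_le hq0 hq1 hC0 hC1 hD0 hD1 hs hst
    refine ⟨K, ?_⟩
    filter_upwards [heq hs hst, hle] with n he hn u
    simp_rw [he]
    exact hn u

end Convergence

/-! ### Asymptotics and bounds of the initial density -/

section InitialDensity

variable {A B C D q : ℝ}

/-- The normalizing constant of the law of the Askey–Wilson process at time `1`. -/
def awConst (A B C D q : ℝ) : ℝ :=
  qPoch q q * qPoch q (A * B) * qPoch q (A * C) * qPoch q (A * D) * qPoch q (B * C)
    * qPoch q (B * D) * qPoch q (C * D) / qPoch q (A * B * C * D)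

theorem awConst_pos (h : AWParams A B C D q 1) : 0 < awConst A B C D q := by
  have := h.const_pos
  rwa [mul_one, div_one] at this

/-- The `j = 0` factor `|1 - e^{2iθ}|² = 4 (1 - x ^ 2)` turns the singular `1 / √(1 - x ^ 2)` into
`√(1 - x ^ 2)`, isolating the behaviour at the edge. -/
theorem hatPi_zero_eq (h : AWParams A B C D q 1) {n : ℕ} (hn : 0 < n) {u : ℝ} (hu0 : 0 < u)
    (hu1 : u < 4 * n) :
    hatPi A B C D q n 0 u = √(1 - (1 - u / (2 * n)) ^ 2) * (awConst A B C D q / Real.pi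
      * qPochNormSq q (q * arccosExp (1 - u / (2 * n)) ^ 2)
      / (qPochNormSq q (A * arccosExp (1 - u / (2 * n)))
        * qPochNormSq q (B * arccosExp (1 - u / (2 * n)))
        * qPochNormSq q (C * arccosExp (1 - u / (2 * n)))
        * qPochNormSq q (D * arccosExp (1 - u / (2 * n))))) / n := by
  have hx := (abs_one_sub_lt_one hn).2 ⟨hu0, hu1⟩
  rw [hatPi, revTime_zero, awMarginalDensity_eq h.norm_q one_pos hx,
    qPochNormSq_succ h.norm_q (arccosExp (1 - u / (2 * n)) ^ 2),
    norm_one_sub_arccosExp_sq_sq hx.le, mul_comm _ (q : ℂ)]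
  simp only [Real.sqrt_one, mul_one, div_one]
  have hs := Real.sqrt_pos.2 (one_sub_sq_pos hx)
  have e : 4 * (1 - (1 - u / (2 * n)) ^ 2) / (2 * Real.pi * √(1 - (1 - u / (2 * n)) ^ 2))
      = 2 * √(1 - (1 - u / (2 * n)) ^ 2) / Real.pi := by
    have := Real.pi_pos
    rw [div_eq_div_iff (by positivity) this.ne']
    linear_combination (-4 * Real.pi) * sq_sqrt_one_sub hx.le
  change awConst A B C D q / _ * _ / _ = _
  generalize √(1 - (1 - u / (2 * n)) ^ 2) = σ at *
  generalize 1 - (1 - u / (2 * n)) ^ 2 = w at *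
  generalize qPochNormSq q (q * arccosExp (1 - u / (2 * n)) ^ 2) = z0
  generalize qPochNormSq q (A * arccosExp (1 - u / (2 * n))) = z1
  generalize qPochNormSq q (B * arccosExp (1 - u / (2 * n))) = z2
  generalize qPochNormSq q (C * arccosExp (1 - u / (2 * n))) = z3
  generalize qPochNormSq q (D * arccosExp (1 - u / (2 * n))) = z4
  linear_combination awConst A B C D q * z0 / (z1 * z2 * z3 * z4) / (2 * n) * e

/-- Used for `A = 1`: the vanishing factor `2 (1 - x)` equals `u / n` after rescaling, and `q` takes
the place of `A` in what remains. -/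
theorem qPochNormSq_arccosExp {x : ℝ} (hq : ‖q‖ < 1) (hx : |x| ≤ 1) :
    qPochNormSq q (((1 : ℝ) : ℂ) * arccosExp x) = 2 * (1 - x) * qPochNormSq q (q * arccosExp x) := by
  rw [Complex.ofReal_one, one_mul, qPochNormSq_succ hq, norm_one_sub_arccosExp_sq hx,
    mul_comm (q : ℂ)]

theorem tendsto_arccosExp_one_sub (u : ℝ) :
    Tendsto (fun n : ℕ => arccosExp (1 - u / (2 * n))) atTop (𝓝 1) :=
  tendsto_arccosExp (tendsto_one_sub_div u)

theorem tendsto_normSq_q_mul_sq (hq : ‖q‖ < 1) (u : ℝ) :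
    Tendsto (fun n : ℕ => qPochNormSq q (q * arccosExp (1 - u / (2 * n)) ^ 2)) atTop
      (𝓝 (qPoch q q ^ 2)) :=
  tendsto_qPochNormSq_mul hq tendsto_const_nhds
    (by simpa using (tendsto_arccosExp_one_sub u).pow 2)

theorem tendsto_normSq_mul (hq : ‖q‖ < 1) (a u : ℝ) :
    Tendsto (fun n : ℕ => qPochNormSq q (a * arccosExp (1 - u / (2 * n)))) atTop
      (𝓝 (qPoch q a ^ 2)) :=
  tendsto_qPochNormSq_mul hq tendsto_const_nhds (tendsto_arccosExp_one_sub u)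

theorem rpow_three_halves {x : ℝ} (hx : 0 < x) : x ^ (3 / 2 : ℝ) = x * √x := by
  rw [show (3 / 2 : ℝ) = 1 + 1 / 2 by norm_num, Real.rpow_add hx, Real.rpow_one, Real.sqrt_eq_rpow]

theorem eventually_lt_four_mul (u : ℝ) : ∀ᶠ n : ℕ in atTop, u < 4 * (n : ℝ) :=
  (tendsto_natCast_atTop_atTop.const_mul_atTop four_pos).eventually_gt_atTop u

theorem isEquivalent_div_mul {f : ℕ → ℝ} {g : ℕ → ℝ} {c d : ℝ} (hcd : c * d ≠ 0)
    (hg : ∀ᶠ n in atTop, g n ≠ 0) (h : Tendsto (fun n => g n * f n) atTop (𝓝 (c * d))) :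
    Asymptotics.IsEquivalent atTop f (fun n => c / g n * d) := by
  have h1 := ((Asymptotics.isEquivalent_const_iff_tendsto hcd).2 h).mul
    (Asymptotics.IsEquivalent.refl (u := fun n => (g n)⁻¹))
  refine (h1.congr_left ?_).congr_right ?_
  · filter_upwards [hg] with n hn
    simp only [Pi.mul_apply]
    field_simp
  · refine Eventually.of_forall fun n => ?_
    simp only [Pi.mul_apply, Function.const_apply]
    ring

theorem isEquivalent_hatPi_of_lt (h : AWParams A B C D q 1) (hA : A < 1) {u : ℝ} (hu : 0 < u) :
    Asymptotics.IsEquivalent atTop (fun n : ℕ => hatPi A B C D q n 0 u)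
      (fun n : ℕ => tangentC1 A B C D q / (n : ℝ) ^ (3 / 2 : ℝ) * u ^ (1 / 2 : ℝ)) := by
  have hq := h.norm_q
  have hP := fun {x : ℝ} (hx : x < 1) => (qPoch_pos h.q_nonneg h.q_lt hx).ne'
  have hQA := hP hA
  have hQB := hP (h.B_nonpos.trans_lt one_pos)
  have hQC := hP h.C_lt_one
  have hQD := hP (h.D_nonpos.trans_lt one_pos)
  have hc : tangentC1 A B C D q = awConst A B C D q / Real.pi * qPoch q q ^ 2
      / (qPoch q A ^ 2 * qPoch q B ^ 2 * qPoch q C ^ 2 * qPoch q D ^ 2) := by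
    simp only [tangentC1, awConst, mul_pow]
    ring
  have hcpos : tangentC1 A B C D q ≠ 0 := by
    rw [hc]
    have h1 := (awConst_pos h).ne'
    have h2 := Real.pi_ne_zero
    have h3 := hP h.q_lt
    positivity
  refine isEquivalent_div_mul (mul_ne_zero hcpos (Real.rpow_pos_of_pos hu _).ne') ?_ ?_
  · filter_upwards [eventually_gt_atTop 0] with n hn
    exact (Real.rpow_pos_of_pos (by exact_mod_cast hn) _).ne'
  have hG := tendsto_div_apply ((tendsto_normSq_q_mul_sq hq u).const_mul
    (awConst A B C D q / Real.pi)) ((((tendsto_normSq_mul hq A u).mul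
      (tendsto_normSq_mul hq B u)).mul (tendsto_normSq_mul hq C u)).mul
      (tendsto_normSq_mul hq D u)) (by positivity)
  have hlim := (tendsto_sqrt_one_sub_sq u).mul hG
  rw [← hc, mul_comm, Real.sqrt_eq_rpow] at hlim
  refine hlim.congr' ?_
  filter_upwards [eventually_gt_atTop 0, eventually_lt_four_mul u] with n hn hn4
  have hn' : (0 : ℝ) < n := by exact_mod_cast hn
  have e : ∀ σ X : ℝ, √(n : ℝ) * σ * X = n * √n * (σ * X / n) := fun σ X => by field_simp
  rw [hatPi_zero_eq h hn hu hn4, rpow_three_halves hn']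
  exact e _ _

/-- Dividing `√(1 - x ^ 2)`, of size `√u / √n`, by `u / n` produces the new exponents. In the
constant, the remaining `(q; q)_∞ ^ 2` cancels against the numerator, and one power of each of the
`B`, `C`, `D` products against the normalization. -/
theorem isEquivalent_hatPi_of_eq (h : AWParams 1 B C D q 1) {u : ℝ} (hu : 0 < u) :
    Asymptotics.IsEquivalent atTop (fun n : ℕ => hatPi 1 B C D q n 0 u)
      (fun n : ℕ => tangentC2 B C D q / (n : ℝ) ^ (1 / 2 : ℝ) * (1 / u ^ (1 / 2 : ℝ))) := by
  have hq := h.norm_q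
  have hP := fun {x : ℝ} (hx : x < 1) => (qPoch_pos h.q_nonneg h.q_lt hx).ne'
  have hQq := hP h.q_lt
  have hQB := hP (h.B_nonpos.trans_lt one_pos)
  have hQC := hP h.C_lt_one
  have hQD := hP (h.D_nonpos.trans_lt one_pos)
  have hc : tangentC2 B C D q = awConst 1 B C D q / Real.pi * qPoch q q ^ 2
      / (qPoch q q ^ 2 * qPoch q B ^ 2 * qPoch q C ^ 2 * qPoch q D ^ 2) := by
    simp only [tangentC2, awConst, one_mul]
    generalize qPoch q (B * C * D) = z1
    have hpi := Real.pi_ne_zero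
    field_simp
  have hcpos : tangentC2 B C D q ≠ 0 := by
    rw [hc]
    have h1 := (awConst_pos h).ne'
    have h2 := Real.pi_ne_zero
    positivity
  have hsu := Real.sqrt_pos.2 hu
  rw [← Real.sqrt_eq_rpow]
  refine isEquivalent_div_mul (mul_ne_zero hcpos (by positivity)) ?_ ?_
  · filter_upwards [eventually_gt_atTop 0] with n hn
    exact (Real.rpow_pos_of_pos (by exact_mod_cast hn) _).ne'
  have hG := tendsto_div_apply ((tendsto_normSq_q_mul_sq hq u).const_mul
    (awConst 1 B C D q / Real.pi)) ((((tendsto_normSq_mul hq q u).mul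
      (tendsto_normSq_mul hq B u)).mul (tendsto_normSq_mul hq C u)).mul
      (tendsto_normSq_mul hq D u)) (by positivity)
  have hlim := (((tendsto_sqrt_one_sub_sq u).div_const u).mul hG)
  rw [← hc, mul_comm, Real.sqrt_div_self', ] at hlim
  refine hlim.congr' ?_
  filter_upwards [eventually_gt_atTop 0, eventually_lt_four_mul u] with n hn hn4
  have hn' : (0 : ℝ) < n := by exact_mod_cast hn
  have hx := abs_one_sub_le_one hn hu.le hn4.le
  rw [hatPi_zero_eq h hn hu hn4, qPochNormSq_arccosExp hq hx, ← Real.sqrt_eq_rpow,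
    show 2 * (1 - (1 - u / (2 * n))) = u / n by field_simp; ring]
  generalize qPochNormSq q (q * arccosExp (1 - u / (2 * n))) = z1
  generalize qPochNormSq q (B * arccosExp (1 - u / (2 * n))) = z2
  generalize qPochNormSq q (C * arccosExp (1 - u / (2 * n))) = z3
  generalize qPochNormSq q (D * arccosExp (1 - u / (2 * n))) = z4
  generalize awConst 1 B C D q / Real.pi * _ = z5
  have e : (n : ℝ) * (n : ℝ)⁻¹ = 1 := mul_inv_cancel₀ hn'.ne'
  simp only [div_eq_mul_inv, mul_inv, inv_inv]
  linear_combination (-√(n : ℝ) * √(1 - (1 - u * (2⁻¹ * (n : ℝ)⁻¹)) ^ 2) * u⁻¹ * z5 * z1⁻¹ * z2⁻¹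
    * z3⁻¹ * z4⁻¹) * e

theorem sqrt_one_sub_sq_le {n : ℕ} (hn : 0 < n) {u : ℝ} (hu : 0 ≤ u) :
    √(1 - (1 - u / (2 * n)) ^ 2) ≤ √u / √n := by
  rw [← Real.sqrt_div hu, one_sub_sq_eq hn]
  refine Real.sqrt_le_sqrt (div_le_div_of_nonneg_right (mul_le_of_le_one_right hu ?_)
    (Nat.cast_nonneg n))
  have : 0 ≤ u / (4 * n) := by positivity
  linarith

theorem hatPi_zero_of_le (A B C D q : ℝ) {n : ℕ} (hn : 0 < n) {u : ℝ} (hu : 4 * n ≤ u) :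
    hatPi A B C D q n 0 u = 0 := by
  rw [hatPi, awMarginalDensity_of_not_lt, zero_div]
  rw [abs_one_sub_lt_one hn]
  exact fun h => not_lt.2 hu h.2

/-- For `u < 4n` the four denominators are bounded below on a disc of radius less than one, and `√(1
- x ^ 2) ≤ √u / √n`; for `u ≥ 4n` the density vanishes. -/
theorem exists_hatPi_le_of_lt (h : AWParams A B C D q 1) (hA : A < 1) :
    ∃ c : ℝ, ∀ᶠ n : ℕ in atTop, ∀ u : ℝ, 0 < u →
      hatPi A B C D q n 0 u ≤ c / (n : ℝ) ^ (3 / 2 : ℝ) * u ^ (1 / 2 : ℝ) := by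
  have hB : |B| < 1 := abs_lt.2 ⟨h.B_gt, h.B_nonpos.trans_lt one_pos⟩
  have hC : |C| < 1 := abs_lt.2 ⟨by linarith [h.C_nonneg], h.C_lt_one⟩
  have hD : |D| < 1 := abs_lt.2 ⟨h.D_gt_neg_one, h.D_nonpos.trans_lt one_pos⟩
  have hA' : |A| < 1 := by rwa [abs_of_nonneg h.A_nonneg]
  obtain ⟨m, M, hm, hM, hlow, hup⟩ := exists_qPochNormSq_bounds h.norm_q
    (max_lt (max_lt hA' hB) (max_lt hC hD))
  have hκ := awConst_pos h
  have hpi := Real.pi_pos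
  refine ⟨awConst A B C D q / Real.pi * M / (m * m * m * m), ?_⟩
  filter_upwards [eventually_gt_atTop 0] with n hn u hu
  have hn' : (0 : ℝ) < n := by exact_mod_cast hn
  rcases le_or_gt (4 * (n : ℝ)) u with hn4 | hn4
  · rw [hatPi_zero_of_le _ _ _ _ _ hn hn4]
    positivity
  rw [hatPi_zero_eq h hn hu hn4, rpow_three_halves hn', ← Real.sqrt_eq_rpow]
  have hσ := sqrt_one_sub_sq_le hn hu.le
  have hb : ∀ a : ℝ, |a| ≤ max (max |A| |B|) (max |C| |D|) →
      m ≤ qPochNormSq q (a * arccosExp (1 - u / (2 * n))) := fun a ha =>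
    hlow _ (by rwa [norm_mul_arccosExp])
  have b1 := hb A ((le_max_left _ _).trans (le_max_left _ _))
  have b2 := hb B ((le_max_right _ _).trans (le_max_left _ _))
  have b3 := hb C ((le_max_left _ _).trans (le_max_right _ _))
  have b4 := hb D ((le_max_right _ _).trans (le_max_right _ _))
  have b5 := hup (q * arccosExp (1 - u / (2 * n)) ^ 2) (by
    rw [norm_mul, norm_pow, norm_arccosExp, one_pow, mul_one, Complex.norm_real]
    exact h.norm_q.le)
  have hN := fun z => qPochNormSq_nonneg q z
  calc _ ≤ √u / √n * (awConst A B C D q / Real.pi * M / (m * m * m * m)) / n := by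
        gcongr
        · exact div_nonneg (mul_nonneg (by positivity) (hN _))
            (mul_nonneg (mul_nonneg (mul_nonneg (hN _) (hN _)) (hN _)) (hN _))
        · exact mul_nonneg (mul_nonneg (hN _) (hN _)) (hN _)
        · exact mul_nonneg (hN _) (hN _)
        · exact hN _
    _ = _ := by
        generalize awConst A B C D q / Real.pi * M / (m * m * m * m) = w
        field_simp

theorem exists_hatPi_le_of_eq (h : AWParams 1 B C D q 1) :
    ∃ c : ℝ, ∀ᶠ n : ℕ in atTop, ∀ u : ℝ, 0 < u →
      hatPi 1 B C D q n 0 u ≤ c / (n : ℝ) ^ (1 / 2 : ℝ) * (1 / u ^ (1 / 2 : ℝ)) := by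
  have hq : |q| < 1 := h.norm_q
  have hB : |B| < 1 := abs_lt.2 ⟨h.B_gt, h.B_nonpos.trans_lt one_pos⟩
  have hC : |C| < 1 := abs_lt.2 ⟨by linarith [h.C_nonneg], h.C_lt_one⟩
  have hD : |D| < 1 := abs_lt.2 ⟨h.D_gt_neg_one, h.D_nonpos.trans_lt one_pos⟩
  obtain ⟨m, M, hm, hM, hlow, hup⟩ := exists_qPochNormSq_bounds h.norm_q
    (max_lt (max_lt hq hB) (max_lt hC hD))
  have hκ := awConst_pos h
  have hpi := Real.pi_pos
  refine ⟨awConst 1 B C D q / Real.pi * M / (m * m * m * m), ?_⟩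
  filter_upwards [eventually_gt_atTop 0] with n hn u hu
  have hn' : (0 : ℝ) < n := by exact_mod_cast hn
  rcases le_or_gt (4 * (n : ℝ)) u with hn4 | hn4
  · rw [hatPi_zero_of_le _ _ _ _ _ hn hn4]
    positivity
  have hx := abs_one_sub_le_one hn hu.le hn4.le
  rw [hatPi_zero_eq h hn hu hn4, qPochNormSq_arccosExp h.norm_q hx, ← Real.sqrt_eq_rpow,
    ← Real.sqrt_eq_rpow, show 2 * (1 - (1 - u / (2 * n))) = u / n by field_simp; ring]
  have hσ := sqrt_one_sub_sq_le hn hu.le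
  have hb : ∀ a : ℝ, |a| ≤ max (max |q| |B|) (max |C| |D|) →
      m ≤ qPochNormSq q (a * arccosExp (1 - u / (2 * n))) := fun a ha =>
    hlow _ (by rwa [norm_mul_arccosExp])
  have b1 := hb q ((le_max_left _ _).trans (le_max_left _ _))
  have b2 := hb B ((le_max_right _ _).trans (le_max_left _ _))
  have b3 := hb C ((le_max_left _ _).trans (le_max_right _ _))
  have b4 := hb D ((le_max_right _ _).trans (le_max_right _ _))
  have b5 := hup (q * arccosExp (1 - u / (2 * n)) ^ 2) (by
    rw [norm_mul, norm_pow, norm_arccosExp, one_pow, mul_one, Complex.norm_real]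
    exact h.norm_q.le)
  have hN := fun z => qPochNormSq_nonneg q z
  have hun : 0 ≤ u / n := by positivity
  have hsu := Real.sqrt_pos.2 hu
  have hsq : √u ^ 2 = u := Real.sq_sqrt hu.le
  calc _ ≤ √u / √n * (awConst 1 B C D q / Real.pi * M / (u / n * m * m * m * m)) / n := by
        gcongr
        · exact div_nonneg (mul_nonneg (by positivity) (hN _)) (mul_nonneg (mul_nonneg (mul_nonneg
            (mul_nonneg hun (hN _)) (hN _)) (hN _)) (hN _))
        · exact mul_nonneg (mul_nonneg (mul_nonneg hun (hN _)) (hN _)) (hN _)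
        · exact mul_nonneg (mul_nonneg hun (hN _)) (hN _)
        · exact mul_nonneg hun (hN _)
    _ = √u / u * (awConst 1 B C D q / Real.pi * M / (m * m * m * m)) / √n := by
        generalize awConst 1 B C D q / Real.pi * M = w
        field_simp
    _ = _ := by
        rw [Real.sqrt_div_self']
        ring

end InitialDensity

/-! ### Conditional laws from joint densities -/

section CondDistrib

/-- The densities `ρ u` form a kernel that disintegrates the joint law over the law of `X`, and such
a kernel is almost everywhere unique. The mass bound makes the kernel finite, so `ρ u` need not be
known to be a probability density. -/
theorem condDistrib_of_density {Ω E : Type*} [MeasurableSpace Ω] [MeasurableSpace E]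
    [StandardBorelSpace E] [Nonempty E] {P : Measure Ω} [IsProbabilityMeasure P] {μ : Measure E}
    [SFinite μ] {X : Ω → ℝ} {W : Ω → E} (hX : Measurable X) (hW : Measurable W)
    {a : ℝ → ENNReal} (ha : Measurable a) {ρ : ℝ → E → ENNReal}
    (hρ : Measurable (Function.uncurry ρ)) (hlawX : P.map X = volume.withDensity a)
    (hlaw : P.map (fun ω => (X ω, W ω)) =
      (volume.prod μ).withDensity fun z => a z.1 * ρ z.1 z.2)
    {K : ENNReal} (hK : K < ⊤) (hmass : ∀ u, ∫⁻ w, ρ u w ∂μ ≤ K) :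
    ∀ᵐ u ∂(P.map X), condDistrib W X P u = μ.withDensity (ρ u) := by
  let κ : Kernel ℝ E := (Kernel.const ℝ μ).withDensity ρ
  have hκ : ∀ u, κ u = μ.withDensity (ρ u) := fun u => by
    rw [Kernel.withDensity_apply _ hρ, Kernel.const_apply]
  have hfin : IsFiniteKernel κ := ⟨K, hK, fun u => by
    rw [hκ, withDensity_apply _ MeasurableSet.univ, Measure.restrict_univ]
    exact hmass u⟩
  have hprob : IsProbabilityMeasure (P.map fun ω => (X ω, W ω)) :=
    Measure.isProbabilityMeasure_map (hX.prodMk hW).aemeasurable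
  have hprobX : IsProbabilityMeasure (P.map X) :=
    Measure.isProbabilityMeasure_map hX.aemeasurable
  have hcomp : P.map (fun ω => (X ω, W ω)) = P.map X ⊗ₘ κ := by
    refine Measure.ext_prod fun {S G} hS hG => ?_
    have hD : Measurable fun z : ℝ × E => a z.1 * ρ z.1 z.2 := (ha.comp measurable_fst).mul hρ
    rw [Measure.compProd_apply_prod hS hG, hlaw, withDensity_apply _ (hS.prod hG),
      setLIntegral_prod _ hD.aemeasurable, hlawX,
      setLIntegral_withDensity_eq_setLIntegral_mul _ ha (Kernel.measurable_coe κ hG) hS]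
    refine setLIntegral_congr_fun hS fun u _ => ?_
    simp only [Pi.mul_apply]
    rw [hκ, withDensity_apply _ hG]
    exact lintegral_const_mul _ hρ.of_uncurry_left
  filter_upwards [condDistrib_ae_eq_of_measure_eq_compProd X hW.aemeasurable hcomp] with u hu
  rw [hu, hκ]

end CondDistrib

/-! ### Joint laws of the rescaled process -/

section RescaledLaw

theorem awAtoms_eq_zero {q : ℝ} {a : ℂ} (ha : ‖a‖ ≤ 1) (b c d : ℂ) : awAtoms q a b c d = 0 := by
  simp [awAtoms, not_lt.2 ha]

theorem lintegral_preimage_rescale {n : ℕ} (hn : 0 < n) (g : ℝ → ℝ) {S : Set ℝ}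
    (hS : MeasurableSet S) :
    ∫⁻ x in (fun x : ℝ => 2 * n * (1 - x)) ⁻¹' S, ENNReal.ofReal (g x)
      = ∫⁻ u in S, ENNReal.ofReal (g (1 - u / (2 * n)) / (2 * n)) := by
  have hn' : (0 : ℝ) < n := by exact_mod_cast hn
  have himg : (fun x : ℝ => 2 * n * (1 - x)) ⁻¹' S = (fun u : ℝ => 1 - u / (2 * n)) '' S := by
    ext x
    constructor
    · intro hx
      refine ⟨_, hx, ?_⟩
      simp only
      field_simp
      ring
    · rintro ⟨u, hu, rfl⟩
      have : 2 * n * (1 - (1 - u / (2 * n))) = u := by field_simp; ring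
      rwa [Set.mem_preimage, this]
  have hd : ∀ u ∈ S, HasDerivWithinAt (fun u : ℝ => 1 - u / (2 * n)) (-(1 / (2 * n : ℝ))) S u :=
    fun u _ => (((hasDerivAt_id' u).div_const _).const_sub 1).hasDerivWithinAt
  rw [himg, lintegral_image_eq_lintegral_abs_deriv_mul hS hd]
  · refine lintegral_congr fun u => ?_
    rw [abs_neg, abs_of_pos (by positivity), ← ENNReal.ofReal_mul (by positivity), mul_comm,
      mul_one_div]
  · intro u _ v _ huv
    have : u / (2 * n) = v / (2 * n) := by
      simp only at huv
      linarith
    rwa [div_left_inj' (by positivity)] at this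

variable {A B C D q : ℝ}

namespace AWParams

variable {t s : ℝ}

/-- All four parameters have modulus at most one, so no atoms arise; `A√t = 1` is allowed since
atoms need modulus greater than one. -/
theorem awMarginal_eq (h : AWParams A B C D q t) :
    awMarginal A B C D q t =
      volume.withDensity fun x => ENNReal.ofReal (awMarginalDensity A B C D q t x) := by
  have hA := h.abs_A
  have hB := h.abs_B.le
  have hC := h.abs_C.le
  have hD := h.abs_D.le
  rw [← Real.norm_eq_abs, ← Complex.norm_real] at hA hB hC hD
  rw [awMarginal, awMeasure, awAtoms_eq_zero hA, awAtoms_eq_zero hB, awAtoms_eq_zero hC,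
    awAtoms_eq_zero hD]
  simp only [add_zero]
  rfl

theorem awTransition_eq (h : AWParams A B C D q t) (hts : t < s) (hs : s ≤ 1) {y : ℝ}
    (hy : |y| ≤ 1) :
    awTransition A B q t s y =
      volume.withDensity fun x => ENNReal.ofReal (awTransitionDensity A B q t s y x) := by
  have h' := h.mono hts.le hs
  have hA := h'.abs_A
  have hB := h'.abs_B.le
  rw [← Real.norm_eq_abs, ← Complex.norm_real] at hA hB
  have e1 : rootPlus y = arccosExp y := by rw [rootPlus, if_pos hy, arccosExp]
  have e2 : rootMinus y = (starRingEnd ℂ) (arccosExp y) := by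
    rw [rootMinus, if_pos hy, conj_arccosExp]
  have h1 := (h.norm_sqrt_div_mul hts _ 1 (norm_arccosExp y) norm_one).le
  have h2 := (h.norm_sqrt_div_mul hts ((starRingEnd ℂ) (arccosExp y)) 1
    (by rw [RCLike.norm_conj, norm_arccosExp]) norm_one).le
  rw [mul_one, ← e1] at h1
  rw [mul_one, ← e2] at h2
  rw [awTransition, awMeasure, awAtoms_eq_zero hA, awAtoms_eq_zero hB, awAtoms_eq_zero h1,
    awAtoms_eq_zero h2]
  simp only [add_zero]
  rfl

theorem awMarginalDensity_nonneg (h : AWParams A B C D q t) (x : ℝ) :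
    0 ≤ awMarginalDensity A B C D q t x := by
  by_cases hx : |x| < 1
  · exact (h.awMarginalDensity_pos hx).le
  · rw [awMarginalDensity_of_not_lt hx]

theorem measurable_awMarginalDensity (h : AWParams A B C D q t) :
    Measurable (awMarginalDensity A B C D q t) := by
  have hN := (continuous_qPochNormSq h.norm_q).measurable
  have he := continuous_arccosExp.measurable
  have hset : MeasurableSet {x : ℝ | |x| < 1} := measurableSet_lt (by fun_prop) measurable_const
  have e : awMarginalDensity A B C D q t = {x : ℝ | |x| < 1}.indicator fun x =>
      (qPoch q q * qPoch q (A * B * t) * qPoch q (A * C) * qPoch q (A * D) * qPoch q (B * C)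
          * qPoch q (B * D) * qPoch q (C * D / t) / qPoch q (A * B * C * D))
        / (2 * Real.pi * √(1 - x ^ 2))
      * (qPochNormSq q (arccosExp x ^ 2) /
        (qPochNormSq q ((A * √t : ℝ) * arccosExp x) * qPochNormSq q ((B * √t : ℝ) * arccosExp x)
          * qPochNormSq q ((C / √t : ℝ) * arccosExp x)
          * qPochNormSq q ((D / √t : ℝ) * arccosExp x))) := by
    funext x
    by_cases hx : |x| < 1
    · have hx' : x ∈ {x : ℝ | |x| < 1} := hx
      rw [Set.indicator_of_mem hx', awMarginalDensity_eq h.norm_q h.t_pos hx]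
    · have hx' : x ∉ {x : ℝ | |x| < 1} := hx
      rw [Set.indicator_of_notMem hx', awMarginalDensity_of_not_lt hx]
  rw [e]
  exact Measurable.indicator (by fun_prop) hset

end AWParams

section Rescaled

variable {n : ℕ} {s t : ℝ}

theorem hatPi_nonneg (h : AWParams A B C D q (revTime n s)) (u : ℝ) :
    0 ≤ hatPi A B C D q n s u :=
  div_nonneg (h.awMarginalDensity_nonneg _) (by positivity)

theorem measurable_hatPi (h : AWParams A B C D q (revTime n s)) :
    Measurable (hatPi A B C D q n s) := by
  have := h.measurable_awMarginalDensity
  unfold hatPi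
  fun_prop

theorem hatPi_pos (hn : 0 < n) (h : AWParams A B C D q (revTime n s)) {u : ℝ}
    (hu : 0 < u ∧ u < 4 * n) : 0 < hatPi A B C D q n s u :=
  div_pos (h.awMarginalDensity_pos ((abs_one_sub_lt_one hn).2 hu)) (by positivity)

theorem hatPi_eq_zero (hn : 0 < n) {u : ℝ} (hu : ¬ (0 < u ∧ u < 4 * n)) :
    hatPi A B C D q n s u = 0 := by
  rw [hatPi, awMarginalDensity_of_not_lt (by rwa [abs_one_sub_lt_one hn]), zero_div]

/-- The forward transition density of the rescaled process, from `v` at time `t` to `u` at time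
`s < t`, expressed through the backward one. -/
def hatForward (A B C D q : ℝ) (n : ℕ) (s t v u : ℝ) : ℝ :=
  hatPi A B C D q n s u * hatPClosed C D q n s t u v / hatPi A B C D q n t v

theorem awTransitionDensity_rescale (hn : 0 < n) (hs : 0 ≤ s) (hst : s < t)
    (h : AWParams A B C D q (revTime n t)) {v : ℝ} (hv : 0 < v ∧ v < 4 * n) (u : ℝ) :
    awTransitionDensity A B q (revTime n t) (revTime n s) (1 - v / (2 * n)) (1 - u / (2 * n))
      / (2 * n) = hatForward A B C D q n s t v u := by
  have hn' : (0 : ℝ) < n := by exact_mod_cast hn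
  by_cases hu : 0 < u ∧ u < 4 * n
  · have hb := h.transition_mul_marginal (revTime_lt hn hst) (revTime_le_one n hs)
      ((abs_one_sub_lt_one hn).2 hu) ((abs_one_sub_lt_one hn).2 hv)
    rw [hatForward, eq_div_iff (hatPi_pos hn h hv).ne', hatPClosed,
      if_pos ⟨hu.1.le, hu.2, hv.1, hv.2⟩, hatPi, hatPi]
    linear_combination 1 / (2 * n) / (2 * n) * hb
  · rw [hatForward, hatPi_eq_zero hn hu, awTransitionDensity,
      awDensity_of_not_lt (by rwa [abs_one_sub_lt_one hn]), zero_div, zero_mul, zero_div]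

theorem measurable_hatForward (hn : 0 < n) (hst : s < t) (hs : 0 ≤ s)
    (h : AWParams A B C D q (revTime n t)) :
    Measurable fun z : ℝ × ℝ => hatForward A B C D q n s t z.1 z.2 := by
  have h' := h.mono (revTime_lt hn hst).le (revTime_le_one n hs)
  have h1 := measurable_hatPi h
  have h2 := measurable_hatPi h'
  have h3 := (measurable_hatPClosed h (s := s)).comp measurable_swap
  unfold hatForward
  exact ((h2.comp measurable_snd).mul h3).div (h1.comp measurable_fst)

/-- Bayes' formula without division: where the marginal density at `v` vanishes, both sides are
zero, so the identity holds everywhere. -/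
theorem ofReal_hatForward_mul (hn : 0 < n) (hs : 0 ≤ s) (hst : s < t)
    (h : AWParams A B C D q (revTime n t)) (u v : ℝ) :
    ENNReal.ofReal (hatForward A B C D q n s t v u) * ENNReal.ofReal (hatPi A B C D q n t v)
      = ENNReal.ofReal (hatPi A B C D q n s u) * ENNReal.ofReal (hatPClosed C D q n s t u v) := by
  have h' := h.mono (revTime_lt hn hst).le (revTime_le_one n hs)
  rw [mul_comm, ← ENNReal.ofReal_mul (hatPi_nonneg h v), ← ENNReal.ofReal_mul (hatPi_nonneg h' u)]
  congr 1
  by_cases hv : 0 < v ∧ v < 4 * n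
  · rw [hatForward, mul_div_cancel₀ _ (hatPi_pos hn h hv).ne']
  · rw [hatPi_eq_zero hn hv, hatPClosed, if_neg fun hc => hv hc.2.2, zero_mul, mul_zero]

theorem awTransition_rescale (hn : 0 < n) (hs : 0 ≤ s) (hst : s < t)
    (h : AWParams A B C D q (revTime n t)) {v : ℝ} (hv : 0 < v ∧ v < 4 * n) {S : Set ℝ}
    (hS : MeasurableSet S) :
    awTransition A B q (revTime n t) (revTime n s) (1 - v / (2 * n))
      ((fun x => 2 * n * (1 - x)) ⁻¹' S)
      = ∫⁻ u in S, ENNReal.ofReal (hatForward A B C D q n s t v u) := by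
  have hpre : MeasurableSet ((fun x : ℝ => 2 * n * (1 - x)) ⁻¹' S) :=
    (by fun_prop : Measurable fun x : ℝ => 2 * n * (1 - x)) hS
  rw [h.awTransition_eq (revTime_lt hn hst) (revTime_le_one n hs)
    ((abs_one_sub_lt_one hn).2 hv).le, withDensity_apply _ hpre, lintegral_preimage_rescale hn _ hS]
  simp_rw [awTransitionDensity_rescale hn hs hst h hv]

end Rescaled

section Law

variable {Ω : Type*} {Y : ℝ → Ω → ℝ} {n : ℕ} {s t : ℝ}

/-- The events that depend on the Askey–Wilson process up to time `r`. -/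
abbrev awPast (Y : ℝ → Ω → ℝ) (r : ℝ) : MeasurableSpace Ω :=
  ⨆ r' ∈ Set.Ioc 0 r, MeasurableSpace.comap (Y r') inferInstance

/-- The time change is decreasing, so the rescaled future is the original past. This is what makes
the Markov property of `Y` applicable. -/
theorem measurable_awPast_hatY (hst : s ≤ t) :
    Measurable[awPast Y (revTime n s)] (hatY Y n t) := by
  have h1 : Measurable[awPast Y (revTime n s)] (Y (revTime n t)) := by
    rw [measurable_iff_comap_le]
    exact le_iSup₂_of_le (f := fun r' (_ : r' ∈ Set.Ioc 0 (revTime n s)) =>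
      MeasurableSpace.comap (Y r') inferInstance) (revTime n t)
      ⟨revTime_pos n t, revTime_le hst⟩ le_rfl
  exact (by fun_prop : Measurable fun x : ℝ => 2 * n * (1 - x)).comp h1

theorem measurable_awPast_path {k : ℕ} {r : Fin k → ℝ} (hr : ∀ i, s ≤ r i) :
    Measurable[awPast Y (revTime n s)] fun ω i => hatY Y n (r i) ω :=
  @measurable_pi_lambda Ω (Fin k) (fun _ => ℝ) (awPast Y (revTime n s)) _ _ fun i =>
    measurable_awPast_hatY (hr i)

variable [MeasurableSpace Ω] {P : Measure Ω}

theorem IsAskeyWilsonProcess.measurable_hatY (hY : IsAskeyWilsonProcess A B C D q P Y)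
    (hs : 0 ≤ s) : Measurable (hatY Y n s) := by
  have := hY.measurable _ (revTime_pos n s) (revTime_le_one n hs)
  unfold hatY
  fun_prop

theorem IsAskeyWilsonProcess.map_hatY (hY : IsAskeyWilsonProcess A B C D q P Y) (hn : 0 < n)
    (hs : 0 ≤ s) (h : AWParams A B C D q (revTime n s)) :
    P.map (hatY Y n s) =
      volume.withDensity fun u => ENNReal.ofReal (hatPi A B C D q n s u) := by
  ext S hS
  have hpre : MeasurableSet ((fun x : ℝ => 2 * n * (1 - x)) ⁻¹' S) :=
    (by fun_prop : Measurable fun x : ℝ => 2 * n * (1 - x)) hS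
  have hm := hY.measurable _ (revTime_pos n s) (revTime_le_one n hs)
  rw [Measure.map_apply (hY.measurable_hatY hs) hS, withDensity_apply _ hS]
  have e : hatY Y n s ⁻¹' S = Y (revTime n s) ⁻¹' ((fun x : ℝ => 2 * n * (1 - x)) ⁻¹' S) := rfl
  rw [e, ← Measure.map_apply hm hpre, hY.marginal _ h.t_pos h.t_le, h.awMarginal_eq,
    withDensity_apply _ hpre, lintegral_preimage_rescale hn _ hS]
  rfl

theorem IsAskeyWilsonProcess.ae_hatY_mem (hY : IsAskeyWilsonProcess A B C D q P Y) (hn : 0 < n)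
    (hs : 0 ≤ s) (h : AWParams A B C D q (revTime n s)) :
    ∀ᵐ ω ∂P, 0 < hatY Y n s ω ∧ hatY Y n s ω < 4 * n := by
  refine ae_of_ae_map (p := fun u => 0 < u ∧ u < 4 * (n : ℝ))
    (hY.measurable_hatY hs).aemeasurable ?_
  rw [hY.map_hatY hn hs h, ae_withDensity_iff (measurable_hatPi h).ennreal_ofReal]
  refine Eventually.of_forall fun u hu => ?_
  by_contra hc
  exact hu (by rw [hatPi_eq_zero hn hc, ENNReal.ofReal_zero])

variable [IsProbabilityMeasure P]

/-- Prepending the state at time `s` to a random variable that depends on the rescaled process from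
time `t` on. -/
theorem IsAskeyWilsonProcess.map_hatY_prod (hY : IsAskeyWilsonProcess A B C D q P Y) (hn : 0 < n)
    (hs : 0 ≤ s) (hst : s < t) (h : AWParams A B C D q (revTime n t))
    {E : Type*} [MeasurableSpace E] {μ : Measure E} [SFinite μ] {Z : Ω → E} {f : E → ℝ}
    {g : E → ENNReal} (hZ : Measurable Z) (hZpast : Measurable[awPast Y (revTime n t)] Z)
    (hf : Measurable f) (hfZ : ∀ ω, f (Z ω) = hatY Y n t ω) (hg : Measurable g)
    (hlaw : P.map Z = μ.withDensity fun z => ENNReal.ofReal (hatPi A B C D q n t (f z)) * g z) :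
    P.map (fun ω => (hatY Y n s ω, Z ω)) = (volume.prod μ).withDensity fun z =>
      ENNReal.ofReal (hatPi A B C D q n s z.1)
        * (ENNReal.ofReal (hatPClosed C D q n s t z.1 (f z.2)) * g z.2) := by
  have h' := h.mono (revTime_lt hn hst).le (revTime_le_one n hs)
  have hX := hY.measurable_hatY (n := n) hs
  have hprob : IsProbabilityMeasure (P.map fun ω => (hatY Y n s ω, Z ω)) :=
    Measure.isProbabilityMeasure_map (hX.prodMk hZ).aemeasurable
  refine Measure.ext_prod fun {S G} hS hG => ?_
  have hpre : MeasurableSet ((fun x : ℝ => 2 * n * (1 - x)) ⁻¹' S) :=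
    (by fun_prop : Measurable fun x : ℝ => 2 * n * (1 - x)) hS
  have hφ : Measurable fun v => ∫⁻ u in S, ENNReal.ofReal (hatForward A B C D q n s t v u) :=
    (measurable_hatForward hn hst hs h).ennreal_ofReal.lintegral_prod_right'
  have hπ := (measurable_hatPi h).ennreal_ofReal
  have hπ' := (measurable_hatPi h').ennreal_ofReal
  have hP := (measurable_hatPClosed h (s := s)).ennreal_ofReal
  have hD : Measurable fun z : ℝ × E => ENNReal.ofReal (hatPi A B C D q n s z.1)
        * (ENNReal.ofReal (hatPClosed C D q n s t z.1 (f z.2)) * g z.2) :=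
    (hπ'.comp measurable_fst).mul ((hP.comp (measurable_fst.prodMk (hf.comp measurable_snd))).mul
      (hg.comp measurable_snd))
  -- The event `Z ⁻¹' G` lies in the past of the original time `revTime n t`, and the state to be
  -- prepended is reached from there by a forward transition.
  have hmarkov := hY.markov _ _ h.t_pos (revTime_lt hn hst) (revTime_le_one n hs) _ hpre
    (Z ⁻¹' G) (hZpast hG)
  have hset : (fun ω => (hatY Y n s ω, Z ω)) ⁻¹' (S ×ˢ G)
      = Z ⁻¹' G ∩ Y (revTime n s) ⁻¹' ((fun x : ℝ => 2 * n * (1 - x)) ⁻¹' S) := by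
    ext ω
    exact and_comm
  rw [Measure.map_apply (hX.prodMk hZ) (hS.prod hG), hset, hmarkov]
  calc ∫⁻ ω in Z ⁻¹' G, awTransition A B q (revTime n t) (revTime n s) (Y (revTime n t) ω)
        ((fun x => 2 * n * (1 - x)) ⁻¹' S) ∂P
      = ∫⁻ ω in Z ⁻¹' G, (fun z => ∫⁻ u in S,
          ENNReal.ofReal (hatForward A B C D q n s t (f z) u)) (Z ω) ∂P := by
        refine lintegral_congr_ae (ae_restrict_of_ae ?_)
        filter_upwards [hY.ae_hatY_mem hn (hs.trans hst.le) h] with ω hω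
        have hn' : (0 : ℝ) < n := by exact_mod_cast hn
        have e : Y (revTime n t) ω = 1 - hatY Y n t ω / (2 * n) := by
          rw [hatY]; field_simp; ring
        rw [e, awTransition_rescale hn hs hst h hω hS]
        simp only [hfZ]
    _ = ∫⁻ z in G, (∫⁻ u in S, ENNReal.ofReal (hatForward A B C D q n s t (f z) u))
          ∂(P.map Z) := (setLIntegral_map hG (hφ.comp hf) hZ).symm
    _ = ∫⁻ z in G, ∫⁻ u in S, ENNReal.ofReal (hatPi A B C D q n s u)
        * (ENNReal.ofReal (hatPClosed C D q n s t u (f z)) * g z) ∂volume ∂μ := by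
        have hφf : Measurable fun z => ∫⁻ u in S,
            ENNReal.ofReal (hatForward A B C D q n s t (f z) u) := hφ.comp hf
        have hπf : Measurable fun z => ENNReal.ofReal (hatPi A B C D q n t (f z)) * g z :=
          (hπ.comp hf).mul hg
        rw [hlaw, setLIntegral_withDensity_eq_setLIntegral_mul _ hπf hφf hG]
        refine setLIntegral_congr_fun hG fun z _ => ?_
        simp only [Pi.mul_apply]
        have hm : Measurable fun u => ENNReal.ofReal (hatForward A B C D q n s t (f z) u) :=
          ((measurable_hatForward hn hst hs h).comp measurable_prodMk_left).ennreal_ofReal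
        -- Bayes' formula under the integral replaces the forward transition and the marginal
        -- density at `t` by the marginal density at `s` and the backward transition.
        rw [mul_comm, ← lintegral_mul_const _ hm]
        refine lintegral_congr fun u => ?_
        rw [← mul_assoc, ofReal_hatForward_mul hn hs hst h, mul_assoc]
    _ = _ := by
        rw [withDensity_apply _ (hS.prod hG), ← Measure.prod_restrict,
          lintegral_prod_symm _ hD.aemeasurable]

theorem MeasureTheory.MeasurePreserving.map_withDensity_comp {α β : Type*} [MeasurableSpace α]
    [MeasurableSpace β] {μ : Measure α} {ν : Measure β} {e : α → β} (he : MeasurePreserving e μ ν)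
    {f : β → ENNReal} (hf : Measurable f) :
    (μ.withDensity (f ∘ e)).map e = ν.withDensity f := by
  ext S hS
  rw [Measure.map_apply he.measurable hS, withDensity_apply _ (he.measurable hS),
    withDensity_apply _ hS, ← he.setLIntegral_comp_preimage hS hf]
  rfl

theorem AWParams.measurable_pathDensity_hatPClosed {k : ℕ} {s₀ : ℝ} {s : Fin k → ℝ}
    (h : ∀ i, AWParams A B C D q (revTime n (s i))) :
    Measurable fun z : ℝ × (Fin k → ℝ) => pathDensity (hatPClosed C D q n) s₀ s z.1 z.2 :=
  measurable_pathDensity fun i => measurable_hatPClosed (h i)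

/-- Induction prepends the smallest rescaled time, with `Z` the path from the next time on, and
regroups coordinates by a volume-preserving map. -/
theorem IsAskeyWilsonProcess.map_hatY_path (hY : IsAskeyWilsonProcess A B C D q P Y) (hn : 0 < n)
    {k : ℕ} : ∀ {s₀ : ℝ} {s : Fin k → ℝ}, 0 ≤ s₀ →
    StrictMono (Fin.cons s₀ s : Fin (k + 1) → ℝ) → AWParams A B C D q (revTime n s₀) →
    (∀ i, AWParams A B C D q (revTime n (s i))) →
    P.map (fun ω => (hatY Y n s₀ ω, fun i => hatY Y n (s i) ω)) =
      (volume.prod volume).withDensity fun z => ENNReal.ofReal (hatPi A B C D q n s₀ z.1)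
        * ENNReal.ofReal (pathDensity (hatPClosed C D q n) s₀ s z.1 z.2) := by
  induction k with
  | zero =>
    intro s₀ s h0 _ h _
    have hX := hY.measurable_hatY (n := n) h0
    have hm : Measurable fun ω => (hatY Y n s₀ ω, fun i : Fin 0 => hatY Y n (s i) ω) :=
      hX.prodMk (measurable_pi_lambda _ fun i => i.elim0)
    have hprob := Measure.isProbabilityMeasure_map (μ := P) hm.aemeasurable
    refine Measure.ext_prod fun {S G} hS hG => ?_
    have hD : Measurable fun z : ℝ × (Fin 0 → ℝ) => ENNReal.ofReal (hatPi A B C D q n s₀ z.1) :=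
      (measurable_hatPi h).ennreal_ofReal.comp measurable_fst
    simp only [pathDensity, Finset.univ_eq_empty, Finset.prod_empty, ENNReal.ofReal_one, mul_one]
    rw [Measure.map_apply hm (hS.prod hG), withDensity_apply _ (hS.prod hG),
      setLIntegral_prod _ hD.aemeasurable]
    simp only [lintegral_const, Measure.restrict_apply MeasurableSet.univ, Set.univ_inter]
    -- `Fin 0 → ℝ` is one point of volume `1`, so `G` is empty or everything.
    rcases Set.eq_empty_or_nonempty G with rfl | hne
    · simp
    · obtain rfl := Subsingleton.eq_univ_of_nonempty hne
      rw [volume_univ_fin_zero]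
      simp only [mul_one]
      rw [← withDensity_apply _ hS, ← hY.map_hatY hn h0 h, Measure.map_apply hX hS]
      congr 1
      ext ω
      simp
  | succ k ih =>
    intro s₀ s h0 hs h hsi
    obtain ⟨h1, h2⟩ := strictMono_finCons hs
    have hs' : StrictMono (Fin.cons (s 0) (Fin.tail s) : Fin (k + 1) → ℝ) := by
      rwa [Fin.cons_self_tail]
    have h0' : 0 ≤ s 0 := h0.trans h1.le
    have hpos : ∀ i, s 0 ≤ s i := fun i => h2.monotone (Fin.zero_le i)
    have hpath := AWParams.measurable_pathDensity_hatPClosed (s₀ := s 0)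
      (s := Fin.tail s) fun i => hsi i.succ
    have hlaw := ih h0' hs' (hsi 0) fun i => hsi i.succ
    have hstep := hY.map_hatY_prod hn h0 h1 (hsi 0) (μ := volume.prod volume)
      (Z := fun ω => (hatY Y n (s 0) ω, fun i : Fin k => hatY Y n (Fin.tail s i) ω)) (f := Prod.fst)
      (g := fun z => ENNReal.ofReal (pathDensity (hatPClosed C D q n) (s 0) (Fin.tail s) z.1 z.2))
      ((hY.measurable_hatY h0').prodMk (measurable_pi_lambda _ fun i =>
        hY.measurable_hatY (h0'.trans (hpos i.succ))))
      ((measurable_awPast_hatY le_rfl).prodMk (measurable_awPast_path fun i => hpos i.succ))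
      measurable_fst (fun ω => rfl) hpath.ennreal_ofReal hlaw
    have he : MeasurePreserving
        (fun z : ℝ × (ℝ × (Fin k → ℝ)) => (z.1, (Fin.cons z.2.1 z.2.2 : Fin (k + 1) → ℝ)))
        (volume.prod (volume.prod volume)) (volume.prod volume) := by
      have hc := (volume_preserving_piFinSuccAbove (fun _ : Fin (k + 1) => ℝ) 0).symm
      have e : ⇑(MeasurableEquiv.piFinSuccAbove (fun _ : Fin (k + 1) => ℝ) 0).symm
          = fun z : ℝ × (Fin k → ℝ) => (Fin.cons z.1 z.2 : Fin (k + 1) → ℝ) :=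
        funext fun z => Fin.insertNth_zero' z.1 z.2
      rw [e] at hc
      exact (MeasurePreserving.id (volume : Measure ℝ)).prod hc
    have hD : Measurable fun z : ℝ × (Fin (k + 1) → ℝ) =>
        ENNReal.ofReal (hatPi A B C D q n s₀ z.1)
          * ENNReal.ofReal (pathDensity (hatPClosed C D q n) s₀ s z.1 z.2) :=
      ((measurable_hatPi h).ennreal_ofReal.comp measurable_fst).mul
        (AWParams.measurable_pathDensity_hatPClosed hsi).ennreal_ofReal
    rw [← he.map_withDensity_comp hD]
    have hdens : (fun z : ℝ × (Fin (k + 1) → ℝ) => ENNReal.ofReal (hatPi A B C D q n s₀ z.1)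
          * ENNReal.ofReal (pathDensity (hatPClosed C D q n) s₀ s z.1 z.2)) ∘
        (fun z : ℝ × (ℝ × (Fin k → ℝ)) => (z.1, (Fin.cons z.2.1 z.2.2 : Fin (k + 1) → ℝ)))
        = fun z => ENNReal.ofReal (hatPi A B C D q n s₀ z.1)
          * (ENNReal.ofReal (hatPClosed C D q n s₀ (s 0) z.1 z.2.1)
          * ENNReal.ofReal (pathDensity (hatPClosed C D q n) (s 0) (Fin.tail s) z.2.1 z.2.2)) := by
      funext z
      simp only [Function.comp]
      rw [pathDensity_cons, ENNReal.ofReal_mul (hatPClosed_nonneg hn h0 h1 (hsi 0) _ _)]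
    have hmeas : Measurable fun ω => (hatY Y n s₀ ω, hatY Y n (s 0) ω,
        fun i : Fin k => hatY Y n (Fin.tail s i) ω) :=
      (hY.measurable_hatY h0).prodMk ((hY.measurable_hatY h0').prodMk
        (measurable_pi_lambda _ fun i => hY.measurable_hatY (h0'.trans (hpos i.succ))))
    rw [hdens, ← hstep, Measure.map_map he.measurable hmeas]
    congr 1
    funext ω
    refine Prod.ext rfl (funext fun i => ?_)
    refine Fin.cases ?_ (fun j => ?_) i
    · simp
    · simp [Fin.tail]

end Law

end RescaledLaw

/-! ### Conditional laws of the rescaled process -/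

section Conditional

variable {A B C D q : ℝ} {Ω : Type*} [MeasurableSpace Ω] {P : Measure Ω} [IsProbabilityMeasure P]
  {Y : ℝ → Ω → ℝ} {n : ℕ}

theorem IsAskeyWilsonProcess.condDistrib_hatY (hY : IsAskeyWilsonProcess A B C D q P Y)
    (hn : 0 < n) {s t : ℝ} (hs : 0 ≤ s) (hst : s < t) (h : AWParams A B C D q (revTime n t))
    {K : ℝ} (hK : ∀ u, ∫⁻ v, ENNReal.ofReal (hatPClosed C D q n s t u v) ≤ ENNReal.ofReal K) :
    ∀ᵐ u ∂(P.map (hatY Y n s)), condDistrib (hatY Y n t) (hatY Y n s) P u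
      = volume.withDensity (fun v => ENNReal.ofReal (hatP A B C D q n s t u v)) := by
  have h' := h.mono (revTime_lt hn hst).le (revTime_le_one n hs)
  have ht := hs.trans hst.le
  simp_rw [hatP_eq hn hs hst h]
  refine condDistrib_of_density (hY.measurable_hatY hs) (hY.measurable_hatY ht)
    (measurable_hatPi h').ennreal_ofReal
    (ρ := fun u v => ENNReal.ofReal (hatPClosed C D q n s t u v))
    (measurable_hatPClosed h).ennreal_ofReal (hY.map_hatY hn hs h') ?_ ENNReal.ofReal_lt_top hK
  have := hY.map_hatY_prod hn hs hst h (μ := volume) (f := id) (g := fun _ => 1)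
    (hY.measurable_hatY ht) (measurable_awPast_hatY le_rfl) measurable_id (fun _ => rfl)
    measurable_const (by simpa using hY.map_hatY hn ht h)
  simpa using this

theorem IsAskeyWilsonProcess.condDistrib_hatY_path (hY : IsAskeyWilsonProcess A B C D q P Y)
    (hn : 0 < n) {k : ℕ} {s : Fin k → ℝ} (hs : StrictMono (Fin.cons 0 s : Fin (k + 1) → ℝ))
    (h : AWParams A B C D q (revTime n 0)) (hsi : ∀ i, AWParams A B C D q (revTime n (s i)))
    {K : ℝ} (hK : ∀ u, ∫⁻ y, ENNReal.ofReal (pathDensity (hatP A B C D q n) 0 s u y)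
      ≤ ENNReal.ofReal K) :
    ∀ᵐ u ∂(P.map (hatY Y n 0)),
      condDistrib (fun ω i => hatY Y n (s i) ω) (hatY Y n 0) P u
        = pathLaw (hatP A B C D q n) s u := by
  have heq : ∀ u y, pathDensity (hatP A B C D q n) 0 s u y
      = pathDensity (hatPClosed C D q n) 0 s u y := fun u y =>
    Finset.prod_congr rfl fun i _ => hatP_eq hn (finCons_castSucc_lt hs i).1
      (finCons_castSucc_lt hs i).2 (hsi i) _ _
  simp_rw [pathLaw_eq, heq] at hK ⊢
  have hpos : ∀ i, 0 ≤ s i := fun i =>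
    ((finCons_castSucc_lt hs i).1.trans_lt (finCons_castSucc_lt hs i).2).le
  exact condDistrib_of_density (hY.measurable_hatY le_rfl)
    (measurable_pi_lambda _ fun i => hY.measurable_hatY (hpos i))
    (measurable_hatPi h).ennreal_ofReal
    (ρ := fun u y => ENNReal.ofReal (pathDensity (hatPClosed C D q n) 0 s u y))
    (AWParams.measurable_pathDensity_hatPClosed hsi).ennreal_ofReal (hY.map_hatY hn le_rfl h)
    (hY.map_hatY_path hn le_rfl hs h hsi) ENNReal.ofReal_lt_top hK

end Conditional

theorem strictMono_finCons_zero {k : ℕ} {s : Fin k → ℝ} (hs : StrictMono s) (h : ∀ i, 0 < s i) :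
    StrictMono (Fin.cons 0 s : Fin (k + 1) → ℝ) := by
  intro i j
  refine Fin.cases ?_ (fun j => ?_) j
  · exact fun hij => absurd hij (Fin.not_lt_zero i)
  · refine Fin.cases (fun _ => ?_) (fun i hij => ?_) i
    · simpa using h j
    · simpa using hs (Fin.succ_lt_succ_iff.1 hij)

end

/-! ### The main theorem -/

theorem proposition4p1 (A B C D q : ℝ) (hq0 : 0 ≤ q) (hq1 : q < 1)
    (hA0 : 0 ≤ A) (hA1 : A ≤ 1) (hC0 : 0 ≤ C) (hC1 : C < 1)
    (hB0 : -1 < B) (hB1 : B ≤ 0) (hD0 : -1 < D) (hD1 : D ≤ 0) :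
    -- pointwise convergence of the transition densities
    (∀ s t u v : ℝ, 0 ≤ s → s < t → 0 ≤ u → 0 ≤ v →
      Tendsto (fun n : ℕ => hatP A B C D q n s t u v) atTop (𝓝 (tangentDensity s t u v))) ∧
    -- weak convergence of the conditional finite-dimensional laws
    (∀ (k : ℕ) (s : Fin k → ℝ) (u : ℝ), StrictMono s → (∀ i, 0 < s i) → 0 < u →
      IsProbabilityMeasure (pathLaw tangentDensity s u) ∧
      ∀ f : BoundedContinuousFunction (Fin k → ℝ) ℝ,
        Tendsto (fun n : ℕ => ∫ y, f y ∂(pathLaw (hatP A B C D q n) s u)) atTop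
          (𝓝 (∫ y, f y ∂(pathLaw tangentDensity s u)))) ∧
    -- asymptotics of the initial density
    (A < 1 → ∀ u : ℝ, 0 < u → Asymptotics.IsEquivalent atTop
      (fun n : ℕ => hatPi A B C D q n 0 u)
      (fun n : ℕ => tangentC1 A B C D q / (n : ℝ) ^ (3 / 2 : ℝ) * u ^ (1 / 2 : ℝ))) ∧
    (A = 1 → ∀ u : ℝ, 0 < u → Asymptotics.IsEquivalent atTop
      (fun n : ℕ => hatPi A B C D q n 0 u)
      (fun n : ℕ => tangentC2 B C D q / (n : ℝ) ^ (1 / 2 : ℝ) * (1 / u ^ (1 / 2 : ℝ)))) ∧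
    -- uniform upper bounds
    (A < 1 → ∃ c : ℝ, ∀ᶠ n : ℕ in atTop, ∀ u : ℝ, 0 < u →
      hatPi A B C D q n 0 u ≤ c / (n : ℝ) ^ (3 / 2 : ℝ) * u ^ (1 / 2 : ℝ)) ∧
    (A = 1 → ∃ c : ℝ, ∀ᶠ n : ℕ in atTop, ∀ u : ℝ, 0 < u →
      hatPi A B C D q n 0 u ≤ c / (n : ℝ) ^ (1 / 2 : ℝ) * (1 / u ^ (1 / 2 : ℝ))) ∧
    -- `hatPi` and `hatP` are the densities and transition densities of the rescaled process, and
    -- `pathLaw (hatP …)` is its conditional law given the initial value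
    (∀ (Ω : Type*) [MeasurableSpace Ω] (P : Measure Ω) [IsProbabilityMeasure P] (Y : ℝ → Ω → ℝ),
      IsAskeyWilsonProcess A B C D q P Y →
      (∀ s : ℝ, 0 ≤ s → ∀ᶠ n : ℕ in atTop,
        P.map (hatY Y n s)
          = volume.withDensity (fun u => ENNReal.ofReal (hatPi A B C D q n s u))) ∧
      (∀ s t : ℝ, 0 ≤ s → s < t → ∀ᶠ n : ℕ in atTop,
        ∀ᵐ u ∂(P.map (hatY Y n s)), condDistrib (hatY Y n t) (hatY Y n s) P u
          = volume.withDensity (fun v => ENNReal.ofReal (hatP A B C D q n s t u v))) ∧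
      (∀ (k : ℕ) (s : Fin k → ℝ), StrictMono s → (∀ i, 0 < s i) → ∀ᶠ n : ℕ in atTop,
        ∀ᵐ u ∂(P.map (hatY Y n 0)),
          condDistrib (fun ω i => hatY Y n (s i) ω) (hatY Y n 0) P u
            = pathLaw (hatP A B C D q n) s u)) := by
  have hpar := fun {t : ℝ} (ht : 0 ≤ t) =>
    eventually_AWParams hq0 hq1 hA0 hA1 hC0 hC1 hB0 hB1 hD0 hD1 ht
  -- `revTime n 0 = 1` for every `n`, so the eventual constraints at `t = 0` are constraints at time
  -- `1`.
  have hone : AWParams A B C D q 1 := by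
    obtain ⟨n, h⟩ := (hpar le_rfl).exists
    simpa [revTime] using h
  have hconv := densityConvergence_hatP hq0 hq1 hA0 hA1 hC0 hC1 hB0 hB1 hD0 hD1
  refine ⟨fun s t u v hs hst hu hv => ?_, fun k s u hs hpos hu => ?_, fun hA u hu => ?_,
    fun hA u hu => ?_, fun hA => ?_, fun hA => ?_, fun Ω _ P _ Y hY => ⟨fun s hs => ?_,
    fun s t hs hst => ?_, fun k s hs hpos => ?_⟩⟩
  · refine (tendsto_hatPClosed hq0 hq1 hC0 hC1 hD1 hst hu hv).congr' ?_
    filter_upwards [eventually_gt_atTop 0, hpar (hs.trans hst.le)] with n hn h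
      using (hatP_eq hn hs hst h u v).symm
  · have hs' := strictMono_finCons_zero hs hpos
    exact ⟨hconv.isProbabilityMeasure_pathLaw hs' hu,
      fun f => hconv.tendsto_integral_pathLaw hs' hu f⟩
  · exact isEquivalent_hatPi_of_lt hone hA hu
  · subst hA
    exact isEquivalent_hatPi_of_eq hone hu
  · exact exists_hatPi_le_of_lt hone hA
  · subst hA
    exact exists_hatPi_le_of_eq hone
  · filter_upwards [eventually_gt_atTop 0, hpar hs] with n hn h using hY.map_hatY hn hs h
  · obtain ⟨K, hK⟩ := exists_lintegral_hatPClosed_le hq0 hq1 hC0 hC1 hD0 hD1 hs hst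
    filter_upwards [eventually_gt_atTop 0, hpar (hs.trans hst.le), hK] with n hn h hKn
      using hY.condDistrib_hatY hn hs hst h hKn
  · have hs' := strictMono_finCons_zero hs hpos
    obtain ⟨K, -, hK⟩ := hconv.exists_lintegral_path_le le_rfl hs'
    filter_upwards [eventually_gt_atTop 0, hpar le_rfl,
      eventually_all.2 fun i => hpar (hpos i).le, hK] with n hn h hsi hKn
      using hY.condDistrib_hatY_path hn hs' h hsi hKn
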